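/- Let $R$ be a commutative $\mathbb Q$-algebra. All functors are defined on commutative $R$-algebras $S$. For an $R$-module $A$ let $\mathcal A(S)=A\otimes_R S$ and $\mathcal A^*(S)=\mathrm{Hom}_R(A,S)$ (the module scheme of $A$), let $\mathcal R(S)=S$, and put $\mathcal A^*\bar\otimes\mathcal B^*:=(\mathcal A\otimes\mathcal B)^*$. A formal monoid $\mathbb G=\mathrm{Spec}\,\mathcal A^*$, $\mathbb G(S)=\mathrm{Hom}_{\mathcal R\text{-alg}}(\mathcal A^*,\mathcal S)$ (where $\mathcal S(T)=T\otimes_R S$), is given by a commutative bialgebra scheme $\mathcal A^*$: an $R$-algebra $A$ together with a structure of functor of commutative $\mathcal R$-algebras on $\mathcal A^*$ such that the maps $\mathcal A^*\to\mathcal A^*\bar\otimes\mathcal A^*$ and $e\colon\mathcal A^*\to\mathcal R$, $e(f)=f(1)$, dual to the multiplication and to the unit of $A$, are morphisms of functors of $\mathcal R$-algebras. Morphisms $\mathrm{Spec}\,\mathcal A^*\to\mathrm{Spec}\,\mathcal B^*$ are by definition the morphisms of functors of $\mathcal R$-algebras $\mathcal B^*\to\mathcal A^*$ whose dual $A\to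 B$ is a morphism of $R$-algebras. Let $\mathcal I^*=\mathrm{Ker}\,e$, let $\mathcal I^{*n}$ be the closure among module schemes of the image of the multiplication $\mathcal I^*\otimes\cdots\otimes\mathcal I^*\to\mathcal A^*$ ($n$ factors), i.e. the module scheme of all forms that vanish on those $a\in A$ which are annihilated by every product of $n$ elements of $\mathcal I^*$. $\mathbb G$ is a flat infinitesimal formal group if (i) $A$ is a flat $R$-module; (ii) $\mathcal A^*=\varprojlim_n\mathcal A^*/\mathcal I^{*n}$, with quotients taken in the category of module schemes; (iii) $(\mathcal I^{*n})_{|S}=(\mathcal I^*_{|S})^n$ for all $n$ and all base changes $R\to S$; (iv) $\mathbb G$ is a functor of groups. Its tangent space is $T_e\mathbb G=\mathrm{Der}_{\mathcal R}(\mathcal A^*,\mathcal R)\subseteq\mathcal A^{**}(R)=A$, the set of $a\in A$ such that $(fg)(a)=f(1)g(a)+f(a)g(1)$ for all $S$ and all $f,g\in\mathcal A^*(S)$; it is a Lie subalgebra of $A$ for the commutator. A flat Lie algebra is a Lie $R$-algebra that is flat as an $R$-module. For a Lie algebra $L$, $\mathcal U(L)^*$ is the bialgebra scheme of the enveloping algebra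 $U(L)$ with the coproduct for which the elements of $L$ are primitive. **Theorem.** For every flat infinitesimal formal group $\mathbb G$, the Lie algebra $T_e\mathbb G$ is flat, and for every flat Lie algebra $L$, $\mathrm{Spec}\,\mathcal U(L)^*$ is a flat infinitesimal formal group. The functors $\mathbb G\mapsto T_e\mathbb G$ and $L\mapsto\mathrm{Spec}\,\mathcal U(L)^*$ are mutually quasi-inverse equivalences between the category of flat infinitesimal formal groups over $R$ and the category of flat Lie $R$-algebras. Moreover: 1. $\mathrm{Hom}_{grp}(\mathbb G,\mathbb G')\to\mathrm{Hom}_{Lie}(T_e\mathbb G,T_e\mathbb G')$ is bijective for all flat infinitesimal formal groups $\mathbb G,\mathbb G'$; 2. for $\mathbb G=\mathrm{Spec}\,\mathcal A^*$ flat infinitesimal, the canonical algebra morphism $U(T_e\mathbb G)\to A$ is dual to an isomorphism of formal groups $\mathrm{Spec}\,\mathcal U(T_e\mathbb G)^*\cong\mathbb G$; 3. for $L$ flat, the canonical map $L\to U(L)$ is an isomorphism of Lie algebras from $L$ onto $T_e(\mathrm{Spec}\,\mathcal U(L)^*)$. -/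

import Mathlib

universe u

open TensorProduct CategoryTheory

attribute [local instance 100] LieRing.ofAssociativeRing

noncomputable section

namespace FormalGrp

/-! ### Module schemes and algebra schemes

For an `R`-module `A`, the module scheme `𝒜*` is the functor `S ↦ Hom_R(A, S)` on commutative
`R`-algebras, with transition maps `f ↦ φ ∘ f` for `φ : S → T`. -/

section AlgebraScheme

variable (R : Type u) [CommRing R]

/-- The element `f ⊠ g : a ⊗ b ↦ f a * g b` of `(𝒜 ⊗ ℬ)*(S) = (𝒜* ⊗̄ ℬ*)(S)` attached to
`f ∈ 𝒜*(S)` and `g ∈ ℬ*(S)`. -/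
def extMul {R : Type u} [CommRing R] {A B : Type u} [AddCommGroup A] [Module R A]
    [AddCommGroup B] [Module R B] {S : Type u} [CommRing S] [Algebra R S]
    (f : A →ₗ[R] S) (g : B →ₗ[R] S) : A ⊗[R] B →ₗ[R] S :=
  LinearMap.mul' R S ∘ₗ TensorProduct.map f g

/-- A structure of functor of commutative (unital, associative) `ℛ`-algebras on the module scheme
`𝒜* : S ↦ Hom_R(A, S)`, i.e. a commutative algebra scheme with underlying module scheme `𝒜*`. -/
structure AlgebraScheme (A : Type u) [AddCommGroup A] [Module R A] where
  /-- The multiplication of `𝒜*(S)`; it is `S`-bilinear. -/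
  mul : ∀ (S : Type u) [CommRing S] [Algebra R S],
    (A →ₗ[R] S) →ₗ[S] (A →ₗ[R] S) →ₗ[S] (A →ₗ[R] S)
  /-- The unit of `𝒜*(S)`. -/
  one : ∀ (S : Type u) [CommRing S] [Algebra R S], A →ₗ[R] S
  protected mul_assoc : ∀ (S : Type u) [CommRing S] [Algebra R S] (f g h : A →ₗ[R] S),
    mul S (mul S f g) h = mul S f (mul S g h)
  protected mul_comm : ∀ (S : Type u) [CommRing S] [Algebra R S] (f g : A →ₗ[R] S),
    mul S f g = mul S g f
  protected one_mul : ∀ (S : Type u) [CommRing S] [Algebra R S] (f : A →ₗ[R] S), mul S (one S) f = f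
  /-- The transition maps are multiplicative. -/
  protected map_mul : ∀ (S T : Type u) [CommRing S] [Algebra R S] [CommRing T] [Algebra R T]
    (φ : S →ₐ[R] T) (f g : A →ₗ[R] S),
    mul T (φ.toLinearMap ∘ₗ f) (φ.toLinearMap ∘ₗ g) = φ.toLinearMap ∘ₗ mul S f g
  /-- The transition maps are unital. -/
  protected map_one : ∀ (S T : Type u) [CommRing S] [Algebra R S] [CommRing T] [Algebra R T]
    (φ : S →ₐ[R] T), φ.toLinearMap ∘ₗ one S = one T

variable {R}

/-- The product `f₁ ⋯ fₙ` in the algebra `𝒜*(S)`. -/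
def AlgebraScheme.prod {A : Type u} [AddCommGroup A] [Module R A] (D : AlgebraScheme R A)
    {S : Type u} [CommRing S] [Algebra R S] (l : List (A →ₗ[R] S)) : A →ₗ[R] S :=
  l.foldr (fun f g => D.mul S f g) (D.one S)

/-- `D₁₂` is the algebra scheme structure of `𝒜* ⊗̄ ℬ* = (𝒜 ⊗ ℬ)*`: the (unique) structure of
functor of `ℛ`-algebras for which the natural morphism `𝒜* ⊗ ℬ* → (𝒜 ⊗ ℬ)*` is a morphism of
functors of `ℛ`-algebras. -/
structure IsTensorScheme {A B : Type u} [AddCommGroup A] [Module R A] [AddCommGroup B] [Module R B]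
    (D₁ : AlgebraScheme R A) (D₂ : AlgebraScheme R B) (D₁₂ : AlgebraScheme R (A ⊗[R] B)) :
    Prop where
  mul_extMul : ∀ (S : Type u) [CommRing S] [Algebra R S] (f f' : A →ₗ[R] S) (g g' : B →ₗ[R] S),
    D₁₂.mul S (extMul f g) (extMul f' g') = extMul (D₁.mul S f f') (D₂.mul S g g')
  one_eq : ∀ (S : Type u) [CommRing S] [Algebra R S],
    D₁₂.one S = extMul (D₁.one S) (D₂.one S)

end AlgebraScheme

/-! ### Formal monoids, given by their commutative bialgebra schemes -/

/-- A formal monoid `𝔾 = Spec 𝒜*`, given by its commutative bialgebra scheme `𝒜*`: an `R`-module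
`A`, a structure of commutative algebra scheme on `𝒜*`, and a structure of `R`-algebra on `A` (that
is, of functor of `ℛ`-algebras on `𝒜`), such that the dual morphisms `m* : 𝒜* → 𝒜* ⊗̄ 𝒜*`,
`f ↦ f ∘ m`, of the multiplication and `u* : 𝒜* → ℛ`, `f ↦ f 1`, of the unit of `𝒜` are morphisms of
functors of `ℛ`-algebras. -/
structure FormalMonoid (R : Type u) [CommRing R] where
  /-- The module `A`. -/
  carrier : Type u
  [ring : Ring carrier]
  [algebra : Algebra R carrier]
  /-- The algebra scheme structure on `𝒜*`. -/
  scheme : AlgebraScheme R carrier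
  coproduct : ∃ D : AlgebraScheme R (carrier ⊗[R] carrier), IsTensorScheme scheme scheme D ∧
    ∀ (S : Type u) [CommRing S] [Algebra R S],
      (∀ f g : carrier →ₗ[R] S, scheme.mul S f g ∘ₗ LinearMap.mul' R carrier =
        D.mul S (f ∘ₗ LinearMap.mul' R carrier) (g ∘ₗ LinearMap.mul' R carrier)) ∧
      scheme.one S ∘ₗ LinearMap.mul' R carrier = D.one S
  counit : ∀ (S : Type u) [CommRing S] [Algebra R S],
    (∀ f g : carrier →ₗ[R] S, scheme.mul S f g 1 = f 1 * g 1) ∧ scheme.one S 1 = 1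

attribute [instance] FormalMonoid.ring FormalMonoid.algebra

/-- A morphism `𝔾 = Spec 𝒜* → 𝔾' = Spec ℬ*`: a morphism of bialgebra schemes `ℬ* → 𝒜*`, i.e. a
morphism of functors of `ℛ`-algebras whose dual morphism `𝒜 → ℬ` is a morphism of algebras. -/
@[ext]
structure FormalMonoid.Hom {R : Type u} [CommRing R] (G G' : FormalMonoid R) where
  /-- The component `ℬ*(S) → 𝒜*(S)`. -/
  app : ∀ (S : Type u) [CommRing S] [Algebra R S],
    (G'.carrier →ₗ[R] S) →ₗ[S] (G.carrier →ₗ[R] S)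
  natural : ∀ (S T : Type u) [CommRing S] [Algebra R S] [CommRing T] [Algebra R T]
    (φ : S →ₐ[R] T) (f : G'.carrier →ₗ[R] S),
    app T (φ.toLinearMap ∘ₗ f) = φ.toLinearMap ∘ₗ app S f
  map_mul : ∀ (S : Type u) [CommRing S] [Algebra R S] (f g : G'.carrier →ₗ[R] S),
    app S (G'.scheme.mul S f g) = G.scheme.mul S (app S f) (app S g)
  map_one : ∀ (S : Type u) [CommRing S] [Algebra R S], app S (G'.scheme.one S) = G.scheme.one S
  exists_dual : ∃ h : G.carrier →ₐ[R] G'.carrier, ∀ (S : Type u) [CommRing S] [Algebra R S]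
    (f : G'.carrier →ₗ[R] S), app S f = f ∘ₗ h.toLinearMap

instance (R : Type u) [CommRing R] : Category (FormalMonoid R) where
  Hom := FormalMonoid.Hom
  id G :=
    { app := fun S _ _ => LinearMap.id
      natural := fun _ _ _ _ _ _ _ _ => rfl
      map_mul := fun _ _ _ _ _ => rfl
      map_one := fun _ _ _ => rfl
      exists_dual := ⟨AlgHom.id R _, fun _ _ _ _ => rfl⟩ }
  comp {G G' G''} p q :=
    { app := fun S _ _ => p.app S ∘ₗ q.app S
      natural := fun S T _ _ _ _ φ f => by
        simp only [LinearMap.comp_apply, q.natural, p.natural]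
      map_mul := fun S _ _ f g => by
        simp only [LinearMap.comp_apply, q.map_mul, p.map_mul]
      map_one := fun S _ _ => by
        simp only [LinearMap.comp_apply, q.map_one, p.map_one]
      exists_dual := by
        obtain ⟨h, hh⟩ := p.exists_dual
        obtain ⟨k, hk⟩ := q.exists_dual
        refine ⟨k.comp h, fun S _ _ f => ?_⟩
        simp only [LinearMap.comp_apply, hh, hk]
        rfl }

/-! ### Square-zero extensions as test algebras -/

section SqZero

variable (R : Type u) [CommRing R] (A : Type u) [AddCommGroup A] [Module R A]

/-- The square-zero extension `R ⊕ A`. -/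
def SqZero : Type u := TrivSqZeroExt R A

instance : CommRing (SqZero R A) :=
  letI : Module Rᵐᵒᵖ A := Module.compHom A ((RingHom.id R).fromOpposite mul_comm)
  haveI : IsCentralScalar R A := ⟨fun _ _ => rfl⟩
  let i : CommRing (TrivSqZeroExt R A) := inferInstance
  i

instance : Algebra R (SqZero R A) :=
  letI : Module Rᵐᵒᵖ A := Module.compHom A ((RingHom.id R).fromOpposite mul_comm)
  haveI : IsCentralScalar R A := ⟨fun _ _ => rfl⟩
  let i : Algebra R (TrivSqZeroExt R A) := inferInstance
  i

/-- The inclusion of the ideal. -/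
def SqZero.inr : A →ₗ[R] SqZero R A where
  toFun a := TrivSqZeroExt.inr a
  map_add' _ _ := TrivSqZeroExt.inr_add _ _ _
  map_smul' _ _ := TrivSqZeroExt.inr_smul _ _ _

/-- The projection onto the ideal. -/
def SqZero.snd : SqZero R A →ₗ[R] A where
  toFun x := TrivSqZeroExt.snd x
  map_add' _ _ := rfl
  map_smul' _ _ := rfl

lemma SqZero.snd_comp_inr : SqZero.snd R A ∘ₗ SqZero.inr R A = LinearMap.id := rfl

lemma SqZero.inr_injective : Function.Injective (SqZero.inr R A) :=
  fun a b h => by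
    have := congrArg (SqZero.snd R A) h
    exact this

variable {R A} in
/-- A linear map `A → T` with square-zero image extends to `R ⊕ A`. -/
def SqZero.lift {T : Type u} [CommRing T] [Algebra R T] (f : A →ₗ[R] T)
    (hf : ∀ x y, f x * f y = 0) : SqZero R A →ₐ[R] T :=
  letI : Module Rᵐᵒᵖ A := Module.compHom A ((RingHom.id R).fromOpposite mul_comm)
  haveI : IsCentralScalar R A := ⟨fun _ _ => rfl⟩
  (TrivSqZeroExt.liftEquivOfComm ⟨f, hf⟩ : TrivSqZeroExt R A →ₐ[R] T)

variable {R A} in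
lemma SqZero.lift_apply {T : Type u} [CommRing T] [Algebra R T] (f : A →ₗ[R] T)
    (hf : ∀ x y, f x * f y = 0) (x : SqZero R A) :
    SqZero.lift f hf x = algebraMap R T (TrivSqZeroExt.fst x) + f (SqZero.snd R A x) := rfl

variable {R A} in
lemma SqZero.lift_inr {T : Type u} [CommRing T] [Algebra R T] (f : A →ₗ[R] T)
    (hf : ∀ x y, f x * f y = 0) (a : A) : SqZero.lift f hf (SqZero.inr R A a) = f a := by
  rw [SqZero.lift_apply]
  show algebraMap R T 0 + f a = f a
  rw [map_zero, zero_add]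

end SqZero

section Coproduct

variable {R : Type u} [CommRing R] {P : Type u} [AddCommGroup P] [Module R P]

/-- The algebra `S[ε₁, ε₂]` with `ε₁² = ε₂² = 0`, and its coefficient of `ε₁ ε₂`. -/
lemma exists_biDual (S : Type u) [CommRing S] [Algebra R S] :
    ∃ (T : Type u) (_ : CommRing T) (_ : Algebra R T) (c : S →ₐ[R] T) (e₁ e₂ : T)
      (coef : T →ₗ[R] S), e₁ * e₁ = 0 ∧ e₂ * e₂ = 0 ∧ (∀ s, coef (e₁ * e₂ * c s) = s) ∧
        (∀ s, coef (e₁ * c s) = 0) ∧ (∀ s, coef (e₂ * c s) = 0) ∧ (∀ s, coef (c s) = 0) := by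
  refine ⟨DualNumber (DualNumber S), inferInstance, inferInstance,
    (TrivSqZeroExt.inlAlgHom R (DualNumber S) (DualNumber S)).comp (TrivSqZeroExt.inlAlgHom R S S),
    TrivSqZeroExt.inl DualNumber.eps, DualNumber.eps,
    ((TrivSqZeroExt.sndHom S S).restrictScalars R) ∘ₗ
      ((TrivSqZeroExt.sndHom (DualNumber S) (DualNumber S)).restrictScalars R),
    ?_, DualNumber.eps_mul_eps, fun s => ?_, fun s => ?_, fun s => ?_, fun s => ?_⟩
  · rw [← TrivSqZeroExt.inl_mul, DualNumber.eps_mul_eps, TrivSqZeroExt.inl_zero]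
  · have h : TrivSqZeroExt.snd (TrivSqZeroExt.snd
        ((TrivSqZeroExt.inl DualNumber.eps * DualNumber.eps *
          TrivSqZeroExt.inl (TrivSqZeroExt.inl s) : DualNumber (DualNumber S)))) = s := by
      simp [TrivSqZeroExt.snd_mul, DualNumber.snd_eps, DualNumber.fst_eps]
    exact h
  · have h : TrivSqZeroExt.snd (TrivSqZeroExt.snd
        ((TrivSqZeroExt.inl DualNumber.eps *
          TrivSqZeroExt.inl (TrivSqZeroExt.inl s) : DualNumber (DualNumber S)))) = 0 := by
      simp [TrivSqZeroExt.snd_mul]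
    exact h
  · have h : TrivSqZeroExt.snd (TrivSqZeroExt.snd
        ((DualNumber.eps *
          TrivSqZeroExt.inl (TrivSqZeroExt.inl s) : DualNumber (DualNumber S)))) = 0 := by
      simp [TrivSqZeroExt.snd_mul, DualNumber.snd_eps, DualNumber.fst_eps]
    exact h
  · have h : TrivSqZeroExt.snd (TrivSqZeroExt.snd
        ((TrivSqZeroExt.inl (TrivSqZeroExt.inl s) : DualNumber (DualNumber S)))) = 0 := by
      simp
    exact h

/-- The map `P → P ⊗ P` dual to the multiplication of an algebra scheme `𝒫*`. -/
def AlgebraScheme.comul (D : AlgebraScheme R P) : P →ₗ[R] P ⊗[R] P :=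
  TensorProduct.map (SqZero.snd R P) (SqZero.snd R P) ∘ₗ
    D.mul (SqZero R P ⊗[R] SqZero R P)
      ((Algebra.TensorProduct.includeLeft : SqZero R P →ₐ[R] _).toLinearMap ∘ₗ SqZero.inr R P)
      ((Algebra.TensorProduct.includeRight : SqZero R P →ₐ[R] _).toLinearMap ∘ₗ SqZero.inr R P)

lemma AlgebraScheme.mul_eq (D : AlgebraScheme R P) (S : Type u) [CommRing S] [Algebra R S]
    (f g : P →ₗ[R] S) : D.mul S f g = extMul f g ∘ₗ D.comul := by
  obtain ⟨T, _, _, c, e₁, e₂, coef, h₁, h₂, c₁₂, c₁, c₂, c₀⟩ := exists_biDual (R := R) S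
  have k₁ : ∀ x y, (e₁ • (c.toLinearMap ∘ₗ f)) x * (e₁ • (c.toLinearMap ∘ₗ f)) y = 0 := by
    intro x y
    simp only [LinearMap.smul_apply, smul_eq_mul]
    rw [mul_mul_mul_comm, h₁, zero_mul]
  have k₂ : ∀ x y, (e₂ • (c.toLinearMap ∘ₗ g)) x * (e₂ • (c.toLinearMap ∘ₗ g)) y = 0 := by
    intro x y
    simp only [LinearMap.smul_apply, smul_eq_mul]
    rw [mul_mul_mul_comm, h₂, zero_mul]
  let φ : SqZero R P ⊗[R] SqZero R P →ₐ[R] T :=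
    Algebra.TensorProduct.lift (SqZero.lift _ k₁) (SqZero.lift _ k₂) (fun _ _ => Commute.all _ _)
  have hφ₁ : φ.toLinearMap ∘ₗ
      ((Algebra.TensorProduct.includeLeft : SqZero R P →ₐ[R] _).toLinearMap ∘ₗ SqZero.inr R P)
      = e₁ • (c.toLinearMap ∘ₗ f) := by
    ext x : 1
    simp only [φ, LinearMap.comp_apply, AlgHom.toLinearMap_apply,
      Algebra.TensorProduct.includeLeft_apply, Algebra.TensorProduct.lift_tmul, map_one, mul_one,
      SqZero.lift_inr, LinearMap.smul_apply]
  have hφ₂ : φ.toLinearMap ∘ₗ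
      ((Algebra.TensorProduct.includeRight : SqZero R P →ₐ[R] _).toLinearMap ∘ₗ SqZero.inr R P)
      = e₂ • (c.toLinearMap ∘ₗ g) := by
    ext x : 1
    simp only [φ, LinearMap.comp_apply, AlgHom.toLinearMap_apply,
      Algebra.TensorProduct.includeRight_apply, Algebra.TensorProduct.lift_tmul, map_one, one_mul,
      SqZero.lift_inr, LinearMap.smul_apply]
  have key := D.map_mul _ T φ
    ((Algebra.TensorProduct.includeLeft : SqZero R P →ₐ[R] _).toLinearMap ∘ₗ SqZero.inr R P)
    ((Algebra.TensorProduct.includeRight : SqZero R P →ₐ[R] _).toLinearMap ∘ₗ SqZero.inr R P)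
  rw [hφ₁, hφ₂, map_smul, map_smul, LinearMap.smul_apply, smul_smul, D.map_mul] at key
  have hpair : ∀ z : SqZero R P ⊗[R] SqZero R P,
      coef (φ z) = extMul f g (TensorProduct.map (SqZero.snd R P) (SqZero.snd R P) z) := by
    intro z
    induction z with
    | zero => simp
    | add x y hx hy => simp only [map_add, hx, hy]
    | tmul x y =>
      have a₁ : ∀ r : R, ∀ t : T, coef (algebraMap R T r * t) = r • coef t := fun r t => by
        rw [← Algebra.smul_def, map_smul]
      have a₂ : ∀ r : R, coef (algebraMap R T r) = 0 := fun r => by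
        rw [← c.commutes, c₀]
      have a₃ : e₁ * c (f (SqZero.snd R P x)) * (e₂ * c (g (SqZero.snd R P y))) =
          e₁ * e₂ * c (f (SqZero.snd R P x) * g (SqZero.snd R P y)) := by
        rw [map_mul]; ring
      simp only [φ, Algebra.TensorProduct.lift_tmul, SqZero.lift_apply, TensorProduct.map_tmul,
        extMul, LinearMap.comp_apply, LinearMap.mul'_apply, LinearMap.smul_apply, smul_eq_mul,
        AlgHom.toLinearMap_apply]
      rw [add_mul, mul_add, mul_add, map_add, map_add, map_add, a₁, a₁, a₂, c₂, a₃, c₁₂,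
        mul_comm _ (algebraMap R T _), a₁, c₁]
      simp
  ext x
  have := congrArg (fun q => coef (q x)) key
  simp only [LinearMap.smul_apply, LinearMap.comp_apply, AlgHom.toLinearMap_apply,
    smul_eq_mul] at this
  rw [mul_comm e₂ e₁, c₁₂, hpair] at this
  exact this

end Coproduct

/-! ### The tangent Lie algebra -/

section Tangent

variable {R : Type u} [CommRing R]

/-- Elements of `(A ⊗ B) ⊗ (A ⊗ B)` are separated by the morphisms `(f ⊠ g) ⊠ (f' ⊠ g')`. -/
lemma tensor_ext {A B : Type u} [AddCommGroup A] [Module R A] [AddCommGroup B] [Module R B]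
    (t t' : (A ⊗[R] B) ⊗[R] (A ⊗[R] B))
    (h : ∀ (S : Type u) [CommRing S] [Algebra R S] (f f' : A →ₗ[R] S) (g g' : B →ₗ[R] S),
      extMul (extMul f g) (extMul f' g') t = extMul (extMul f g) (extMul f' g') t') : t = t' := by
  let E := SqZero R A ⊗[R] SqZero R B
  let l₁ : SqZero R A →ₐ[R] E := Algebra.TensorProduct.includeLeft
  let l₂ : SqZero R B →ₐ[R] E := Algebra.TensorProduct.includeRight
  let k₁ : E →ₐ[R] E ⊗[R] E := Algebra.TensorProduct.includeLeft
  let k₂ : E →ₐ[R] E ⊗[R] E := Algebra.TensorProduct.includeRight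
  have key := h (E ⊗[R] E) ((k₁.comp l₁).toLinearMap ∘ₗ SqZero.inr R A)
    ((k₂.comp l₁).toLinearMap ∘ₗ SqZero.inr R A) ((k₁.comp l₂).toLinearMap ∘ₗ SqZero.inr R B)
    ((k₂.comp l₂).toLinearMap ∘ₗ SqZero.inr R B)
  have e : extMul (extMul ((k₁.comp l₁).toLinearMap ∘ₗ SqZero.inr R A)
      ((k₁.comp l₂).toLinearMap ∘ₗ SqZero.inr R B))
      (extMul ((k₂.comp l₁).toLinearMap ∘ₗ SqZero.inr R A)
      ((k₂.comp l₂).toLinearMap ∘ₗ SqZero.inr R B)) =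
      TensorProduct.map (TensorProduct.map (SqZero.inr R A) (SqZero.inr R B))
        (TensorProduct.map (SqZero.inr R A) (SqZero.inr R B)) := by
    have hl : ∀ x y, l₁ x * l₂ y = x ⊗ₜ y := fun x y =>
      (Algebra.TensorProduct.tmul_mul_tmul x 1 1 y).trans (by rw [mul_one, one_mul]; rfl)
    have hk : ∀ x y, k₁ x * k₂ y = x ⊗ₜ y := fun x y =>
      (Algebra.TensorProduct.tmul_mul_tmul x 1 1 y).trans (by rw [mul_one, one_mul])
    ext a b c d
    simp only [extMul, AlgebraTensorModule.curry_apply, curry_apply, LinearMap.coe_restrictScalars,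
      LinearMap.comp_apply, TensorProduct.map_tmul, LinearMap.mul'_apply,
      AlgHom.toLinearMap_apply, AlgHom.comp_apply, ← map_mul, hl, hk]
  rw [e] at key
  have key2 := congrArg (TensorProduct.map (TensorProduct.map (SqZero.snd R A) (SqZero.snd R B))
    (TensorProduct.map (SqZero.snd R A) (SqZero.snd R B))) key
  simpa only [← LinearMap.comp_apply, ← TensorProduct.map_comp, SqZero.snd_comp_inr,
    TensorProduct.map_id, LinearMap.id_apply] using key2

/-- `a ∈ A = 𝒜**(R)`, seen as the `ℛ`-linear form `f ↦ f a` on `𝒜*`, is a derivation at the unit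
`e` of `𝔾` (recall that the counit of `𝒜*` is `f ↦ f 1`). -/
def IsTangent (G : FormalMonoid R) (a : G.carrier) : Prop :=
  ∀ (S : Type u) [CommRing S] [Algebra R S] (f g : G.carrier →ₗ[R] S),
    G.scheme.mul S f g a = f 1 * g a + f a * g 1

lemma mul_apply_mul (G : FormalMonoid R) {a b : G.carrier} (ha : IsTangent G a)
    (hb : IsTangent G b) (S : Type u) [CommRing S] [Algebra R S] (f g : G.carrier →ₗ[R] S) :
    G.scheme.mul S f g (a * b) = f (a * b) * g 1 + f a * g b + f b * g a + f 1 * g (a * b) := by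
  obtain ⟨D, hD, hm⟩ := G.coproduct
  have ht : D.comul (a ⊗ₜ b) = (a ⊗ₜ b) ⊗ₜ (1 ⊗ₜ 1) + (a ⊗ₜ 1) ⊗ₜ (1 ⊗ₜ b) +
      (1 ⊗ₜ b) ⊗ₜ (a ⊗ₜ 1) + (1 ⊗ₜ 1) ⊗ₜ (a ⊗ₜ b) := by
    refine tensor_ext _ _ fun S _ _ f f' g g' => ?_
    have h := congrArg (fun q => q (a ⊗ₜ[R] b)) (hD.mul_extMul S f f' g g')
    simp only [D.mul_eq] at h
    rw [LinearMap.comp_apply] at h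
    rw [h]
    simp only [extMul, LinearMap.comp_apply, TensorProduct.map_tmul, LinearMap.mul'_apply, ha S f f',
      hb S g g', map_add]
    ring
  have h := congrArg (fun q => q (a ⊗ₜ[R] b)) ((hm S).1 f g)
  simp only [D.mul_eq] at h
  rw [LinearMap.comp_apply, LinearMap.comp_apply, ht, LinearMap.mul'_apply] at h
  rw [h]
  simp only [extMul, LinearMap.comp_apply, TensorProduct.map_tmul, LinearMap.mul'_apply, map_add,
    mul_one, one_mul]

/-- The tangent space `T_e 𝔾 = Der_ℛ(𝒜*, ℛ) ⊆ A`, a Lie subalgebra of `A` with its commutator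
bracket. -/
def tangentSpace (G : FormalMonoid R) : LieSubalgebra R G.carrier where
  carrier := {a | IsTangent G a}
  zero_mem' := fun S _ _ f g => by simp
  add_mem' := fun {a b} ha hb S _ _ f g => by
    rw [map_add, ha S f g, hb S f g, map_add, map_add]
    ring
  smul_mem' := fun r a ha S _ _ f g => by
    rw [map_smul, ha S f g, map_smul, map_smul, smul_add, mul_smul_comm, smul_mul_assoc]
  lie_mem' := fun {a b} ha hb S _ _ f g => by
    have ha' : IsTangent G a := ha
    have hb' : IsTangent G b := hb
    rw [LieRing.of_associative_ring_bracket, map_sub, mul_apply_mul G ha' hb', mul_apply_mul G hb' ha',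
      map_sub, map_sub]
    ring

/-- The algebra morphism `A → B` dual to a morphism `Spec 𝒜* → Spec ℬ*`. -/
def FormalMonoid.Hom.dual {G G' : FormalMonoid R} (p : G ⟶ G') : G.carrier →ₐ[R] G'.carrier :=
  (FormalMonoid.Hom.exists_dual p).choose

lemma FormalMonoid.Hom.app_eq {G G' : FormalMonoid R} (p : G ⟶ G') (S : Type u) [CommRing S]
    [Algebra R S] (f : G'.carrier →ₗ[R] S) :
    FormalMonoid.Hom.app p S f = f ∘ₗ (FormalMonoid.Hom.dual p).toLinearMap :=
  (FormalMonoid.Hom.exists_dual p).choose_spec S f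

lemma FormalMonoid.Hom.dual_unique {G G' : FormalMonoid R} (p : G ⟶ G')
    (h : G.carrier →ₐ[R] G'.carrier)
    (hh : ∀ (S : Type u) [CommRing S] [Algebra R S] (f : G'.carrier →ₗ[R] S),
      FormalMonoid.Hom.app p S f = f ∘ₗ h.toLinearMap) : FormalMonoid.Hom.dual p = h := by
  ext a
  apply SqZero.inr_injective R G'.carrier
  have h₁ := FormalMonoid.Hom.app_eq p _ (SqZero.inr R G'.carrier)
  rw [hh] at h₁
  exact (congrArg (fun q => q a) h₁).symm

lemma FormalMonoid.Hom.dual_id (G : FormalMonoid R) :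
    FormalMonoid.Hom.dual (𝟙 G) = AlgHom.id R G.carrier :=
  FormalMonoid.Hom.dual_unique _ _ fun _ _ _ _ => rfl

lemma FormalMonoid.Hom.dual_comp {G G' G'' : FormalMonoid R} (p : G ⟶ G') (q : G' ⟶ G'') :
    FormalMonoid.Hom.dual (p ≫ q) =
      (FormalMonoid.Hom.dual q).comp (FormalMonoid.Hom.dual p) := by
  refine FormalMonoid.Hom.dual_unique _ _ fun S _ _ f => ?_
  show FormalMonoid.Hom.app p S (FormalMonoid.Hom.app q S f) = _
  rw [FormalMonoid.Hom.app_eq, FormalMonoid.Hom.app_eq]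
  rfl

lemma FormalMonoid.Hom.isTangent_dual {G G' : FormalMonoid R} (p : G ⟶ G') {a : G.carrier}
    (ha : IsTangent G a) : IsTangent G' (FormalMonoid.Hom.dual p a) := by
  intro S _ _ f g
  have h := congrArg (fun q => q a) (FormalMonoid.Hom.map_mul p S f g)
  simp only [FormalMonoid.Hom.app_eq] at h
  rw [ha S] at h
  simpa using h

end Tangent

/-- A Lie algebra over `R`. -/
structure LieAlgCat (R : Type u) [CommRing R] where
  /-- The underlying module. -/
  carrier : Type u
  [lieRing : LieRing carrier]
  [lieAlgebra : LieAlgebra R carrier]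

attribute [instance] LieAlgCat.lieRing LieAlgCat.lieAlgebra

instance (R : Type u) [CommRing R] : Category (LieAlgCat R) where
  Hom L L' := L.carrier →ₗ⁅R⁆ L'.carrier
  id L := LieHom.id
  comp f g := LieHom.comp g f

/-- The Lie algebra homomorphism underlying a morphism of `LieAlgCat R`. -/
def LieAlgCat.toLieHom {R : Type u} [CommRing R] {L L' : LieAlgCat R} (p : L ⟶ L') :
    L.carrier →ₗ⁅R⁆ L'.carrier := p

/-- The functor `𝔾 ↦ T_e 𝔾` from formal monoids to Lie algebras; on a morphism `Spec 𝒜* → Spec ℬ*`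
it is the restriction of the dual morphism `A → B`. -/
def tangentFunctor (R : Type u) [CommRing R] : FormalMonoid R ⥤ LieAlgCat R where
  obj G := ⟨tangentSpace G⟩
  map {G G'} p :=
    { toFun := fun a => ⟨FormalMonoid.Hom.dual p a.1, FormalMonoid.Hom.isTangent_dual p a.2⟩
      map_add' := fun a b => Subtype.ext (map_add (FormalMonoid.Hom.dual p) a.1 b.1)
      map_smul' := fun r a => Subtype.ext (map_smul (FormalMonoid.Hom.dual p) r a.1)
      map_lie' := fun {a b} => Subtype.ext (by
        show FormalMonoid.Hom.dual p ⁅a.1, b.1⁆ =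
          ⁅FormalMonoid.Hom.dual p a.1, FormalMonoid.Hom.dual p b.1⁆
        simp only [LieRing.of_associative_ring_bracket, map_sub, map_mul]) }
  map_id G := by
    refine LieHom.ext fun a => Subtype.ext ?_
    show FormalMonoid.Hom.dual (𝟙 G) a.1 = a.1
    rw [FormalMonoid.Hom.dual_id]
    rfl
  map_comp {G G' G''} p q := by
    refine LieHom.ext fun a => Subtype.ext ?_
    show FormalMonoid.Hom.dual (p ≫ q) a.1 =
      FormalMonoid.Hom.dual q (FormalMonoid.Hom.dual p a.1)
    rw [FormalMonoid.Hom.dual_comp]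
    rfl

/-! ### Infinitesimal formal groups -/

section Infinitesimal

variable {R : Type u} [CommRing R]

/-- The augmentation ideal scheme `ℐ* = Ker (e : 𝒜* → ℛ)`, where `e` is the counit `f ↦ f 1`. -/
def augIdeal (G : FormalMonoid R) (S : Type u) [CommRing S] [Algebra R S] :
    Set (G.carrier →ₗ[R] S) :=
  {f | f 1 = 0}

/-- `A_n = (𝒜*/ℐ*ⁿ⁺¹)*(R) ⊆ A`: the elements of `A` annihilated by all products of `n + 1` elements
of `ℐ*`. The quotient `A → A/A_n` is the image of `A` in `((ℐ*)^{⊗ n+1})*(R)`. -/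
def annPow (G : FormalMonoid R) (n : ℕ) : Submodule R G.carrier where
  carrier := {a | ∀ (S : Type u) [CommRing S] [Algebra R S] (l : List (G.carrier →ₗ[R] S)),
    l.length = n + 1 → (∀ f ∈ l, f ∈ augIdeal G S) → G.scheme.prod l a = 0}
  zero_mem' := fun _ _ _ _ _ _ => map_zero _
  add_mem' := fun ha hb S _ _ l hl hI => by rw [map_add, ha S l hl hI, hb S l hl hI, add_zero]
  smul_mem' := fun r a ha S _ _ l hl hI => by rw [map_smul, ha S l hl hI, smul_zero]

/-- The power `ℐ*ⁿ⁺¹`: the closure, among module schemes, of the image of `(ℐ*)^{⊗ n+1} → 𝒜*`. It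
is the module scheme of the forms vanishing on `A_n`. -/
def idealPow (G : FormalMonoid R) (n : ℕ) (S : Type u) [CommRing S] [Algebra R S] :
    Set (G.carrier →ₗ[R] S) :=
  {f | ∀ a ∈ annPow G n, f a = 0}

/-- For an `S`-algebra `T`, with structure morphism `φ`, the `S`-linear form
`S ⊗ A → T`, `s ⊗ a ↦ φ s * f a` corresponding to `f : A → T`. -/
def baseForm {S T A : Type u} [CommRing S] [Algebra R S] [CommRing T] [Algebra R T]
    [AddCommGroup A] [Module R A] (φ : S →ₐ[R] T) (f : A →ₗ[R] T) : S ⊗[R] A →ₗ[R] T :=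
  extMul φ.toLinearMap LinearMap.id ∘ₗ TensorProduct.map LinearMap.id f

/-- The analogue of `A_n` for the base change of `𝒜*` to `S`: the elements of `S ⊗ A` annihilated
by all products of `n + 1` elements of `ℐ*_{|S}(T) = ℐ*(T)`, for all `S`-algebras `T`. -/
def annPowBase (G : FormalMonoid R) (n : ℕ) (S : Type u) [CommRing S] [Algebra R S] :
    Set (S ⊗[R] G.carrier) :=
  {x | ∀ (T : Type u) [CommRing T] [Algebra R T] (φ : S →ₐ[R] T) (l : List (G.carrier →ₗ[R] T)),
    l.length = n + 1 → (∀ f ∈ l, f ∈ augIdeal G T) → baseForm φ (G.scheme.prod l) x = 0}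

/-- The power `(ℐ*_{|S})ⁿ⁺¹` of the augmentation ideal of the base change of `𝒜*` to `S`, evaluated
at the `S`-algebra `T` with structure morphism `φ`. -/
def idealPowBase (G : FormalMonoid R) (n : ℕ) {S T : Type u} [CommRing S] [Algebra R S]
    [CommRing T] [Algebra R T] (φ : S →ₐ[R] T) : Set (G.carrier →ₗ[R] T) :=
  {f | ∀ x ∈ annPowBase G n S, baseForm φ f x = 0}

/-- A morphism of functors of `ℛ`-modules from the module scheme `𝒫*` to the quasi-coherent module
`T ↦ T ⊗ N`. -/
structure SchemeModHom (R : Type u) [CommRing R] (P N : Type u) [AddCommGroup P] [Module R P]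
    [AddCommGroup N] [Module R N] where
  /-- The component at `T`. -/
  app : ∀ (T : Type u) [CommRing T] [Algebra R T], (P →ₗ[R] T) →ₗ[T] T ⊗[R] N
  natural : ∀ (T T' : Type u) [CommRing T] [Algebra R T] [CommRing T'] [Algebra R T']
    (φ : T →ₐ[R] T') (f : P →ₗ[R] T),
    app T' (φ.toLinearMap ∘ₗ f) = TensorProduct.map φ.toLinearMap LinearMap.id (app T f)

/-- The set `𝔾(S) = (Spec 𝒜*)(S)` of morphisms of functors of `ℛ`-algebras from `𝒜*` to
`𝒮 : T ↦ T ⊗ S`. -/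
structure SpecPoint (G : FormalMonoid R) (S : Type u) [CommRing S] [Algebra R S] extends
    SchemeModHom R G.carrier S where
  map_mul : ∀ (T : Type u) [CommRing T] [Algebra R T] (f g : G.carrier →ₗ[R] T),
    app T (G.scheme.mul T f g) = app T f * app T g
  map_one : ∀ (T : Type u) [CommRing T] [Algebra R T], app T (G.scheme.one T) = 1

/-- The point `z` is the product `x · y` in the monoid `𝔾(S)`: it is the composition of
`m* : 𝒜* → 𝒜* ⊗̄ 𝒜* = (𝒜 ⊗ 𝒜)*` with the (unique) morphism `w = x ⊗ y` from `(𝒜 ⊗ 𝒜)*` to `𝒮`. -/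
def IsSpecMul {G : FormalMonoid R} {S : Type u} [CommRing S] [Algebra R S]
    (x y z : SpecPoint G S) : Prop :=
  ∃ w : SchemeModHom R (G.carrier ⊗[R] G.carrier) S,
    ∀ (T : Type u) [CommRing T] [Algebra R T],
      (∀ f g : G.carrier →ₗ[R] T, w.app T (extMul f g) = x.app T f * y.app T g) ∧
      ∀ f : G.carrier →ₗ[R] T, z.app T f = w.app T (f ∘ₗ LinearMap.mul' R G.carrier)

/-- The unit of the monoid `𝔾(S)`: the composition of the counit `e : 𝒜* → ℛ` with `ℛ → 𝒮`. -/
def specOne (G : FormalMonoid R) (S : Type u) [CommRing S] [Algebra R S] : SpecPoint G S where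
  app T _ _ :=
    { toFun := fun f => f 1 ⊗ₜ[R] (1 : S)
      map_add' := fun f g => by rw [LinearMap.add_apply, TensorProduct.add_tmul]
      map_smul' := fun t f => by rw [LinearMap.smul_apply, TensorProduct.smul_tmul']; rfl }
  natural T T' _ _ _ _ φ f := by simp
  map_mul T _ _ f g := by
    show G.scheme.mul T f g 1 ⊗ₜ[R] (1 : S) = f 1 ⊗ₜ[R] (1 : S) * g 1 ⊗ₜ[R] (1 : S)
    rw [(G.counit T).1, Algebra.TensorProduct.tmul_mul_tmul, mul_one]
  map_one T _ _ := by
    show G.scheme.one T 1 ⊗ₜ[R] (1 : S) = 1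
    rw [(G.counit T).2, Algebra.TensorProduct.one_def]

/-- The formal monoid `𝔾 = Spec 𝒜*` is a flat infinitesimal formal group. -/
structure IsFlatInfinitesimalGroup (G : FormalMonoid R) : Prop where
  /-- `A` is a flat `R`-module. -/
  flat : Module.Flat R G.carrier
  /-- `𝒜*` is the inverse limit of the `𝒜*/ℐ*ⁿ⁺¹` in the category of module schemes, where
  `𝒜*/ℐ*ⁿ⁺¹` is the module scheme `S ↦ Hom_R(A_n, S)`. -/
  complete : ∀ (S : Type u) [CommRing S] [Algebra R S] (g : ∀ n, annPow G n →ₗ[R] S),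
    (∀ n m, n ≤ m → ∀ (a : G.carrier) (ha : a ∈ annPow G n) (ha' : a ∈ annPow G m),
      g m ⟨a, ha'⟩ = g n ⟨a, ha⟩) →
    ∃! f : G.carrier →ₗ[R] S, ∀ n (a : annPow G n), f a = g n a
  /-- `(ℐ*ⁿ⁺¹)_{|S} = (ℐ*_{|S})ⁿ⁺¹` for all base changes `R → S`. -/
  baseChange : ∀ (n : ℕ) (S T : Type u) [CommRing S] [Algebra R S] [CommRing T] [Algebra R T]
    (φ : S →ₐ[R] T), idealPow G n T = idealPowBase G n φ
  /-- `𝔾` is a functor of groups. -/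
  group : ∀ (S : Type u) [CommRing S] [Algebra R S] (x : SpecPoint G S),
    ∃ y : SpecPoint G S, IsSpecMul x y (specOne G S) ∧ IsSpecMul y x (specOne G S)

end Infinitesimal

/-! ### The formal monoid `Spec 𝒰(L)*` -/

section Enveloping

variable {R : Type u} [CommRing R]

/-- The algebra scheme `𝒞*` of a cocommutative coalgebra `C`, with the convolution product. -/
def AlgebraScheme.ofCoalgebra (C : Type u) [AddCommGroup C] [Module R C] [Coalgebra R C]
    [Coalgebra.IsCocomm R C] : AlgebraScheme R C where
  mul S _ _ := LinearMap.mk₂ S (fun f g => extMul f g ∘ₗ Coalgebra.comul)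
    (fun f f' g => by ext; simp [extMul, TensorProduct.map_add_left])
    (fun s f g => by
      have : extMul (s • f) g = s • extMul f g := by ext; simp [extMul, mul_assoc]
      rw [this, LinearMap.smul_comp])
    (fun f g g' => by ext; simp [extMul, TensorProduct.map_add_right])
    (fun s f g => by
      have : extMul f (s • g) = s • extMul f g := by ext; simp [extMul, mul_left_comm]
      rw [this, LinearMap.smul_comp])
  one S _ _ := Algebra.linearMap R S ∘ₗ Coalgebra.counit
  mul_assoc S _ _ f g h := congrArg WithConv.ofConv
    (mul_assoc (WithConv.toConv f) (WithConv.toConv g) (WithConv.toConv h))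
  mul_comm S _ _ f g := congrArg WithConv.ofConv
    (mul_comm (WithConv.toConv f) (WithConv.toConv g))
  one_mul S _ _ f := congrArg WithConv.ofConv (one_mul (WithConv.toConv f))
  map_mul S T _ _ _ _ φ f g := congrArg WithConv.ofConv
    (congrArg WithConv.toConv (LinearMap.algHom_comp_convMul_distrib φ (WithConv.toConv f)
      (WithConv.toConv g)).symm)
  map_one S T _ _ _ _ φ := by ext; simp

lemma AlgebraScheme.ofCoalgebra_mul (C : Type u) [AddCommGroup C] [Module R C] [Coalgebra R C]
    [Coalgebra.IsCocomm R C] (S : Type u) [CommRing S] [Algebra R S] (f g : C →ₗ[R] S) :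
    (AlgebraScheme.ofCoalgebra C).mul S f g = extMul f g ∘ₗ Coalgebra.comul := rfl

lemma AlgebraScheme.isTensorScheme_ofCoalgebra (C : Type u) [AddCommGroup C] [Module R C]
    [Coalgebra R C] [Coalgebra.IsCocomm R C] :
    IsTensorScheme (AlgebraScheme.ofCoalgebra (R := R) C) (AlgebraScheme.ofCoalgebra C)
      (AlgebraScheme.ofCoalgebra (C ⊗[R] C)) where
  mul_extMul S _ _ f f' g g' := by
    have h : ∀ s t : C ⊗[R] C, extMul (extMul f g) (extMul f' g')
        (TensorProduct.tensorTensorTensorComm R C C C C (s ⊗ₜ t)) =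
          extMul f f' s * extMul g g' t := by
      intro s t
      induction s with
      | zero => simp
      | add s s' hs hs' => rw [TensorProduct.add_tmul, map_add, map_add, hs, hs', map_add, add_mul]
      | tmul a a' =>
        induction t with
        | zero => simp
        | add t t' ht ht' =>
          rw [TensorProduct.tmul_add, map_add, map_add, ht, ht', map_add, mul_add]
        | tmul b b' =>
          simp only [TensorProduct.tensorTensorTensorComm_tmul, extMul, LinearMap.comp_apply,
            TensorProduct.map_tmul, LinearMap.mul'_apply]
          ring
    ext a b
    exact h (Coalgebra.comul a) (Coalgebra.comul b)
  one_eq S _ _ := by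
    ext a b
    simp [AlgebraScheme.ofCoalgebra, extMul, mul_comm]

/-- The formal monoid `Spec 𝒜*` of a cocommutative bialgebra `A`. -/
def FormalMonoid.ofBialgebra (A : Type u) [Ring A] [Bialgebra R A] [Coalgebra.IsCocomm R A] :
    FormalMonoid R where
  carrier := A
  scheme := AlgebraScheme.ofCoalgebra A
  coproduct := ⟨AlgebraScheme.ofCoalgebra (A ⊗[R] A), AlgebraScheme.isTensorScheme_ofCoalgebra A,
    fun S _ _ => ⟨fun f g => by
      have h : ∀ s t : A ⊗[R] A, extMul f g (s * t) =
          extMul (f ∘ₗ LinearMap.mul' R A) (g ∘ₗ LinearMap.mul' R A)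
            (TensorProduct.tensorTensorTensorComm R A A A A (s ⊗ₜ t)) := by
        intro s t
        induction s with
        | zero => simp
        | add s s' hs hs' =>
          rw [add_mul, map_add, hs, hs', TensorProduct.add_tmul, map_add, map_add]
        | tmul a a' =>
          induction t with
          | zero => simp
          | add t t' ht ht' =>
            rw [mul_add, map_add, ht, ht', TensorProduct.tmul_add, map_add, map_add]
          | tmul b b' =>
            simp [extMul]
      ext a b
      show extMul f g (Coalgebra.comul (a * b)) = _
      rw [Bialgebra.comul_mul]
      exact h (Coalgebra.comul a) (Coalgebra.comul b), by
      ext a b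
      simp [AlgebraScheme.ofCoalgebra, mul_comm]⟩⟩
  counit S _ _ := ⟨fun f g => by
    simp [AlgebraScheme.ofCoalgebra, extMul, Algebra.TensorProduct.one_def], by
    simp [AlgebraScheme.ofCoalgebra]⟩

variable (R) (L : Type u) [LieRing L] [LieAlgebra R L]

/-- The coproduct of `U(L)`: the algebra morphism with `x ↦ x ⊗ 1 + 1 ⊗ x` for `x ∈ L`. -/
def uComul : UniversalEnvelopingAlgebra R L →ₐ[R]
    UniversalEnvelopingAlgebra R L ⊗[R] UniversalEnvelopingAlgebra R L :=
  UniversalEnvelopingAlgebra.lift R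
    { toFun := fun x => UniversalEnvelopingAlgebra.ι R x ⊗ₜ 1 + 1 ⊗ₜ UniversalEnvelopingAlgebra.ι R x
      map_add' := fun x y => by
        rw [map_add, TensorProduct.add_tmul, TensorProduct.tmul_add]; abel
      map_smul' := fun r x => by
        rw [map_smul, ← TensorProduct.smul_tmul', TensorProduct.tmul_smul, RingHom.id_apply,
          smul_add]
      map_lie' := fun {x y} => by
        simp only [LieHom.map_lie, LieRing.of_associative_ring_bracket, add_mul, mul_add,
          Algebra.TensorProduct.tmul_mul_tmul, one_mul, mul_one, TensorProduct.sub_tmul,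
          TensorProduct.tmul_sub]
        abel }

/-- The counit of `U(L)`, with `x ↦ 0` for `x ∈ L`. -/
def uCounit : UniversalEnvelopingAlgebra R L →ₐ[R] R :=
  UniversalEnvelopingAlgebra.lift R 0

variable {L} in
lemma uComul_ι (x : L) : uComul R L (UniversalEnvelopingAlgebra.ι R x) =
    UniversalEnvelopingAlgebra.ι R x ⊗ₜ 1 + 1 ⊗ₜ UniversalEnvelopingAlgebra.ι R x :=
  UniversalEnvelopingAlgebra.lift_ι_apply R _ x

variable {L} in
lemma uCounit_ι (x : L) : uCounit R L (UniversalEnvelopingAlgebra.ι R x) = 0 :=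
  UniversalEnvelopingAlgebra.lift_ι_apply R _ x

variable {R L} in
lemma uHom_ext {A : Type u} [Ring A] [Algebra R A] {p q : UniversalEnvelopingAlgebra R L →ₐ[R] A}
    (h : ∀ x, p (UniversalEnvelopingAlgebra.ι R x) = q (UniversalEnvelopingAlgebra.ι R x)) :
    p = q :=
  UniversalEnvelopingAlgebra.hom_ext R (LieHom.ext h)

instance : Bialgebra R (UniversalEnvelopingAlgebra R L) :=
  Bialgebra.ofAlgHom (uComul R L) (uCounit R L)
    (by
      refine uHom_ext fun x => ?_
      simp [uComul_ι, -UniversalEnvelopingAlgebra.ι_apply, TensorProduct.add_tmul,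
        TensorProduct.tmul_add, Algebra.TensorProduct.one_def, add_assoc])
    (by
      refine uHom_ext fun x => ?_
      simp [uComul_ι, uCounit_ι, -UniversalEnvelopingAlgebra.ι_apply])
    (by
      refine uHom_ext fun x => ?_
      simp [uComul_ι, uCounit_ι, -UniversalEnvelopingAlgebra.ι_apply])

instance : Coalgebra.IsCocomm R (UniversalEnvelopingAlgebra R L) where
  comm_comp_comul := by
    have h : (Algebra.TensorProduct.comm R (UniversalEnvelopingAlgebra R L)
        (UniversalEnvelopingAlgebra R L)).toAlgHom.comp (uComul R L) = uComul R L := by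
      refine uHom_ext fun x => ?_
      simp [uComul_ι, -UniversalEnvelopingAlgebra.ι_apply, add_comm]
    exact congrArg AlgHom.toLinearMap h

variable {L} in
/-- The algebra morphism `U(L) → U(L')` induced by `L → L'`. -/
def uMap {L' : Type u} [LieRing L'] [LieAlgebra R L'] (p : L →ₗ⁅R⁆ L') :
    UniversalEnvelopingAlgebra R L →ₐ[R] UniversalEnvelopingAlgebra R L' :=
  UniversalEnvelopingAlgebra.lift R ((UniversalEnvelopingAlgebra.ι R).comp p)

variable {R L} in
lemma uMap_ι {L' : Type u} [LieRing L'] [LieAlgebra R L'] (p : L →ₗ⁅R⁆ L') (x : L) :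
    uMap R p (UniversalEnvelopingAlgebra.ι R x) = UniversalEnvelopingAlgebra.ι R (p x) :=
  UniversalEnvelopingAlgebra.lift_ι_apply R _ x

variable {R L} in
lemma comul_uMap {L' : Type u} [LieRing L'] [LieAlgebra R L'] (p : L →ₗ⁅R⁆ L')
    (a : UniversalEnvelopingAlgebra R L) : Coalgebra.comul (R := R) (uMap R p a) =
      TensorProduct.map (uMap R p).toLinearMap (uMap R p).toLinearMap (Coalgebra.comul a) := by
  have h : (uComul R L').comp (uMap R p) =
      (Algebra.TensorProduct.map (uMap R p) (uMap R p)).comp (uComul R L) :=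
    uHom_ext fun x => by
      simp [uMap_ι, uComul_ι, -UniversalEnvelopingAlgebra.ι_apply]
  exact congrArg (fun q => q a) h

variable {R L} in
lemma counit_uMap {L' : Type u} [LieRing L'] [LieAlgebra R L'] (p : L →ₗ⁅R⁆ L')
    (a : UniversalEnvelopingAlgebra R L) : Coalgebra.counit (R := R) (uMap R p a) =
      Coalgebra.counit (R := R) a := by
  have h : (uCounit R L').comp (uMap R p) = uCounit R L :=
    uHom_ext fun x => by
      simp [uMap_ι, uCounit_ι, -UniversalEnvelopingAlgebra.ι_apply]
  exact congrArg (fun q => q a) h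

end Enveloping

/-- The functor `L ↦ Spec 𝒰(L)*` from Lie algebras to formal monoids. -/
def envelopingFunctor (R : Type u) [CommRing R] : LieAlgCat R ⥤ FormalMonoid R where
  obj L := FormalMonoid.ofBialgebra (UniversalEnvelopingAlgebra R L.carrier)
  map {L L'} p :=
    { app := fun S _ _ =>
        { toFun := fun f => f ∘ₗ (uMap R p).toLinearMap
          map_add' := fun _ _ => rfl
          map_smul' := fun _ _ => rfl }
      natural := fun _ _ _ _ _ _ _ _ => rfl
      map_mul := fun S _ _ (f g : UniversalEnvelopingAlgebra R L'.carrier →ₗ[R] S) => by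
        refine LinearMap.ext fun (a : UniversalEnvelopingAlgebra R L.carrier) => ?_
        show extMul f g (Coalgebra.comul (uMap R p a)) =
          extMul (f ∘ₗ (uMap R p).toLinearMap) (g ∘ₗ (uMap R p).toLinearMap) (Coalgebra.comul a)
        rw [comul_uMap]
        simp only [extMul, TensorProduct.map_comp, LinearMap.comp_apply]
      map_one := fun S _ _ => by
        refine LinearMap.ext fun (a : UniversalEnvelopingAlgebra R L.carrier) => ?_
        show algebraMap R S (Coalgebra.counit (uMap R p a)) = algebraMap R S (Coalgebra.counit a)
        rw [counit_uMap]
      exists_dual := ⟨uMap R p, fun _ _ _ _ => rfl⟩ }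
  map_id L := by
    have h : uMap R (LieHom.id : L.carrier →ₗ⁅R⁆ L.carrier) = AlgHom.id R _ :=
      uHom_ext fun x => uMap_ι _ x
    refine FormalMonoid.Hom.ext ?_
    funext S _ _
    ext f : 1
    show f ∘ₗ (uMap R (LieHom.id : L.carrier →ₗ⁅R⁆ L.carrier)).toLinearMap = f
    rw [h]
    rfl
  map_comp {L L' L''} p q := by
    have h : uMap R (LieHom.comp q p : L.carrier →ₗ⁅R⁆ L''.carrier) =
        (uMap R q).comp (uMap R p) :=
      uHom_ext fun x => by
        rw [uMap_ι, AlgHom.comp_apply, uMap_ι, uMap_ι]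
        rfl
    refine FormalMonoid.Hom.ext ?_
    funext S _ _
    ext f : 1
    show f ∘ₗ (uMap R (LieHom.comp q p : L.carrier →ₗ⁅R⁆ L''.carrier)).toLinearMap =
      (f ∘ₗ (uMap R q).toLinearMap) ∘ₗ (uMap R p).toLinearMap
    rw [h]
    rfl

/-- Flat infinitesimal formal groups, as a property of formal monoids. -/
def flatInfinitesimalGroup (R : Type u) [CommRing R] : ObjectProperty (FormalMonoid R) :=
  fun G => IsFlatInfinitesimalGroup G

/-- Flat Lie algebras, as a property of Lie algebras. -/
def flatLie (R : Type u) [CommRing R] : ObjectProperty (LieAlgCat R) :=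
  fun L => Module.Flat R L.carrier

/-- The category of flat infinitesimal formal groups. -/
abbrev FlatInfFormalGroup (R : Type u) [CommRing R] := (flatInfinitesimalGroup R).FullSubcategory

/-- The category of flat Lie algebras. -/
abbrev FlatLieAlg (R : Type u) [CommRing R] := (flatLie R).FullSubcategory

/-- The canonical algebra morphism `U(T_e 𝔾) → A` extending the inclusion `T_e 𝔾 ⊆ A`. -/
def envelopingToCarrier {R : Type u} [CommRing R] (G : FormalMonoid R) :
    UniversalEnvelopingAlgebra R (tangentSpace G) →ₐ[R] G.carrier :=
  UniversalEnvelopingAlgebra.lift R (tangentSpace G).incl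

/-- An element of `T_e (Spec 𝒰(L)*)`, as an element of `U(L)`. -/
def tangentToU {R : Type u} [CommRing R] (L : LieAlgCat R)
    (a : ((tangentFunctor R).obj ((envelopingFunctor R).obj L)).carrier) :
    UniversalEnvelopingAlgebra R L.carrier :=
  (show tangentSpace ((envelopingFunctor R).obj L) from a).1

end FormalGrp

end

/-! Testing an algebra scheme on square-zero extensions shows that it is the dual of a cocommutative
coalgebra. Hence a formal monoid comes from a cocommutative bialgebra `A`
(`FormalMonoid.exists_eq_ofBialgebra`), its tangent vectors are the primitive elements
(`isTangent_ofBialgebra_iff`), and each of its points over `S` is given by a group-like element of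
`A ⊗ S` (`comul_pointElem`). The theorem becomes a Cartier–Milnor–Moore theorem over a ℚ-algebra,
which is proved through the Eulerian maps and does not rely on the Poincaré–Birkhoff–Witt theorem.

Suppose that the convolution powers of the identity of `A` are polynomial in the exponent, and let
`e_k` be the coefficient of `t^k` in the resulting `Ψ^t`. The rule `Ψ^(t+m) = Ψ^t * Ψ^m` gives `Ψ' =
e_1 * Ψ`, so `k! e_k = e_1^k` for convolution (`factorial_smul_eulerian`); in other words `Ψ^t =
exp(t e_1)`. At `t = 1` every `a` is the finite sum of the `e_k(a)` (`sum_eulerian`).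
Cocommutativity makes `e_1`, the logarithm of the identity, take primitive values
(`comul_eulerian_one`). So `A` is controlled by its primitive elements: they generate it, and the
morphism from their enveloping algebra is injective because the Eulerian maps of `U(L)` factor
through `A` (`lift_surjective`, `lift_injective`). The primitives form a retract of `A`, and `e_k`
factors through their `k`-fold tensor power, so flatness passes both ways.

Polynomiality holds in two situations. The algebra `U(L)` is spanned by the powers of elements of
`L` (`span_ι_pow`), and the `m`-th convolution power multiplies `x^n` by `m^n`. If `A` is the union
of the annihilators `A_n`, which completeness forces, then `id = 1 + v` where `v^k` kills `A_n` for
`k > n`, and the binomial series stops. For `U(L)`, the grading by the `e_k` also yields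
completeness and the base change condition, and `Ψ^(-1)` is the antipode.

Injectivity of `L → U(L)` is shown for free Lie algebras by extending the degree derivation to the
enveloping algebra. It descends to a quotient `F/K` because `e_1` maps the ideal of `U(F)` generated
by `K` into the image of `K`. -/

noncomputable section

namespace FormalGrp

open Polynomial WithConv

/-! ### Polynomials with coefficients in an algebra -/

section PolynomialValues

variable {R : Type u} [CommRing R] {B : Type u} [Ring B] [Algebra R B]

/-- Evaluation of a polynomial with coefficients in the algebra `B` at a scalar. -/
def polyEval (r : R) : B[X] →ₐ[R] B :=
  { eval₂RingHom' (RingHom.id B) (algebraMap R B r) (fun a => (Algebra.commutes r a).symm) with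
    commutes' := fun s => by
      show eval₂ (RingHom.id B) (algebraMap R B r) (algebraMap R B[X] s) = algebraMap R B s
      rw [Polynomial.algebraMap_apply, eval₂_C]
      rfl }

lemma polyEval_apply (r : R) (p : B[X]) : polyEval r p = p.eval (algebraMap R B r) := rfl

@[simp] lemma polyEval_C (r : R) (b : B) : polyEval r (C b) = b := eval_C

@[simp] lemma polyEval_X (r : R) : polyEval r (X : B[X]) = algebraMap R B r := eval_X

lemma polyEval_monomial (r : R) (n : ℕ) (b : B) : polyEval r (monomial n b) = r ^ n • b := by
  rw [polyEval_apply, eval_monomial, ← map_pow, ← Algebra.commutes, Algebra.smul_def]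

lemma polyEval_mapAlgHom {B' : Type u} [Ring B'] [Algebra R B'] (h : B →ₐ[R] B') (r : R)
    (p : B[X]) : polyEval r (mapAlgHom h p) = h (polyEval r p) := by
  induction p using Polynomial.induction_on' with
  | add p q hp hq => simp only [map_add, hp, hq]
  | monomial n b =>
    have : mapAlgHom h (monomial n b) = monomial n (h b) := map_monomial _
    rw [this, polyEval_monomial, polyEval_monomial, map_smul]

lemma polyEval_taylor (r s : R) (p : B[X]) :
    polyEval r (taylor (algebraMap R B s) p) = polyEval (r + s) p := by
  induction p using Polynomial.induction_on' with
  | add p q hp hq => simp only [map_add, hp, hq]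
  | monomial n b =>
    rw [taylor_monomial, map_mul, map_pow, map_add, polyEval_C, polyEval_C, polyEval_X, ← map_add,
      ← map_pow, polyEval_monomial, ← Algebra.commutes, Algebra.smul_def]

/-- The `k`-th coefficient, as a linear map. -/
def polyCoeff (R : Type u) [CommRing R] {B : Type u} [Ring B] [Algebra R B] (k : ℕ) :
    B[X] →ₗ[R] B :=
  (lcoeff B k).restrictScalars R

/-- A polynomial whose values at all natural numbers lie in a submodule has its coefficients in
this submodule. -/
lemma coeff_mem_of_polyEval_mem [Algebra ℚ R] (V : Submodule R B) (p : B[X])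
    (h : ∀ m : ℕ, polyEval (m : R) p ∈ V) (k : ℕ) : p.coeff k ∈ V := by
  -- `B ⧸ V` is a ℚ-vector space, so its ℚ-linear forms detect zero, and the claim reduces to
  -- rational polynomials with infinitely many roots.
  let _ : Module ℚ (B ⧸ V) := Module.compHom _ (algebraMap ℚ R)
  rw [← Submodule.Quotient.mk_eq_zero, ← Module.forall_dual_apply_eq_zero_iff ℚ]
  intro l
  let g : B →+ ℚ := l.toAddMonoidHom.comp V.mkQ.toAddMonoidHom
  have hg : ∀ b ∈ V, g b = 0 := fun b hb => by
    show l (Submodule.Quotient.mk b) = 0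
    rw [(Submodule.Quotient.mk_eq_zero V).2 hb, map_zero]
  let q : ℚ[X] := ∑ i ∈ Finset.range (p.natDegree + 1), monomial i (g (p.coeff i))
  have hq : q = 0 := by
    refine eq_of_infinite_eval_eq q 0 ((Set.infinite_range_of_injective
      (Nat.cast_injective (R := ℚ))).mono ?_)
    rintro _ ⟨m, rfl⟩
    have h1 : q.eval (m : ℚ) = g (polyEval (m : R) p) := by
      rw [polyEval_apply, eval_eq_sum_range (p := p), map_sum, eval_finsetSum]
      refine Finset.sum_congr rfl fun i _ => ?_
      rw [eval_monomial, map_natCast, ← Nat.cast_pow, ← Nat.cast_pow, ← nsmul_eq_mul',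
        ← nsmul_eq_mul', map_nsmul]
    show q.eval (m : ℚ) = eval (m : ℚ) 0
    rw [h1, hg _ (h m), eval_zero]
  show g (p.coeff k) = 0
  by_cases hk : k < p.natDegree + 1
  · have h2 : q.coeff k = g (p.coeff k) := by
      simp only [q, finsetSum_coeff, coeff_monomial]
      rw [Finset.sum_eq_single k (fun b _ hb => if_neg hb) fun h =>
        absurd (Finset.mem_range.2 hk) h, if_pos rfl]
    rw [← h2, hq, coeff_zero]
  · rw [coeff_eq_zero_of_natDegree_lt (by omega), map_zero]

lemma eq_of_polyEval_eq [Algebra ℚ R] {p q : B[X]}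
    (h : ∀ m : ℕ, polyEval (m : R) p = polyEval (m : R) q) : p = q := by
  ext k
  rw [← sub_eq_zero, ← coeff_sub]
  exact coeff_mem_of_polyEval_mem (⊥ : Submodule R B) (p - q)
    (fun m => by rw [map_sub, h, sub_self]; exact Submodule.zero_mem _) k

lemma mem_of_natCast_smul_mem [Algebra ℚ R] {M : Type u} [AddCommGroup M] [Module R M]
    (V : Submodule R M) {n : ℕ} (hn : n ≠ 0) {x : M} (h : (n : R) • x ∈ V) : x ∈ V := by
  have h1 := V.smul_mem (algebraMap ℚ R (n : ℚ)⁻¹) h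
  rwa [smul_smul, ← map_natCast (algebraMap ℚ R) n, ← map_mul,
    inv_mul_cancel₀ (Nat.cast_ne_zero.2 hn), map_one, one_smul] at h1

end PolynomialValues

/-! ### Convolution -/

section Convolution

variable {R : Type u} [CommRing R] {A : Type u} [AddCommGroup A] [Module R A] [Coalgebra R A]
  {B : Type u} [Ring B] [Algebra R B]

/-- Composition with an algebra morphism, as a morphism of convolution rings. -/
def postConv {B' : Type u} [Ring B'] [Algebra R B'] (h : B →ₐ[R] B') :
    WithConv (A →ₗ[R] B) →+* WithConv (A →ₗ[R] B') where
  toFun f := toConv (h.toLinearMap ∘ₗ f.ofConv)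
  map_zero' := by ext; simp
  map_add' f g := by ext; simp
  map_one' := by ext; simp
  map_mul' f g := congrArg toConv (LinearMap.algHom_comp_convMul_distrib h f g)

/-- Composition with a coalgebra morphism, as a morphism of convolution rings. -/
def preConv {A' : Type u} [AddCommGroup A'] [Module R A'] [Coalgebra R A'] (h : A' →ₗc[R] A) :
    WithConv (A →ₗ[R] B) →+* WithConv (A' →ₗ[R] B) where
  toFun f := toConv (f.ofConv ∘ₗ h.toLinearMap)
  map_zero' := by ext; simp
  map_add' f g := by ext; simp
  map_one' := by ext; simp
  map_mul' f g := congrArg toConv (LinearMap.convMul_comp_coalgHom_distrib f g h)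

lemma postConv_apply {B' : Type u} [Ring B'] [Algebra R B'] (h : B →ₐ[R] B')
    (f : WithConv (A →ₗ[R] B)) (a : A) : (postConv h f).ofConv a = h (f.ofConv a) := rfl

lemma preConv_apply {A' : Type u} [AddCommGroup A'] [Module R A'] [Coalgebra R A']
    (h : A' →ₗc[R] A) (f : WithConv (A →ₗ[R] B)) (a : A') :
    (preConv h f).ofConv a = f.ofConv (h a) := rfl

lemma conv_ext_of_polyEval [Algebra ℚ R] {F G : WithConv (A →ₗ[R] B[X])}
    (h : ∀ m : ℕ, postConv (polyEval (m : R)) F = postConv (polyEval (m : R)) G) : F = G := by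
  ext a : 2
  exact eq_of_polyEval_eq fun m => congrArg (fun f => f.ofConv a) (h m)

/-- The `k`-th coefficient of a linear map with polynomial values. -/
def coeffConv (k : ℕ) (F : WithConv (A →ₗ[R] B[X])) : WithConv (A →ₗ[R] B) :=
  toConv (polyCoeff R k ∘ₗ F.ofConv)

lemma coeffConv_apply (k : ℕ) (F : WithConv (A →ₗ[R] B[X])) (a : A) :
    (coeffConv k F).ofConv a = (F.ofConv a).coeff k := rfl

lemma coeffConv_zero_eq (F : WithConv (A →ₗ[R] B[X])) :
    coeffConv 0 F = postConv (polyEval (0 : R)) F := by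
  ext a
  show (F.ofConv a).coeff 0 = polyEval (0 : R) (F.ofConv a)
  rw [polyEval_apply, map_zero, coeff_zero_eq_eval_zero]

lemma coeffConv_one_mul (F G : WithConv (A →ₗ[R] B[X])) :
    coeffConv 1 (F * G) = coeffConv 0 F * coeffConv 1 G + coeffConv 1 F * coeffConv 0 G := by
  ext a
  simp only [coeffConv_apply, LinearMap.convMul_apply, ofConv_add, LinearMap.add_apply]
  induction (Coalgebra.comul (R := R) a) with
  | zero => simp
  | add s t hs ht => simp only [map_add, coeff_add, hs, ht]; abel
  | tmul s t => simp [mul_coeff_one, coeffConv_apply]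

lemma coeffConv_C_mul (f : WithConv (A →ₗ[R] B)) (G : WithConv (A →ₗ[R] B[X])) (k : ℕ) :
    coeffConv k (postConv CAlgHom f * G) = f * coeffConv k G := by
  ext a
  simp only [coeffConv_apply, LinearMap.convMul_apply]
  induction (Coalgebra.comul (R := R) a) with
  | zero => simp
  | add s t hs ht => simp only [map_add, coeff_add, hs, ht]
  | tmul s t => simp [coeffConv_apply, postConv_apply]

end Convolution

/-! ### Adams operations -/

section Adams

variable (R : Type u) [CommRing R] (A : Type u) [Ring A] [Bialgebra R A]

/-- The identity, as an element of the convolution ring. -/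
def idConv : WithConv (A →ₗ[R] A) := toConv LinearMap.id

/-- The convolution powers of the identity of `A` depend polynomially on the exponent. -/
def IsPolynomialType : Prop :=
  ∀ a : A, ∃ p : A[X], ∀ m : ℕ, polyEval (m : R) p = (idConv R A ^ m).ofConv a

variable {R A}

variable [Algebra ℚ R] (hA : IsPolynomialType R A)

/-- The polynomial in `t` whose value at a natural number `m` is the `m`-th convolution power of the
identity. -/
def adams : WithConv (A →ₗ[R] A[X]) := toConv
  { toFun := fun a => (hA a).choose
    map_add' := fun a b => eq_of_polyEval_eq (R := R) fun m => by
      rw [map_add, (hA (a + b)).choose_spec, (hA a).choose_spec, (hA b).choose_spec, map_add]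
    map_smul' := fun r a => eq_of_polyEval_eq (R := R) fun m => by
      rw [RingHom.id_apply, map_smul, (hA (r • a)).choose_spec, (hA a).choose_spec, map_smul] }

lemma postConv_polyEval_adams (m : ℕ) :
    postConv (polyEval (m : R)) (adams hA) = idConv R A ^ m := by
  ext a
  exact (hA a).choose_spec m

/-- The coefficient of `tᵏ` in the Adams operation. -/
def eulerian (k : ℕ) : WithConv (A →ₗ[R] A) := coeffConv k (adams hA)

lemma eulerian_apply (k : ℕ) (a : A) :
    (eulerian hA k).ofConv a = ((adams hA).ofConv a).coeff k := rfl

/-- The constant term is the value at `m = 0`, where the convolution power is the unit. -/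
lemma eulerian_zero : eulerian hA 0 = 1 := by
  have h := postConv_polyEval_adams hA 0
  rw [Nat.cast_zero, pow_zero] at h
  rw [eulerian, coeffConv_zero_eq, h]

/-- Evaluate the Adams polynomial at `1`. Any bound beyond the degree is allowed, so that one range
can serve several elements at once. -/
lemma sum_eulerian (a : A) (N : ℕ) (hN : ((adams hA).ofConv a).natDegree < N) :
    ∑ k ∈ Finset.range N, (eulerian hA k).ofConv a = a := by
  have h := congrArg (fun f => f.ofConv a) (postConv_polyEval_adams hA 1)
  simp only [postConv_apply, pow_one, Nat.cast_one] at h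
  rw [polyEval_apply, map_one, eval_eq_sum_range' hN] at h
  simpa [eulerian_apply, idConv] using h

/-- The shift `p(t) ↦ p(t + s)`. -/
lemma taylor_adams (m : ℕ) : toConv ((taylor (algebraMap R A m)).restrictScalars R ∘ₗ
    (adams hA).ofConv) = adams hA * postConv CAlgHom (idConv R A ^ m) := by
  -- At `t = k` both sides are the convolution power of exponent `k + m`.
  refine conv_ext_of_polyEval fun k => ?_
  have h : postConv (polyEval (k : R)) (postConv CAlgHom (idConv R A ^ m)) = idConv R A ^ m := by
    ext a
    exact polyEval_C _ _
  rw [map_mul, h, postConv_polyEval_adams, ← pow_add, ← postConv_polyEval_adams hA]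
  ext a
  show polyEval (k : R) (taylor (algebraMap R A m) ((adams hA).ofConv a)) = _
  rw [polyEval_taylor, ← Nat.cast_add]
  rfl

/-- The differential equation of the one-parameter group `Ψ^t`: the coefficient of `t` in `Ψ^(t + m)
= Ψ^t * Ψ^m` gives the derivative at every natural number `m`, which suffices for polynomials. -/
lemma derivative_adams : toConv ((derivative (R := A)).restrictScalars R ∘ₗ (adams hA).ofConv) =
    postConv CAlgHom (eulerian hA 1) * adams hA := by
  refine conv_ext_of_polyEval fun m => ?_
  have h : postConv (polyEval (m : R)) (postConv CAlgHom (eulerian hA 1)) = eulerian hA 1 := by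
    ext a
    exact polyEval_C _ _
  have h0 : coeffConv 0 (postConv CAlgHom (idConv R A ^ m)) = idConv R A ^ m := by
    ext a
    exact coeff_C_zero
  have h1 : coeffConv 1 (postConv CAlgHom (idConv R A ^ m)) = 0 := by
    ext a
    exact coeff_C_of_ne_zero one_ne_zero
  have h2 := congrArg (coeffConv 1) (taylor_adams hA m)
  rw [coeffConv_one_mul, h0, h1, mul_zero, zero_add] at h2
  rw [map_mul, h, postConv_polyEval_adams]
  refine Eq.trans ?_ h2
  ext a
  exact (taylor_coeff_one _ _).symm

/-- Comparison of the coefficients of `t^k` in `Ψ' = e_1 * Ψ`. -/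
lemma eulerian_succ (k : ℕ) :
    ((k + 1 : ℕ) : R) • eulerian hA (k + 1) = eulerian hA 1 * eulerian hA k := by
  have h := congrArg (coeffConv k) (derivative_adams hA)
  rw [coeffConv_C_mul] at h
  refine Eq.trans ?_ h
  ext a
  show ((k + 1 : ℕ) : R) • ((adams hA).ofConv a).coeff (k + 1) =
    (derivative ((adams hA).ofConv a)).coeff k
  rw [coeff_derivative, Nat.cast_smul_eq_nsmul, nsmul_eq_mul', Nat.cast_succ]

/-- This is `Ψ^t = exp(t e_1)`, written without denominators: everything about the Eulerian maps
reduces to `e_1`. -/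
lemma factorial_smul_eulerian (k : ℕ) :
    (k.factorial : R) • eulerian hA k = eulerian hA 1 ^ k := by
  induction k with
  | zero => rw [Nat.factorial_zero, Nat.cast_one, one_smul, pow_zero, eulerian_zero]
  | succ k ih =>
    rw [Nat.factorial_succ, mul_comm, Nat.cast_mul, mul_smul, eulerian_succ, pow_succ', ← ih,
      mul_smul_comm]

lemma eulerian_mem_of_pow_mem (V : Submodule R A) (k : ℕ) (a : A)
    (h : (eulerian hA 1 ^ k).ofConv a ∈ V) : (eulerian hA k).ofConv a ∈ V := by
  rw [← factorial_smul_eulerian] at h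
  exact mem_of_natCast_smul_mem V k.factorial_ne_zero h

/-- The Eulerian maps commute with morphisms of bialgebras. -/
lemma map_eulerian {B : Type u} [Ring B] [Bialgebra R B] (hB : IsPolynomialType R B)
    (f : A →ₐc[R] B) (k : ℕ) (a : A) :
    f ((eulerian hA k).ofConv a) = (eulerian hB k).ofConv (f a) := by
  have h : postConv (mapAlgHom (f : A →ₐ[R] B)) (adams hA) =
      preConv (f : A →ₗc[R] B) (adams hB) := by
    refine conv_ext_of_polyEval fun m => ?_
    have h1 : postConv (polyEval (m : R)) (preConv (f : A →ₗc[R] B) (adams hB)) =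
        preConv (f : A →ₗc[R] B) (postConv (polyEval (m : R)) (adams hB)) := rfl
    have h2 : postConv (polyEval (m : R)) (postConv (mapAlgHom (f : A →ₐ[R] B)) (adams hA)) =
        postConv (f : A →ₐ[R] B) (postConv (polyEval (m : R)) (adams hA)) := by
      ext a
      exact polyEval_mapAlgHom _ _ _
    -- Both sides are `f` itself. Postcomposition uses its multiplicativity and precomposition its
    -- compatibility with coproducts, so the equality persists for all convolution powers.
    have h3 : postConv (f : A →ₐ[R] B) (idConv R A) = preConv (f : A →ₗc[R] B) (idConv R B) := rfl
    rw [h1, h2, postConv_polyEval_adams, postConv_polyEval_adams, map_pow, map_pow, h3]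
  have h4 := congrArg (fun F => (F.ofConv a).coeff k) h
  refine Eq.trans ?_ h4
  show _ = (Polynomial.map _ _).coeff k
  rw [coeff_map]
  rfl

variable [Coalgebra.IsCocomm R A]

omit [Algebra ℚ R] in
-- The two products differ by the flip of the coproduct, so cocommutativity is exactly what is
-- needed.
lemma commute_include : Commute
    (postConv (Algebra.TensorProduct.includeLeft : A →ₐ[R] A ⊗[R] A) (idConv R A))
    (postConv (Algebra.TensorProduct.includeRight : A →ₐ[R] A ⊗[R] A) (idConv R A)) := by
  ext a
  rw [LinearMap.convMul_apply, LinearMap.convMul_apply]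
  conv_rhs => rw [← Coalgebra.comm_comul R a]
  induction (Coalgebra.comul (R := R) a) with
  | zero => simp
  | add s t hs ht => simp only [map_add, hs, ht]
  | tmul s t => simp [postConv_apply, idConv]

omit [Algebra ℚ R] [Coalgebra.IsCocomm R A] in
lemma include_mul_include :
    postConv (Algebra.TensorProduct.includeLeft : A →ₐ[R] A ⊗[R] A) (idConv R A) *
    postConv (Algebra.TensorProduct.includeRight : A →ₐ[R] A ⊗[R] A) (idConv R A) =
      postConv (Bialgebra.comulAlgHom R A) (idConv R A) := by
  ext a
  rw [LinearMap.convMul_apply]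
  show _ = Coalgebra.comul (R := R) a
  induction (Coalgebra.comul (R := R) a) with
  | zero => simp
  | add s t hs ht => simp only [map_add, hs, ht]
  | tmul s t => simp [postConv_apply, idConv]

/-- With `i₁`, `i₂` the two inclusions, the coproduct is the convolution `i₁ * i₂`. As these
commute, its `m`-th power is `i₁^m * i₂^m`; polynomiality extends this from natural numbers to `t`.
-/
lemma comul_adams : postConv (mapAlgHom (Bialgebra.comulAlgHom R A)) (adams hA) =
    postConv (mapAlgHom (Algebra.TensorProduct.includeLeft : A →ₐ[R] A ⊗[R] A)) (adams hA) *
    postConv (mapAlgHom (Algebra.TensorProduct.includeRight : A →ₐ[R] A ⊗[R] A)) (adams hA) := by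
  refine conv_ext_of_polyEval fun m => ?_
  have h2 : ∀ g : A →ₐ[R] A ⊗[R] A,
      postConv (polyEval (m : R)) (postConv (mapAlgHom g) (adams hA)) =
      postConv g (idConv R A) ^ m := by
    intro g
    rw [← map_pow, ← postConv_polyEval_adams hA]
    ext a
    exact polyEval_mapAlgHom _ _ _
  rw [map_mul, h2, h2, h2, ← commute_include.mul_pow, include_mul_include]

/-- The logarithm of a group-like family is primitive: take the coefficient of `t` in the
multiplicativity of `Ψ^t`, whose constant terms are `1`. -/
lemma comul_eulerian_one (a : A) : Coalgebra.comul (R := R) ((eulerian hA 1).ofConv a) =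
    (eulerian hA 1).ofConv a ⊗ₜ 1 + 1 ⊗ₜ (eulerian hA 1).ofConv a := by
  have h2 : ∀ (g : A →ₐ[R] A ⊗[R] A) k, coeffConv k (postConv (mapAlgHom g) (adams hA)) =
      postConv g (eulerian hA k) := by
    intro g k
    ext a
    show (Polynomial.map _ _).coeff k = _
    rw [coeff_map]
    rfl
  have h := congrArg (coeffConv 1) (comul_adams hA)
  rw [coeffConv_one_mul, h2, h2, h2, h2, h2, eulerian_zero, map_one, map_one, one_mul, mul_one,
    add_comm] at h
  exact congrArg (fun F => F.ofConv a) h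

end Adams

/-! ### Primitive elements and their powers -/

section Primitive

variable (R : Type u) [CommRing R] {A : Type u} [Ring A] [Bialgebra R A]

/-- Primitive elements. -/
def IsPrimitive (a : A) : Prop := Coalgebra.comul (R := R) a = a ⊗ₜ 1 + 1 ⊗ₜ a

variable {R}

lemma IsPrimitive.comul_pow {x : A} (hx : IsPrimitive R x) (n : ℕ) :
    Coalgebra.comul (R := R) (x ^ n) =
      ∑ i ∈ Finset.range (n + 1), (n.choose i) • ((x ^ i) ⊗ₜ[R] (x ^ (n - i))) := by
  have hc : Commute (x ⊗ₜ[R] (1 : A)) ((1 : A) ⊗ₜ[R] x) := by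
    show _ * _ = _ * _
    simp
  rw [Bialgebra.comul_pow, hx, hc.add_pow]
  refine Finset.sum_congr rfl fun i _ => ?_
  rw [Algebra.TensorProduct.tmul_pow, Algebra.TensorProduct.tmul_pow,
    Algebra.TensorProduct.tmul_mul_tmul, one_pow, one_pow, mul_one, one_mul, nsmul_eq_mul']

lemma IsPrimitive.convMul_pow_apply {B : Type u} [Ring B] [Algebra R B] {x : A}
    (hx : IsPrimitive R x) (n : ℕ) (f g : WithConv (A →ₗ[R] B)) : (f * g).ofConv (x ^ n) =
      ∑ i ∈ Finset.range (n + 1), (n.choose i) • (f.ofConv (x ^ i) * g.ofConv (x ^ (n - i))) := by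
  rw [LinearMap.convMul_apply, hx.comul_pow, map_sum, map_sum]
  refine Finset.sum_congr rfl fun i _ => ?_
  rw [map_nsmul, map_nsmul, TensorProduct.map_tmul, LinearMap.mul'_apply]

lemma IsPrimitive.counit_eq_zero {x : A} (hx : IsPrimitive R x) :
    Coalgebra.counit (R := R) x = 0 := by
  have h := Coalgebra.rTensor_counit_comul (R := R) x
  rw [hx, map_add, LinearMap.rTensor_tmul, LinearMap.rTensor_tmul, Bialgebra.counit_one,
    add_eq_right] at h
  -- The counit law only gives `ε(x) ⊗ 1 = 0` in `R ⊗ A`; applying the counit to the second factor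
  -- brings this back to `R`.
  have h1 := congrArg (LinearMap.mul' R R ∘ₗ TensorProduct.map LinearMap.id Coalgebra.counit) h
  simpa using h1

/-- The coproduct of `x^n` is a binomial expansion, so the induction on `m` is the binomial theorem
for `(m + 1)^n`. -/
lemma IsPrimitive.idConv_pow {x : A} (hx : IsPrimitive R x) (n m : ℕ) :
    (idConv R A ^ m).ofConv (x ^ n) = (m : R) ^ n • x ^ n := by
  induction m generalizing n with
  | zero =>
    rw [pow_zero, LinearMap.convOne_apply, Bialgebra.counit_pow, hx.counit_eq_zero, Nat.cast_zero]
    cases n with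
    | zero => simp
    | succ n => simp
  | succ m ih =>
    rw [pow_succ, hx.convMul_pow_apply, Nat.cast_succ, add_pow, Finset.sum_smul]
    refine Finset.sum_congr rfl fun i hi => ?_
    rw [ih, one_pow, mul_one, smul_mul_assoc]
    show _ • _ • (x ^ i * x ^ (n - i)) = _
    rw [← pow_add, Nat.add_sub_cancel' (Nat.lt_succ_iff.1 (Finset.mem_range.1 hi)), mul_comm,
      mul_smul, Nat.cast_smul_eq_nsmul]

lemma isPolynomialType_of_span
    (h : Submodule.span R {a : A | ∃ x n, IsPrimitive R x ∧ x ^ n = a} = ⊤) :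
    IsPolynomialType R A := by
  intro a
  have ha : a ∈ Submodule.span R {a : A | ∃ x n, IsPrimitive R x ∧ x ^ n = a} :=
    h ▸ Submodule.mem_top
  induction ha using Submodule.span_induction with
  | mem a ha =>
    obtain ⟨x, n, hx, rfl⟩ := ha
    exact ⟨monomial n (x ^ n), fun m => by rw [polyEval_monomial, hx.idConv_pow]⟩
  | zero => exact ⟨0, fun m => by rw [map_zero, map_zero]⟩
  | add a b _ _ ha hb =>
    obtain ⟨p, hp⟩ := ha
    obtain ⟨q, hq⟩ := hb
    exact ⟨p + q, fun m => by rw [map_add, map_add, hp, hq]⟩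
  | smul r a _ ha =>
    obtain ⟨p, hp⟩ := ha
    exact ⟨r • p, fun m => by rw [map_smul, map_smul, hp]⟩

variable [Algebra ℚ R]

lemma IsPrimitive.adams_pow {x : A} (hx : IsPrimitive R x) (hA : IsPolynomialType R A) (n : ℕ) :
    (adams hA).ofConv (x ^ n) = monomial n (x ^ n) :=
  eq_of_polyEval_eq (R := R) fun m => by
    rw [polyEval_monomial, ← hx.idConv_pow, ← postConv_polyEval_adams hA]
    rfl

lemma IsPrimitive.eulerian_pow {x : A} (hx : IsPrimitive R x) (hA : IsPolynomialType R A)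
    (n k : ℕ) : (eulerian hA k).ofConv (x ^ n) = if n = k then x ^ n else 0 := by
  rw [eulerian_apply, hx.adams_pow, coeff_monomial]

lemma IsPrimitive.eulerian_one {x : A} (hx : IsPrimitive R x) (hA : IsPolynomialType R A) :
    (eulerian hA 1).ofConv x = x := by
  have h := hx.eulerian_pow hA 1 1
  rwa [pow_one, if_pos rfl] at h

end Primitive

/-! ### The linear part of the powers of `x + t y` -/

section LinearPart

variable {R : Type u} [CommRing R] {B : Type u} [Ring B] [Algebra R B]

lemma coeff_one_add_X_mul_pow (x y : B) (n : ℕ) : ((C x + X * C y) ^ (n + 1)).coeff 1 =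
    ∑ i ∈ Finset.range (n + 1), x ^ i * y * x ^ (n - i) := by
  have h0 : (C x + X * C y).coeff 0 = x := by simp
  have h1 : (C x + X * C y).coeff 1 = y := by simp
  have h2 : ∀ n, ((C x + X * C y) ^ n).coeff 0 = x ^ n := by
    intro n
    induction n with
    | zero => simp
    | succ n ih => rw [pow_succ, mul_coeff_zero, ih, h0, pow_succ]
  induction n with
  | zero => simp
  | succ n ih =>
    rw [pow_succ, mul_coeff_one, h2, h1, ih, h0, Finset.sum_range_succ _ (n + 1), Finset.sum_mul,
      Nat.sub_self, pow_zero, mul_one, add_comm]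
    congr 1
    refine Finset.sum_congr rfl fun i hi => ?_
    rw [mul_assoc, ← pow_succ, Nat.succ_sub (Nat.lt_succ_iff.1 (Finset.mem_range.1 hi))]

/-- Polarization: the sum is the coefficient of `t` in `(x + t y)^(n + 1)`, a polynomial whose
values at natural numbers lie in `V`. -/
lemma sum_pow_mul_mul_pow_mem [Algebra ℚ R] (V : Submodule R B) (x y : B) (n : ℕ)
    (h : ∀ m : ℕ, (x + m • y) ^ (n + 1) ∈ V) :
    ∑ i ∈ Finset.range (n + 1), x ^ i * y * x ^ (n - i) ∈ V := by
  rw [← coeff_one_add_X_mul_pow]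
  refine coeff_mem_of_polyEval_mem V _ (fun m => ?_) 1
  rw [map_pow, map_add, map_mul, polyEval_C, polyEval_C, polyEval_X, map_natCast, ← nsmul_eq_mul]
  exact h m

/-- If a submodule `N` contains all the sums `∑ xⁱ y xⁿ⁻ⁱ`, for `y` in a submodule stable under the
bracket with `x`, then it contains all the elements `xⁿ y`. -/
lemma pow_mul_mem_of_sum_mem [Algebra ℚ R] (x : B) (I N : Submodule R B)
    (hI : ∀ y ∈ I, x * y - y * x ∈ I)
    (h : ∀ n, ∀ y ∈ I, ∑ i ∈ Finset.range (n + 1), x ^ i * y * x ^ (n - i) ∈ N) (n : ℕ) :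
    ∀ y ∈ I, x ^ n * y ∈ N := by
  induction n using Nat.strong_induction_on with
  | _ n ih =>
    -- Modulo `N`, the factor `y` moves freely to the right: each exchange with an `x` costs a term
    -- with the bracket of `x` and `y`, still in `I`, and one power of `x` less, which the outer
    -- induction handles.
    have claim : ∀ k i, ∀ y ∈ I, i + k ≤ n → x ^ i * y * x ^ k - x ^ (i + k) * y ∈ N := by
      intro k
      induction k with
      | zero => intro i y _ _; simp
      | succ k ihk =>
        intro i y hy hik
        have h1 := ihk (i + 1) y hy (by omega)
        have h2 := ihk i _ (hI y hy) (by omega)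
        have h3 := ih (i + k) (by omega) _ (hI y hy)
        have h4 : x ^ i * y * x ^ (k + 1) - x ^ (i + (k + 1)) * y =
            (x ^ (i + 1) * y * x ^ k - x ^ (i + 1 + k) * y) -
            ((x ^ i * (x * y - y * x) * x ^ k - x ^ (i + k) * (x * y - y * x)) +
              x ^ (i + k) * (x * y - y * x)) := by
          rw [sub_add_cancel, add_right_comm i 1 k, ← add_assoc, pow_succ' x k, pow_succ x i]
          noncomm_ring
        rw [h4]
        exact N.sub_mem h1 (N.add_mem h2 h3)
    intro y hy
    -- All `n + 1` terms of the sum are congruent to `x^n y` modulo `N`, so `(n + 1) x^n y` lies in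
    -- `N`.
    refine mem_of_natCast_smul_mem N n.succ_ne_zero ?_
    have h5 : ∑ i ∈ Finset.range (n + 1), (x ^ i * y * x ^ (n - i) - x ^ n * y) ∈ N :=
      N.sum_mem fun i hi => by
        have hi' : i + (n - i) = n :=
          Nat.add_sub_cancel' (Nat.lt_succ_iff.1 (Finset.mem_range.1 hi))
        have h6 := claim (n - i) i y hy hi'.le
        rwa [hi'] at h6
    rw [Finset.sum_sub_distrib, Finset.sum_const, Finset.card_range] at h5
    rw [Nat.cast_smul_eq_nsmul]
    exact (N.sub_mem_iff_right (h n y hy)).1 h5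

end LinearPart

/-! ### The enveloping algebra is spanned by powers -/

section Span

variable (R : Type u) [CommRing R] {L : Type u} [LieRing L] [LieAlgebra R L]

local notation "U" => UniversalEnvelopingAlgebra
local notation "ι" => UniversalEnvelopingAlgebra.ι

/-- The universal property yields a morphism into `S` whose composition with the inclusion fixes the
generators, hence is the identity. -/
lemma ueaSubalgebra_eq_top (S : Subalgebra R (U R L)) (h : ∀ x, ι R x ∈ S) : S = ⊤ := by
  let g : L →ₗ⁅R⁆ S :=
    { toFun := fun x => ⟨ι R x, h x⟩
      map_add' := fun x y => Subtype.ext (map_add (ι R) x y)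
      map_smul' := fun r x => Subtype.ext (map_smul (ι R) r x)
      map_lie' := fun {x y} => Subtype.ext (LieHom.map_lie (ι R) x y) }
  have hg : S.val.comp (UniversalEnvelopingAlgebra.lift R g) = AlgHom.id R _ := uHom_ext fun x => by
    rw [AlgHom.comp_apply, UniversalEnvelopingAlgebra.lift_ι_apply]
    rfl
  refine eq_top_iff.2 fun a _ => ?_
  have ha : (UniversalEnvelopingAlgebra.lift R g a).1 = a := congrArg (fun q => q a) hg
  exact ha ▸ (UniversalEnvelopingAlgebra.lift R g a).2

lemma range_mul_sub_mul (x : L) (I : LieIdeal R L) :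
    ∀ y ∈ I.toSubmodule.map (ι R : L →ₗ⁅R⁆ U R L).toLinearMap,
      ι R x * y - y * ι R x ∈ I.toSubmodule.map (ι R : L →ₗ⁅R⁆ U R L).toLinearMap := by
  rintro _ ⟨y, hy, rfl⟩
  exact ⟨⁅x, y⁆, I.lie_mem hy, LieHom.map_lie (ι R) x y⟩

/-- The span of the powers contains `1`, and it is stable under right multiplication by `L`: by
polarization it contains the symmetrized products of `x^n` and `y`, and `pow_mul_mem_of_sum_mem`
undoes the symmetrization. -/
lemma span_ι_pow [Algebra ℚ R] :
    Submodule.span R {a : U R L | ∃ (x : L) (n : ℕ), ι R x ^ n = a} = ⊤ := by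
  set V := Submodule.span R {a : U R L | ∃ (x : L) (n : ℕ), ι R x ^ n = a} with hV
  have h1 : ∀ x y : L, ∀ n, ι R x ^ n * ι R y ∈ V := fun x y n => by
    refine pow_mul_mem_of_sum_mem (ι R x) _ V (range_mul_sub_mul R x ⊤) ?_ n _ ⟨y, trivial, rfl⟩
    rintro n _ ⟨z, -, rfl⟩
    refine sum_pow_mul_mul_pow_mem V _ _ _ fun m => Submodule.subset_span ⟨x + m • z, n + 1, ?_⟩
    rw [map_add, map_nsmul]
    rfl
  -- The right stabilizer of `V` is a subalgebra; once it contains `L` it is everything, and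
  -- applying it to `1` finishes.
  let S : Subalgebra R (U R L) :=
    { carrier := {a | ∀ v ∈ V, v * a ∈ V}
      mul_mem' := fun {a b} ha hb v hv => by rw [← mul_assoc]; exact hb _ (ha v hv)
      add_mem' := fun {a b} ha hb v hv => by rw [mul_add]; exact V.add_mem (ha v hv) (hb v hv)
      algebraMap_mem' := fun r v hv => by
        rw [← Algebra.commutes, ← Algebra.smul_def]; exact V.smul_mem r hv }
  have hS : S = ⊤ := ueaSubalgebra_eq_top R S fun y v hv => by
    induction hv using Submodule.span_induction with
    | mem v hv =>
      obtain ⟨x, n, rfl⟩ := hv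
      exact h1 x y n
    | zero => rw [zero_mul]; exact V.zero_mem
    | add v w _ _ hv hw => rw [add_mul]; exact V.add_mem hv hw
    | smul r v _ hv => rw [smul_mul_assoc]; exact V.smul_mem r hv
  refine eq_top_iff.2 fun a _ => ?_
  have ha : a ∈ S := hS ▸ Algebra.mem_top
  have := ha 1 (Submodule.subset_span ⟨0, 0, pow_zero _⟩)
  rwa [one_mul] at this

lemma isPrimitive_ι (x : L) : IsPrimitive R (ι R x) := uComul_ι R x

lemma uea_isPolynomialType [Algebra ℚ R] : IsPolynomialType R (U R L) := by
  refine isPolynomialType_of_span (eq_top_iff.2 ?_)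
  rw [← span_ι_pow R]
  refine Submodule.span_mono ?_
  rintro _ ⟨x, n, rfl⟩
  exact ⟨_, n, isPrimitive_ι R x, rfl⟩

/-- Two linear maps on the enveloping algebra agree if they agree on the powers of elements of the
Lie algebra. -/
lemma uea_linearMap_ext [Algebra ℚ R] {M : Type u} [AddCommGroup M] [Module R M]
    {f g : U R L →ₗ[R] M} (h : ∀ (x : L) (n : ℕ), f (ι R x ^ n) = g (ι R x ^ n)) : f = g :=
  LinearMap.ext_on (span_ι_pow R) (by rintro _ ⟨x, n, rfl⟩; exact h x n)

lemma uea_eulerian_pow [Algebra ℚ R] (x : L) (n k : ℕ) :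
    (eulerian (uea_isPolynomialType R (L := L)) k).ofConv (ι R x ^ n) =
      if n = k then ι R x ^ n else 0 :=
  (isPrimitive_ι R x).eulerian_pow _ n k

lemma uea_eulerian_one_mem [Algebra ℚ R] (a : U R L) :
    ∃ x : L, (eulerian (uea_isPolynomialType R (L := L)) 1).ofConv a = ι R x := by
  have ha : a ∈ Submodule.span R {a : U R L | ∃ (x : L) (n : ℕ), ι R x ^ n = a} := by
    rw [span_ι_pow R]
    exact Submodule.mem_top
  induction ha using Submodule.span_induction with
  | mem a ha =>
    obtain ⟨x, n, rfl⟩ := ha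
    rw [uea_eulerian_pow]
    split_ifs with h
    · exact ⟨x, by rw [h, pow_one]⟩
    · exact ⟨0, (map_zero _).symm⟩
  | zero => exact ⟨0, by rw [map_zero, map_zero]⟩
  | add a b _ _ ha hb =>
    obtain ⟨x, hx⟩ := ha
    obtain ⟨y, hy⟩ := hb
    exact ⟨x + y, by rw [map_add, map_add, hx, hy]⟩
  | smul r a _ ha =>
    obtain ⟨x, hx⟩ := ha
    exact ⟨r • x, by rw [map_smul, map_smul, hx]⟩

/-- `e_1` fixes primitive elements and takes its values in the image of `L`. -/
lemma exists_ι_eq_of_isPrimitive [Algebra ℚ R] {a : U R L} (ha : IsPrimitive R a) :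
    ∃ x : L, ι R x = a := by
  obtain ⟨x, hx⟩ := uea_eulerian_one_mem R a
  exact ⟨x, by rw [← hx, ha.eulerian_one]⟩

/-- If `I` is an ideal of `L`, then the linear part of an element of the left ideal of `U(L)`
generated by `I` belongs to `I`. -/
lemma uea_eulerian_one_mem_of_mem_span [Algebra ℚ R] (I : LieIdeal R L) (a : U R L)
    (ha : a ∈ Ideal.span (I.toSubmodule.map (ι R : L →ₗ⁅R⁆ U R L).toLinearMap : Set (U R L))) :
    (eulerian (uea_isPolynomialType R (L := L)) 1).ofConv a ∈
      I.toSubmodule.map (ι R : L →ₗ⁅R⁆ U R L).toLinearMap := by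
  set e := (eulerian (uea_isPolynomialType R (L := L)) 1).ofConv with he
  set K := I.toSubmodule.map (ι R : L →ₗ⁅R⁆ U R L).toLinearMap with hK
  have h1 : ∀ x n, ∀ y ∈ K, ι R x ^ n * y ∈ K.comap e := fun x n => by
    refine pow_mul_mem_of_sum_mem (ι R x) K (K.comap e) (range_mul_sub_mul R x I) ?_ n
    rintro n _ ⟨y, hy, rfl⟩
    -- The sum has total degree `n + 1`. In degree one it is `y` itself; in higher degree `e_1`
    -- kills all powers, hence by polarization the sum.
    cases n with
    | zero =>
      have h2 : e (ι R y) = ι R y := (isPrimitive_ι R y).eulerian_one _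
      have h3 : e (ι R y) ∈ K := by rw [h2]; exact ⟨y, hy, rfl⟩
      simpa using h3
    | succ n =>
      refine
        (LinearMap.ker_le_comap e) (sum_pow_mul_mul_pow_mem (LinearMap.ker e) _ _ _ fun m => ?_)
      have h2 : ι R x + m • (ι R : L →ₗ⁅R⁆ U R L).toLinearMap y = ι R (x + m • y) := by
        rw [map_add, map_nsmul]
        rfl
      rw [h2, LinearMap.mem_ker, he, uea_eulerian_pow, if_neg (by omega)]
  have h4 : ∀ u : U R L, ∀ y ∈ K, e (u * y) ∈ K := by
    intro u y hy
    have hu : u ∈ Submodule.span R {a : U R L | ∃ (x : L) (n : ℕ), ι R x ^ n = a} := by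
      rw [span_ι_pow R]
      exact Submodule.mem_top
    induction hu using Submodule.span_induction with
    | mem u hu =>
      obtain ⟨x, n, rfl⟩ := hu
      exact h1 x n y hy
    | zero => rw [zero_mul, map_zero]; exact K.zero_mem
    | add u v _ _ hu hv => rw [add_mul, map_add]; exact K.add_mem hu hv
    | smul r u _ hu => rw [smul_mul_assoc, map_smul]; exact K.smul_mem r hu
  -- The statement is strengthened by a left factor `u` so that the induction over the left ideal
  -- closes under multiplication.
  have h5 : ∀ u : U R L, e (u * a) ∈ K := by
    induction ha using Submodule.span_induction with
    | mem y hy => exact fun u => h4 u y hy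
    | zero => intro u; rw [mul_zero, map_zero]; exact K.zero_mem
    | add a b _ _ ha hb => intro u; rw [mul_add, map_add]; exact K.add_mem (ha u) (hb u)
    | smul v a _ ha => intro u; rw [smul_eq_mul, ← mul_assoc]; exact ha _
  have h6 := h5 1
  rwa [one_mul] at h6

end Span

/-! ### Injectivity of `L → U(L)` -/

section Injective

variable (R : Type u) [CommRing R]

local notation "U" => UniversalEnvelopingAlgebra
local notation "ι" => UniversalEnvelopingAlgebra.ι

lemma freeLie_mem_of_forall_of_mem {X : Type u} (S : LieSubalgebra R (FreeLieAlgebra R X))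
    (h : ∀ x, FreeLieAlgebra.of R x ∈ S) (f : FreeLieAlgebra R X) : f ∈ S := by
  have hS : S.incl.comp (FreeLieAlgebra.lift R fun x => (⟨_, h x⟩ : S)) = LieHom.id :=
    FreeLieAlgebra.hom_ext fun x => by
      rw [LieHom.comp_apply, FreeLieAlgebra.lift_of_apply]
      rfl
  have hf : (FreeLieAlgebra.lift R (fun x => (⟨_, h x⟩ : S)) f).1 = f :=
    congrArg (fun q => q f) hS
  exact hf ▸ (FreeLieAlgebra.lift R (fun x => (⟨_, h x⟩ : S)) f).2

/-- A linear endomorphism is injective on a module spanned by eigenvectors with positive integral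
eigenvalues. -/
lemma eq_zero_of_span_eigenvectors [Algebra ℚ R] {M : Type u} [AddCommGroup M] [Module R M]
    (E : Module.End R M) (h : Submodule.span R {v : M | ∃ n : ℕ, E v = (n + 1) • v} = ⊤)
    (v : M) (hv : E v = 0) : v = 0 := by
  -- Each vector is killed by `q(E)` for some integral `q` with nonzero constant term: `X - (n + 1)`
  -- for an eigenvector, and a product for a sum. On the kernel of `E` only the constant term acts,
  -- and nonzero integers are invertible in `R`.
  have h1 : ∀ v : M, ∃ q : ℤ[X], q.coeff 0 ≠ 0 ∧ aeval E q v = 0 := by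
    intro v
    have hv : v ∈ Submodule.span R {v : M | ∃ n : ℕ, E v = (n + 1) • v} := h ▸ Submodule.mem_top
    induction hv using Submodule.span_induction with
    | mem v hv =>
      obtain ⟨n, hn⟩ := hv
      refine ⟨X - C ((n : ℤ) + 1), ?_, ?_⟩
      · rw [coeff_sub, coeff_X_zero, coeff_C_zero]
        omega
      · rw [map_sub, aeval_X, aeval_C, LinearMap.sub_apply, hn]
        have h2 : algebraMap ℤ (Module.End R M) ((n : ℤ) + 1) = ((n + 1 : ℕ) : Module.End R M) := by
          simp
        rw [h2, Module.End.natCast_apply, sub_self]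
    | zero => exact ⟨1, by simp, map_zero _⟩
    | add v w _ _ hv hw =>
      obtain ⟨p, hp, hp'⟩ := hv
      obtain ⟨q, hq, hq'⟩ := hw
      refine ⟨p * q, by rw [mul_coeff_zero]; exact mul_ne_zero hp hq, ?_⟩
      rw [map_add]
      nth_rw 1 [mul_comm p q]
      rw [map_mul, map_mul, Module.End.mul_apply, Module.End.mul_apply, hp', hq', map_zero,
        map_zero, add_zero]
    | smul r v _ hv =>
      obtain ⟨p, hp, hp'⟩ := hv
      exact ⟨p, hp, by rw [map_smul, hp', smul_zero]⟩
  obtain ⟨q, hq, hq'⟩ := h1 v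
  rw [← divX_mul_X_add q, map_add, map_mul, aeval_X, aeval_C, LinearMap.add_apply,
    Module.End.mul_apply, hv, map_zero, zero_add] at hq'
  have h2 : (q.coeff 0).natAbs • v = 0 := by
    have h3 : (q.coeff 0) • v = 0 := by
      rw [← hq']
      simp
    rcases Int.natAbs_eq (q.coeff 0) with h4 | h4
    · rw [h4, natCast_zsmul] at h3
      exact h3
    · rw [h4, neg_smul, natCast_zsmul, neg_eq_zero] at h3
      exact h3
  have h5 := mem_of_natCast_smul_mem (⊥ : Submodule R M) (Int.natAbs_ne_zero.2 hq) (x := v)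
    (by rw [Nat.cast_smul_eq_nsmul, h2]; exact Submodule.zero_mem _)
  exact h5

/-- The affine representation of the free Lie algebra `F` on `F × R` attached to its degree
derivation, given on generators by `x (g, r) = ([x, g] + r x, 0)`. -/
def freeLieAffine (X : Type u) :
    FreeLieAlgebra R X →ₗ⁅R⁆ Module.End R (FreeLieAlgebra R X × R) :=
  FreeLieAlgebra.lift R fun x =>
    LinearMap.inl R _ R ∘ₗ (LinearMap.coprod (LieAlgebra.ad R _ (FreeLieAlgebra.of R x))
      (LinearMap.toSpanSingleton R _ (FreeLieAlgebra.of R x)))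

/-- The degree derivation of the free Lie algebra. -/
def freeLieDegree (X : Type u) : Module.End R (FreeLieAlgebra R X) :=
  LinearMap.fst R _ R ∘ₗ LinearMap.applyₗ ((0 : FreeLieAlgebra R X), (1 : R)) ∘ₗ
    (freeLieAffine R X).toLinearMap

lemma freeLieDegree_apply {X : Type u} (f : FreeLieAlgebra R X) :
    freeLieDegree R X f = (freeLieAffine R X f (0, 1)).1 := rfl

/-- The elements acting by their adjoint action on `F × 0` and sending `(0, 1)` into `F × 0` form a
Lie subalgebra containing the generators. Consequently `f ↦ f · (0, 1)` is a 1-cocycle with values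
in the adjoint representation, that is, a derivation. -/
lemma freeLieAffine_apply {X : Type u} (f : FreeLieAlgebra R X) :
    (∀ g, freeLieAffine R X f (g, 0) = (⁅f, g⁆, 0)) ∧ (freeLieAffine R X f (0, 1)).2 = 0 := by
  let S : LieSubalgebra R (FreeLieAlgebra R X) :=
    { carrier := {f | (∀ g, freeLieAffine R X f (g, 0) = (⁅f, g⁆, 0)) ∧
        (freeLieAffine R X f (0, 1)).2 = 0}
      zero_mem' := ⟨fun g => by rw [map_zero, zero_lie]; rfl, by simp⟩
      add_mem' := fun {a b} ha hb => ⟨fun g => by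
        rw [map_add, LinearMap.add_apply, ha.1, hb.1, add_lie, Prod.mk_add_mk, add_zero], by
        rw [map_add, LinearMap.add_apply, Prod.snd_add, ha.2, hb.2, add_zero]⟩
      smul_mem' := fun r a ha => ⟨fun g => by
        rw [map_smul, LinearMap.smul_apply, ha.1, smul_lie, Prod.smul_mk, smul_zero], by
        rw [map_smul, LinearMap.smul_apply, Prod.smul_snd, ha.2, smul_zero]⟩
      lie_mem' := fun {a b} ha hb => by
        have h : ∀ c, (freeLieAffine R X c (0, 1)).2 = 0 → freeLieAffine R X c (0, 1) =
            ((freeLieAffine R X c (0, 1)).1, 0) := fun c hc => Prod.ext rfl hc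
        refine ⟨fun g => ?_, ?_⟩
        · rw [LieHom.map_lie, LieRing.of_associative_ring_bracket, LinearMap.sub_apply,
            Module.End.mul_apply, Module.End.mul_apply, ha.1, hb.1, ha.1, hb.1, lie_lie,
            Prod.mk_sub_mk, sub_zero]
        · rw [LieHom.map_lie, LieRing.of_associative_ring_bracket, LinearMap.sub_apply,
            Module.End.mul_apply, Module.End.mul_apply, h a ha.2, h b hb.2, ha.1, hb.1,
            Prod.mk_sub_mk, sub_zero] }
  refine freeLie_mem_of_forall_of_mem R S (fun x => ?_) f
  refine ⟨fun g => ?_, ?_⟩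
  · simp [freeLieAffine]
  · simp [freeLieAffine]

lemma freeLieDegree_of {X : Type u} (x : X) :
    freeLieDegree R X (FreeLieAlgebra.of R x) = FreeLieAlgebra.of R x := by
  simp [freeLieDegree_apply, freeLieAffine]

lemma freeLieDegree_lie {X : Type u} (f g : FreeLieAlgebra R X) :
    freeLieDegree R X ⁅f, g⁆ = ⁅f, freeLieDegree R X g⁆ - ⁅g, freeLieDegree R X f⁆ := by
  have h : ∀ c, freeLieAffine R X c (0, 1) = (freeLieDegree R X c, 0) :=
    fun c => Prod.ext rfl (freeLieAffine_apply R c).2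
  rw [freeLieDegree_apply, LieHom.map_lie, LieRing.of_associative_ring_bracket,
    LinearMap.sub_apply, Module.End.mul_apply, Module.End.mul_apply, h, h,
    (freeLieAffine_apply R f).1, (freeLieAffine_apply R g).1]
  rfl

lemma span_freeLieDegree_eigenvectors (X : Type u) :
    Submodule.span R {f | ∃ n : ℕ, freeLieDegree R X f = (n + 1) • f} = ⊤ := by
  let S : LieSubalgebra R (FreeLieAlgebra R X) :=
    { Submodule.span R {f | ∃ n : ℕ, freeLieDegree R X f = (n + 1) • f} with
      lie_mem' := fun {a b} ha hb => by
        have ha' : a ∈ Submodule.span R {f | ∃ n : ℕ, freeLieDegree R X f = (n + 1) • f} := ha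
        have hb' : b ∈ Submodule.span R {f | ∃ n : ℕ, freeLieDegree R X f = (n + 1) • f} := hb
        show ⁅a, b⁆ ∈ Submodule.span R {f | ∃ n : ℕ, freeLieDegree R X f = (n + 1) • f}
        clear ha hb
        induction ha', hb' using Submodule.span_induction₂ with
        | mem_mem a b ha hb =>
          obtain ⟨n, hn⟩ := ha
          obtain ⟨m, hm⟩ := hb
          -- Degrees are recorded as `n + 1` to keep them positive, so `n + 1` and `m + 1` add up to
          -- `(n + m + 1) + 1`.
          refine Submodule.subset_span ⟨n + m + 1, ?_⟩
          rw [freeLieDegree_lie, hn, hm, lie_nsmul, lie_nsmul, ← lie_skew b a, smul_neg,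
            sub_neg_eq_add, ← add_smul]
          congr 1
          omega
        | zero_left b hb => rw [zero_lie]; exact Submodule.zero_mem _
        | zero_right a ha => rw [lie_zero]; exact Submodule.zero_mem _
        | add_left a b c _ _ _ h1 h2 => rw [add_lie]; exact Submodule.add_mem _ h1 h2
        | add_right a b c _ _ _ h1 h2 => rw [lie_add]; exact Submodule.add_mem _ h1 h2
        | smul_left r a b _ _ h => rw [smul_lie]; exact Submodule.smul_mem _ r h
        | smul_right r a b _ _ h => rw [lie_smul]; exact Submodule.smul_mem _ r h }
  refine eq_top_iff.2 fun f _ => ?_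
  refine freeLie_mem_of_forall_of_mem R S (fun x => ?_) f
  exact Submodule.subset_span ⟨0, by rw [freeLieDegree_of, zero_add, one_smul]⟩

/-- The affine representation extends to the enveloping algebra, so the degree derivation factors
through `ι`; and the derivation is injective, since homogeneous elements have positive degree. -/
lemma freeLie_ι_injective [Algebra ℚ R] (X : Type u) (f : FreeLieAlgebra R X) (hf : ι R f = 0) :
    f = 0 := by
  refine eq_zero_of_span_eigenvectors R (freeLieDegree R X) (span_freeLieDegree_eigenvectors R X)
    f ?_
  rw [freeLieDegree_apply, ← UniversalEnvelopingAlgebra.lift_ι_apply R (freeLieAffine R X) f, hf,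
    map_zero]
  rfl

variable {L : Type u} [LieRing L] [LieAlgebra R L]

/-- For `y` in the ideal, `y x = x y - [x, y]`, and both terms belong to the left ideal. Thus the
right stabilizer of the left ideal contains `L`. -/
lemma isTwoSided_span_ι (I : LieIdeal R L) :
    (Ideal.span (I.toSubmodule.map (ι R : L →ₗ⁅R⁆ U R L).toLinearMap
      : Set (U R L))).IsTwoSided := by
  set K := I.toSubmodule.map (ι R : L →ₗ⁅R⁆ U R L).toLinearMap with hK
  set J := Ideal.span (K : Set (U R L)) with hJ
  let S : Subalgebra R (U R L) :=
    { carrier := {b | ∀ a ∈ J, a * b ∈ J}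
      mul_mem' := fun {a b} ha hb v hv => by rw [← mul_assoc]; exact hb _ (ha v hv)
      add_mem' := fun {a b} ha hb v hv => by rw [mul_add]; exact J.add_mem (ha v hv) (hb v hv)
      algebraMap_mem' := fun r v hv => by rw [← Algebra.commutes]; exact J.mul_mem_left _ hv }
  have hS : S = ⊤ := ueaSubalgebra_eq_top R S fun x a ha => by
    induction ha using Submodule.span_induction with
    | mem y hy =>
      have h1 := J.sub_mem (J.mul_mem_left (ι R x) (Ideal.subset_span hy))
        (Ideal.subset_span (range_mul_sub_mul R x I y hy))
      rwa [sub_sub_cancel] at h1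
    | zero => rw [zero_mul]; exact J.zero_mem
    | add v w _ _ hv hw => rw [add_mul]; exact J.add_mem hv hw
    | smul r v _ hv => rw [smul_eq_mul, mul_assoc]; exact J.mul_mem_left _ hv
  exact ⟨fun {a} b ha => (hS ▸ Algebra.mem_top : b ∈ S) a ha⟩

/-- Over a `ℚ`-algebra, a Lie algebra embeds into its enveloping algebra. -/
lemma ι_injective [Algebra ℚ R] : Function.Injective (ι R : L →ₗ⁅R⁆ U R L) := by
  let p : FreeLieAlgebra R L →ₗ⁅R⁆ L := FreeLieAlgebra.lift R id
  have hp : ∀ x, p (FreeLieAlgebra.of R x) = x := fun x => FreeLieAlgebra.lift_of_apply id x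
  let K := p.ker.toSubmodule.map (ι R : FreeLieAlgebra R L →ₗ⁅R⁆ _).toLinearMap
  let J : Ideal (U R (FreeLieAlgebra R L)) := Ideal.span (K : Set (U R (FreeLieAlgebra R L)))
  have hJ : J.IsTwoSided := isTwoSided_span_ι R p.ker
  -- Modulo `J` the class of `ι f` depends only on `p f`, so the set-theoretic section
  -- `FreeLieAlgebra.of` of `p` induces a Lie morphism on `L`.
  let s : FreeLieAlgebra R L → U R (FreeLieAlgebra R L) ⧸ J := fun f => Ideal.Quotient.mk J (ι R f)
  have hs : ∀ f g, p f = p g → s f = s g := fun f g h => by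
    refine Ideal.Quotient.eq.2 (Ideal.subset_span ⟨f - g, ?_, map_sub (ι R) f g⟩)
    show f - g ∈ p.ker
    rw [LieHom.mem_ker, map_sub, h, sub_self]
  let g : L →ₗ⁅R⁆ U R (FreeLieAlgebra R L) ⧸ J :=
    { toFun := fun x => s (FreeLieAlgebra.of R x)
      map_add' := fun x y => by
        rw [hs _ (FreeLieAlgebra.of R x + FreeLieAlgebra.of R y) (by rw [map_add, hp, hp, hp])]
        simp only [s, map_add]
      map_smul' := fun r x => by
        rw [hs _ (r • FreeLieAlgebra.of R x) (by rw [map_smul, hp, hp])]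
        simp only [s, map_smul]
        rfl
      map_lie' := fun {x y} => by
        show s _ = ⁅s _, s _⁆
        rw [hs _ ⁅FreeLieAlgebra.of R x, FreeLieAlgebra.of R y⁆
          (by rw [LieHom.map_lie, hp, hp, hp])]
        simp only [s, LieHom.map_lie, LieRing.of_associative_ring_bracket, map_sub, map_mul] }
  refine (injective_iff_map_eq_zero _).2 fun x hx => ?_
  have h1 : g x = 0 := by
    rw [← UniversalEnvelopingAlgebra.lift_ι_apply R g x, hx, map_zero]
  -- If `ι x = 0`, the generator of `x` lies in `J`. It is primitive, hence equal to its linear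
  -- part, which comes from `ker p`; injectivity in the free case places the generator itself in
  -- `ker p`.
  obtain ⟨f, hf, hf'⟩ :=
    uea_eulerian_one_mem_of_mem_span R p.ker _ (Ideal.Quotient.eq_zero_iff_mem.1 h1)
  rw [(isPrimitive_ι R _).eulerian_one] at hf'
  have h2 : f = FreeLieAlgebra.of R x := by
    rw [← sub_eq_zero]
    refine freeLie_ι_injective R L _ ?_
    rw [map_sub, sub_eq_zero]
    exact hf'
  rw [← hp x, ← h2]
  exact LieHom.mem_ker.1 hf

end Injective

/-! ### The filtration by the annihilators of the powers of the augmentation ideal -/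

section Annihilators

variable {R : Type u} [CommRing R]

lemma AlgebraScheme.prod_map {A : Type u} [AddCommGroup A] [Module R A] (D : AlgebraScheme R A)
    {S T : Type u} [CommRing S] [Algebra R S] [CommRing T] [Algebra R T] (φ : S →ₐ[R] T)
    (l : List (A →ₗ[R] S)) :
    D.prod (l.map fun f => φ.toLinearMap ∘ₗ f) = φ.toLinearMap ∘ₗ D.prod l := by
  induction l with
  | nil => exact (D.map_one S T φ).symm
  | cons f l ih =>
    show D.mul T (φ.toLinearMap ∘ₗ f) (D.prod (l.map fun f => φ.toLinearMap ∘ₗ f)) = _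
    rw [ih, D.map_mul]
    rfl

/-- A product of `m + 1` elements of the augmentation ideal is a product of `n + 1` elements of it
if `n ≤ m`. -/
lemma exists_prod_eq_of_le (G : FormalMonoid R) {S : Type u} [CommRing S] [Algebra R S] {n m : ℕ}
    (h : n ≤ m) (l : List (G.carrier →ₗ[R] S)) (hl : l.length = m + 1)
    (hI : ∀ f ∈ l, f ∈ augIdeal G S) :
    ∃ l' : List (G.carrier →ₗ[R] S), l'.length = n + 1 ∧ (∀ f ∈ l', f ∈ augIdeal G S) ∧
      G.scheme.prod l' = G.scheme.prod l := by
  induction m, h using Nat.le_induction generalizing l with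
  | base => exact ⟨l, hl, hI, rfl⟩
  | succ m _ ih =>
    obtain ⟨f, l, rfl⟩ := List.exists_cons_of_length_eq_add_one hl
    obtain ⟨g, l, rfl⟩ := List.exists_cons_of_length_eq_add_one
      (show l.length = m + 1 by simpa using hl)
    obtain ⟨l', h1, h2, h3⟩ := ih (G.scheme.mul S f g :: l) (by simpa using hl) (by
      intro k hk
      rcases List.mem_cons.1 hk with rfl | hk
      · have hf : f 1 = 0 := hI f (by simp)
        show G.scheme.mul S f g 1 = 0
        rw [(G.counit S).1, hf, zero_mul]
      · exact hI k (by simp [hk]))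
    exact ⟨l', h1, h2, h3.trans (G.scheme.mul_assoc S f g _)⟩

lemma annPow_mono (G : FormalMonoid R) : Monotone (annPow G) := by
  intro n m h a ha S _ _ l hl hI
  obtain ⟨l', h1, h2, h3⟩ := exists_prod_eq_of_le G h l hl hI
  rw [← h3]
  exact ha S l' h1 h2

lemma annPowBase_mono (G : FormalMonoid R) (S : Type u) [CommRing S] [Algebra R S] {n m : ℕ}
    (h : n ≤ m) : annPowBase G n S ⊆ annPowBase G m S := by
  intro x hx T _ _ φ l hl hI
  obtain ⟨l', h1, h2, h3⟩ := exists_prod_eq_of_le G h l hl hI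
  rw [← h3]
  exact hx T φ l' h1 h2

/-- Only uniqueness in the limit is needed: the projection of `A` to its quotient by the union of
the `A_n`, made into a form by a square-zero extension, and the zero form agree on every `A_n`. -/
lemma exists_mem_annPow_of_complete (G : FormalMonoid R)
    (h : ∀ (S : Type u) [CommRing S] [Algebra R S] (g : ∀ n, annPow G n →ₗ[R] S),
      (∀ n m, n ≤ m → ∀ (a : G.carrier) (ha : a ∈ annPow G n) (ha' : a ∈ annPow G m),
        g m ⟨a, ha'⟩ = g n ⟨a, ha⟩) →
      ∃! f : G.carrier →ₗ[R] S, ∀ n (a : annPow G n), f a = g n a) (a : G.carrier) :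
    ∃ n, a ∈ annPow G n := by
  set V : Submodule R G.carrier := ⨆ n, annPow G n with hV
  have h1 := (h (SqZero R (G.carrier ⧸ V)) (fun _ => 0) (fun _ _ _ _ _ _ => rfl)).unique
    (y₁ := SqZero.inr R (G.carrier ⧸ V) ∘ₗ V.mkQ) (y₂ := 0) (fun n a => by
      have h2 : V.mkQ (a : G.carrier) = 0 :=
        (Submodule.Quotient.mk_eq_zero V).2 (Submodule.mem_iSup_of_mem n a.2)
      show SqZero.inr R (G.carrier ⧸ V) (V.mkQ (a : G.carrier)) = 0
      rw [h2, map_zero]) (fun n a => rfl)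
  have h2 : V.mkQ a = 0 := SqZero.inr_injective R _ (by
    rw [map_zero]
    exact congrArg (fun q => q a) h1)
  exact (Submodule.mem_iSup_of_directed _ (annPow_mono G).directed_le).1
    ((Submodule.Quotient.mk_eq_zero V).1 h2)

variable {A : Type u} [Ring A] [Bialgebra R A] [Coalgebra.IsCocomm R A]

variable (R A) in
/-- `annPow` for the formal monoid of a cocommutative bialgebra. -/
def annFiltration (n : ℕ) : Submodule R A := annPow (FormalMonoid.ofBialgebra (R := R) A) n

lemma mem_annFiltration_iff {n : ℕ} {a : A} : a ∈ annFiltration R A n ↔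
    ∀ (S : Type u) [CommRing S] [Algebra R S] (l : List (A →ₗ[R] S)), l.length = n + 1 →
      (∀ f ∈ l, f 1 = 0) → (AlgebraScheme.ofCoalgebra (R := R) A).prod l a = 0 := Iff.rfl

lemma mem_annPowBase_ofBialgebra_iff {n : ℕ} {S : Type u} [CommRing S] [Algebra R S]
    {x : S ⊗[R] A} : x ∈ annPowBase (FormalMonoid.ofBialgebra (R := R) A) n S ↔
      ∀ (T : Type u) [CommRing T] [Algebra R T] (φ : S →ₐ[R] T) (l : List (A →ₗ[R] T)),
        l.length = n + 1 → (∀ f ∈ l, f 1 = 0) →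
          baseForm φ ((AlgebraScheme.ofCoalgebra (R := R) A).prod l) x = 0 := Iff.rfl

/-- The convolution powers of a linear map which vanishes at `1`, with values in any algebra,
factor through products in commutative algebras. -/
lemma exists_prod_eq_pow {B : Type u} [Ring B] [Algebra R B] (f : A →ₗ[R] B) (hf : f 1 = 0)
    (k : ℕ) : ∃ (S : Type u) (_ : CommRing S) (_ : Algebra R S) (l : List (A →ₗ[R] S))
      (q : S →ₗ[R] B), l.length = k ∧ (∀ g ∈ l, g 1 = 0) ∧
        q ∘ₗ (AlgebraScheme.ofCoalgebra (R := R) A).prod l = (toConv f ^ k).ofConv := by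
  induction k with
  | zero => exact ⟨R, inferInstance, inferInstance, [], Algebra.linearMap R B, rfl, by simp, rfl⟩
  | succ k ih =>
    obtain ⟨S, _, _, l, q, h1, h2, h3⟩ := ih
    let i₁ : SqZero R B →ₐ[R] SqZero R B ⊗[R] S := Algebra.TensorProduct.includeLeft
    let i₂ : S →ₐ[R] SqZero R B ⊗[R] S := Algebra.TensorProduct.includeRight
    -- Each new factor gets its own square-zero copy of `B`. The tensor product is commutative, and
    -- the order of multiplication in `B` is restored only by the linear map `q`.
    refine ⟨SqZero R B ⊗[R] S, inferInstance, inferInstance,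
      (i₁.toLinearMap ∘ₗ SqZero.inr R B ∘ₗ f) :: l.map fun g => i₂.toLinearMap ∘ₗ g,
      LinearMap.mul' R B ∘ₗ TensorProduct.map (SqZero.snd R B) q, by simp [h1], ?_, ?_⟩
    · intro g hg
      rcases List.mem_cons.1 hg with rfl | hg
      · rw [LinearMap.comp_apply, LinearMap.comp_apply, hf, map_zero, map_zero]
      · obtain ⟨g', hg', rfl⟩ := List.mem_map.1 hg
        rw [LinearMap.comp_apply, h2 g' hg', map_zero]
    · rw [pow_succ']
      ext a
      rw [LinearMap.convMul_apply, ← h3]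
      show LinearMap.mul' R B (TensorProduct.map (SqZero.snd R B) q
        (extMul (i₁.toLinearMap ∘ₗ SqZero.inr R B ∘ₗ f) ((AlgebraScheme.ofCoalgebra (R := R) A).prod
          (l.map fun g => i₂.toLinearMap ∘ₗ g)) (Coalgebra.comul a))) = _
      rw [AlgebraScheme.prod_map]
      induction (Coalgebra.comul (R := R) a) with
      | zero => simp
      | add s t hs ht => simp only [map_add, hs, ht]
      | tmul s t =>
        have h4 : ∀ x y, i₁ x * i₂ y = x ⊗ₜ y := fun x y =>
          (Algebra.TensorProduct.tmul_mul_tmul x 1 1 y).trans (by rw [mul_one, one_mul]; rfl)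
        show LinearMap.mul' R B (TensorProduct.map (SqZero.snd R B) q
          (i₁ (SqZero.inr R B (f s)) * i₂ _)) = _
        rw [h4]
        rfl

lemma convPow_apply_eq_zero {B : Type u} [Ring B] [Algebra R B] (f : A →ₗ[R] B) (hf : f 1 = 0)
    {n k : ℕ} (h : n < k) {a : A} (ha : a ∈ annFiltration R A n) :
    (toConv f ^ k).ofConv a = 0 := by
  obtain ⟨S, _, _, l, q, h1, h2, h3⟩ := exists_prod_eq_pow f hf k
  obtain ⟨k, rfl⟩ := Nat.exists_eq_add_of_le' (Nat.zero_lt_of_lt h)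
  rw [← h3, LinearMap.comp_apply,
    mem_annFiltration_iff.1 (annPow_mono _ (Nat.lt_succ_iff.1 h) ha) S l h1 h2, map_zero]

/-- Base change of `convPow_apply_eq_zero`: the commutative algebra `T` through which the
convolution power factors is replaced by the `S`-algebra `S ⊗ T`. -/
lemma lTensor_convPow_apply_eq_zero {B : Type u} [Ring B] [Algebra R B] (f : A →ₗ[R] B)
    (hf : f 1 = 0) {n k : ℕ} (h : n < k) (S : Type u) [CommRing S] [Algebra R S] {x : S ⊗[R] A}
    (hx : x ∈ annPowBase (FormalMonoid.ofBialgebra (R := R) A) n S) :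
    (toConv f ^ k).ofConv.lTensor S x = 0 := by
  obtain ⟨T, _, _, l, q, h1, h2, h3⟩ := exists_prod_eq_pow f hf k
  obtain ⟨k, rfl⟩ := Nat.exists_eq_add_of_le' (Nat.zero_lt_of_lt h)
  let i₂ : T →ₐ[R] S ⊗[R] T := Algebra.TensorProduct.includeRight
  have h4 := mem_annPowBase_ofBialgebra_iff.1
    (annPowBase_mono _ S (Nat.lt_succ_iff.1 h) hx) (S ⊗[R] T)
    Algebra.TensorProduct.includeLeft (l.map fun g => i₂.toLinearMap ∘ₗ g) (by simp [h1]) (by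
      intro g hg
      obtain ⟨g', hg', rfl⟩ := List.mem_map.1 hg
      show i₂ (g' 1) = 0
      rw [h2 g' hg', map_zero])
  rw [AlgebraScheme.prod_map] at h4
  have h5 : ∀ g : A →ₗ[R] T, baseForm (Algebra.TensorProduct.includeLeft : S →ₐ[R] S ⊗[R] T)
      (i₂.toLinearMap ∘ₗ g) = g.lTensor S := by
    intro g
    ext s a
    simp [baseForm, extMul, i₂]
  have h6 : ((AlgebraScheme.ofCoalgebra (R := R) A).prod l).lTensor S x = 0 := by
    rw [← h5]
    exact h4
  rw [← h3, LinearMap.lTensor_comp, LinearMap.comp_apply, h6, map_zero]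

/-- A pigeonhole argument: the iterated coproduct distributes `j` copies of `x` over `n + 1`
factors, so some factor is evaluated at `1`, where it vanishes. -/
lemma IsPrimitive.pow_mem_annFiltration {x : A} (hx : IsPrimitive R x) {j n : ℕ} (h : j ≤ n) :
    x ^ j ∈ annFiltration R A n := by
  refine mem_annFiltration_iff.2 fun S _ _ l hl hI => ?_
  have key : ∀ (l : List (A →ₗ[R] S)) (j : ℕ), (∀ f ∈ l, f 1 = 0) → j < l.length →
      (AlgebraScheme.ofCoalgebra (R := R) A).prod l (x ^ j) = 0 := by
    intro l
    induction l with
    | nil => intro j _ hj; simp at hj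
    | cons f l ih =>
      intro j hI hj
      have h1 := hx.convMul_pow_apply j (toConv f)
        (toConv ((AlgebraScheme.ofCoalgebra (R := R) A).prod l))
      refine Eq.trans h1 (Finset.sum_eq_zero fun i hi => ?_)
      cases i with
      | zero =>
        have hf : f 1 = 0 := hI f (by simp)
        rw [pow_zero]
        show _ • (f 1 * _) = _
        rw [hf, zero_mul, smul_zero]
      | succ i =>
        rw [List.length_cons] at hj
        have h2 := ih (j - (i + 1)) (fun g hg => hI g (by simp [hg]))
          (by have := Finset.mem_range.1 hi; omega)
        show _ • (_ * (AlgebraScheme.ofCoalgebra (R := R) A).prod l _) = _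
        rw [h2, mul_zero, smul_zero]
  exact key l j hI (by omega)

lemma exists_polynomial_choose [Algebra ℚ R] (k : ℕ) :
    ∃ b : R[X], ∀ m : ℕ, b.eval (m : R) = (m.choose k : R) := by
  refine ⟨C (algebraMap ℚ R (k.factorial : ℚ)⁻¹) * descPochhammer R k, fun m => ?_⟩
  rw [eval_mul, eval_C, descPochhammer_eval_eq_descFactorial,
    Nat.descFactorial_eq_factorial_mul_choose, Nat.cast_mul, ← mul_assoc,
    ← map_natCast (algebraMap ℚ R) k.factorial, ← map_mul,
    inv_mul_cancel₀ (Nat.cast_ne_zero.2 k.factorial_ne_zero), map_one, one_mul]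

/-- Write `id = 1 + v` with `v 1 = 0`. In the binomial expansion of `id^m`, the power `v^k` kills
`A_n` for `k > n`, and each remaining binomial coefficient is a polynomial in `m`. -/
lemma isPolynomialType_of_exists_mem_annFiltration [Algebra ℚ R]
    (h : ∀ a : A, ∃ n, a ∈ annFiltration R A n) : IsPolynomialType R A := by
  intro a
  obtain ⟨n, hn⟩ := h a
  let v : A →ₗ[R] A := (idConv R A - 1).ofConv
  have hv : v 1 = 0 := by
    show (1 : A) - algebraMap R A (Coalgebra.counit (1 : A)) = 0
    simp
  choose b hb using exists_polynomial_choose (R := R)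
  refine ⟨∑ k ∈ Finset.range (n + 1),
    mapAlgHom (Algebra.ofId R A) (b k) * C ((toConv v ^ k).ofConv a),
    fun m => ?_⟩
  have h1 : ∀ p : R[X], polyEval (m : R) (mapAlgHom (Algebra.ofId R A) p) =
      algebraMap R A (p.eval (m : R)) := fun p => polyEval_mapAlgHom (Algebra.ofId R A) _ p
  have h2 : idConv R A = toConv v + 1 := by
    show _ = idConv R A - 1 + 1
    rw [sub_add_cancel]
  have h3 : (idConv R A ^ m).ofConv a =
      ∑ k ∈ Finset.range (m + 1), (m.choose k : R) • (toConv v ^ k).ofConv a := by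
    rw [h2, (Commute.one_right (toConv v)).add_pow]
    refine (congrArg (fun f => f a) (map_sum (WithConv.addEquiv (A →ₗ[R] A)) _ _)).trans ?_
    rw [LinearMap.sum_apply]
    refine Finset.sum_congr rfl fun k _ => ?_
    rw [one_pow, mul_one, ← nsmul_eq_mul', map_nsmul, Nat.cast_smul_eq_nsmul]
    rfl
  rw [map_sum, h3]
  simp only [map_mul, polyEval_C, h1, hb, ← Algebra.smul_def]
  -- One sum stops at `n`, the other at `m`; both extend by zeros to the common range.
  have h4 : ∀ k ∈ Finset.range (n + m + 1), k ∉ Finset.range (n + 1) →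
      (m.choose k : R) • (toConv v ^ k).ofConv a = 0 := fun k _ hk => by
    rw [convPow_apply_eq_zero v hv (by simpa using hk) hn, smul_zero]
  have h5 : ∀ k ∈ Finset.range (n + m + 1), k ∉ Finset.range (m + 1) →
      (m.choose k : R) • (toConv v ^ k).ofConv a = 0 := fun k _ hk => by
    rw [Nat.choose_eq_zero_of_lt (by simpa using hk), Nat.cast_zero, zero_smul]
  rw [Finset.sum_subset (Finset.range_mono (by omega)) h4,
    Finset.sum_subset (Finset.range_mono (by omega)) h5]

end Annihilators

/-! ### The bialgebra of a formal monoid -/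

section Bialgebra

variable {R : Type u} [CommRing R]

lemma extMul_tmul {A B : Type u} [AddCommGroup A] [Module R A] [AddCommGroup B] [Module R B]
    {S : Type u} [CommRing S] [Algebra R S] (f : A →ₗ[R] S) (g : B →ₗ[R] S) (a : A) (b : B) :
    extMul f g (a ⊗ₜ b) = f a * g b := rfl

lemma extMul_include_inr (A B : Type u) [AddCommGroup A] [Module R A] [AddCommGroup B]
    [Module R B] {S T : Type u} [CommRing S] [Algebra R S] [CommRing T] [Algebra R T]
    (f : A →ₗ[R] S) (g : B →ₗ[R] T) :
    extMul ((Algebra.TensorProduct.includeLeft : S →ₐ[R] S ⊗[R] T).toLinearMap ∘ₗ f)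
      ((Algebra.TensorProduct.includeRight : T →ₐ[R] S ⊗[R] T).toLinearMap ∘ₗ g) =
      TensorProduct.map f g := by
  ext a b
  exact (Algebra.TensorProduct.tmul_mul_tmul (f a) 1 1 (g b)).trans (by rw [mul_one, one_mul]; rfl)

/-- There is a universal pair of forms: on `SqZero R A ⊗ SqZero R B` the two inclusions give an
`extMul` which embeds `A ⊗ B`, with retraction given by the projections. -/
lemma eq_of_extMul_eq {A B : Type u} [AddCommGroup A] [Module R A] [AddCommGroup B] [Module R B]
    {t t' : A ⊗[R] B} (h : ∀ (S : Type u) [CommRing S] [Algebra R S] (f : A →ₗ[R] S)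
      (g : B →ₗ[R] S), extMul f g t = extMul f g t') : t = t' := by
  have key := h (SqZero R A ⊗[R] SqZero R B)
    ((Algebra.TensorProduct.includeLeft : SqZero R A →ₐ[R] _).toLinearMap ∘ₗ SqZero.inr R A)
    ((Algebra.TensorProduct.includeRight : SqZero R B →ₐ[R] _).toLinearMap ∘ₗ SqZero.inr R B)
  rw [extMul_include_inr] at key
  have key2 := congrArg (TensorProduct.map (SqZero.snd R A) (SqZero.snd R B)) key
  simpa only [← LinearMap.comp_apply, ← TensorProduct.map_comp, SqZero.snd_comp_inr,
    TensorProduct.map_id, LinearMap.id_apply] using key2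

lemma eq_of_extMul_extMul_eq {A B D : Type u} [AddCommGroup A] [Module R A] [AddCommGroup B]
    [Module R B] [AddCommGroup D] [Module R D] {t t' : A ⊗[R] (B ⊗[R] D)}
    (h : ∀ (S : Type u) [CommRing S] [Algebra R S] (f : A →ₗ[R] S) (g : B →ₗ[R] S)
      (k : D →ₗ[R] S), extMul f (extMul g k) t = extMul f (extMul g k) t') : t = t' := by
  let E := SqZero R B ⊗[R] SqZero R D
  let i₂ : E →ₐ[R] SqZero R A ⊗[R] E := Algebra.TensorProduct.includeRight
  have key := h (SqZero R A ⊗[R] E)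
    ((Algebra.TensorProduct.includeLeft : SqZero R A →ₐ[R] _).toLinearMap ∘ₗ SqZero.inr R A)
    (i₂.toLinearMap ∘ₗ (Algebra.TensorProduct.includeLeft : SqZero R B →ₐ[R] _).toLinearMap ∘ₗ
      SqZero.inr R B)
    (i₂.toLinearMap ∘ₗ (Algebra.TensorProduct.includeRight : SqZero R D →ₐ[R] _).toLinearMap ∘ₗ
      SqZero.inr R D)
  have h1 : ∀ (g : B →ₗ[R] E) (k : D →ₗ[R] E), extMul (i₂.toLinearMap ∘ₗ g) (i₂.toLinearMap ∘ₗ k) =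
      i₂.toLinearMap ∘ₗ extMul g k := fun g k => by
    ext b d
    exact (map_mul i₂ _ _).symm
  rw [h1, extMul_include_inr, extMul_include_inr] at key
  have key2 := congrArg (TensorProduct.map (SqZero.snd R A) (TensorProduct.map (SqZero.snd R B)
    (SqZero.snd R D))) key
  simpa only [← LinearMap.comp_apply, ← TensorProduct.map_comp, SqZero.snd_comp_inr,
    TensorProduct.map_id, LinearMap.id_apply] using key2

/-! ### The coalgebra axioms from the axioms of an algebra scheme. -/

section Coalgebra

variable {A : Type u} [AddCommGroup A] [Module R A] (D : AlgebraScheme R A)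

lemma AlgebraScheme.extMul_comul (S : Type u) [CommRing S] [Algebra R S] (f g : A →ₗ[R] S) (a : A) :
    extMul f g (D.comul a) = D.mul S f g a := by
  rw [D.mul_eq]
  rfl

lemma AlgebraScheme.one_eq (S : Type u) [CommRing S] [Algebra R S] :
    D.one S = Algebra.linearMap R S ∘ₗ D.one R :=
  (D.map_one R S (Algebra.ofId R S)).symm

/-- The unit law for the universal form `SqZero.inr`, which is injective, is the counit law. -/
lemma AlgebraScheme.one_comul : (D.one R).rTensor A ∘ₗ D.comul = TensorProduct.mk R R A 1 := by
  ext a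
  have h := congrArg (fun q => q a) (D.one_mul (SqZero R A) (SqZero.inr R A))
  simp only [D.mul_eq] at h
  have h1 : extMul (D.one (SqZero R A)) (SqZero.inr R A) =
      SqZero.inr R A ∘ₗ (TensorProduct.lid R A).toLinearMap ∘ₗ (D.one R).rTensor A := by
    rw [D.one_eq]
    ext a b
    exact (Algebra.smul_def (D.one R a) (SqZero.inr R A b)).symm.trans (map_smul _ _ _).symm
  rw [h1] at h
  have h2 := SqZero.inr_injective R A h
  exact (TensorProduct.lid R A).injective (h2.trans (TensorProduct.lid_tmul a (1 : R) ▸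
    (one_smul R a).symm))

lemma AlgebraScheme.comm_comul :
    (TensorProduct.comm R A A).toLinearMap ∘ₗ D.comul = D.comul := by
  ext a
  refine eq_of_extMul_eq fun S _ _ f g => ?_
  have h1 : extMul f g ∘ₗ (TensorProduct.comm R A A).toLinearMap = extMul g f := by
    ext a b
    exact mul_comm _ _
  rw [D.extMul_comul, D.mul_comm, ← D.extMul_comul, ← h1]
  rfl

lemma AlgebraScheme.comul_one : (D.one R).lTensor A ∘ₗ D.comul =
    (TensorProduct.mk R A R).flip 1 := by
  rw [← D.comm_comul]
  have h : (D.one R).lTensor A ∘ₗ (TensorProduct.comm R A A).toLinearMap =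
      (TensorProduct.comm R R A).toLinearMap ∘ₗ (D.one R).rTensor A := by
    ext a b
    rfl
  rw [← LinearMap.comp_assoc, h, LinearMap.comp_assoc, D.one_comul]
  rfl

lemma AlgebraScheme.comul_coassoc : (TensorProduct.assoc R A A A).toLinearMap ∘ₗ
    D.comul.rTensor A ∘ₗ D.comul = D.comul.lTensor A ∘ₗ D.comul := by
  ext a
  refine eq_of_extMul_extMul_eq fun S _ _ f g k => ?_
  have h1 : extMul f (extMul g k) ∘ₗ (TensorProduct.assoc R A A A).toLinearMap ∘ₗ
      D.comul.rTensor A = extMul (D.mul S f g) k := by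
    have h3 : extMul f (extMul g k) ∘ₗ (TensorProduct.assoc R A A A).toLinearMap =
        extMul (extMul f g) k := by
      ext a b c
      exact (mul_assoc _ _ _).symm
    rw [← LinearMap.comp_assoc, h3, D.mul_eq]
    ext a b
    rfl
  have h2 : extMul f (extMul g k) ∘ₗ D.comul.lTensor A = extMul f (D.mul S g k) := by
    rw [D.mul_eq]
    ext a b
    rfl
  have h4 := congrArg (fun q => q (D.comul a)) h1
  have h5 := congrArg (fun q => q (D.comul a)) h2
  refine h4.trans (Eq.trans ?_ h5.symm)
  rw [D.extMul_comul, D.extMul_comul, D.mul_assoc]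

/-- The coalgebra of an algebra scheme. -/
@[reducible] def AlgebraScheme.coalgebra : Coalgebra R A where
  comul := D.comul
  counit := D.one R
  coassoc := D.comul_coassoc
  rTensor_counit_comp_comul := D.one_comul
  lTensor_counit_comp_comul := D.comul_one

lemma AlgebraScheme.eq_of_mul_eq {D D' : AlgebraScheme R A}
    (h : ∀ (S : Type u) [CommRing S] [Algebra R S] (f g : A →ₗ[R] S), D.mul S f g = D'.mul S f g)
    (h' : ∀ (S : Type u) [CommRing S] [Algebra R S], D.one S = D'.one S) : D = D' := by
  obtain ⟨m, o, _, _, _, _, _⟩ := D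
  obtain ⟨m', o', _, _, _, _, _⟩ := D'
  obtain rfl : @m = @m' := by
    funext S _ _
    exact LinearMap.ext fun f => LinearMap.ext fun g => h S f g
  obtain rfl : @o = @o' := by
    funext S _ _
    exact h' S
  rfl

end Coalgebra

lemma extMul_tensorTensorTensorComm {A B : Type u} [AddCommGroup A] [Module R A] [AddCommGroup B]
    [Module R B] {S : Type u} [CommRing S] [Algebra R S] (f f' : A →ₗ[R] S) (g g' : B →ₗ[R] S)
    (s : A ⊗[R] A) (t : B ⊗[R] B) : extMul (extMul f g) (extMul f' g')
      (TensorProduct.tensorTensorTensorComm R A A B B (s ⊗ₜ t)) =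
        extMul f f' s * extMul g g' t := by
  induction s with
  | zero => simp
  | add s s' hs hs' => rw [TensorProduct.add_tmul, map_add, map_add, hs, hs', map_add, add_mul]
  | tmul a a' =>
    induction t with
    | zero => simp
    | add t t' ht ht' =>
      rw [TensorProduct.tmul_add, map_add, map_add, ht, ht', map_add, mul_add]
    | tmul b b' =>
      simp only [TensorProduct.tensorTensorTensorComm_tmul, extMul_tmul]
      ring

lemma extMul_mul {A : Type u} [Ring A] [Algebra R A] {S : Type u} [CommRing S] [Algebra R S]
    (f g : A →ₗ[R] S) (s t : A ⊗[R] A) : extMul f g (s * t) =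
      extMul (f ∘ₗ LinearMap.mul' R A) (g ∘ₗ LinearMap.mul' R A)
        (TensorProduct.tensorTensorTensorComm R A A A A (s ⊗ₜ t)) := by
  induction s with
  | zero => simp
  | add s s' hs hs' => rw [add_mul, map_add, hs, hs', TensorProduct.add_tmul, map_add, map_add]
  | tmul a a' =>
    induction t with
    | zero => simp
    | add t t' ht ht' => rw [mul_add, map_add, ht, ht', TensorProduct.tmul_add, map_add, map_add]
    | tmul b b' => simp [extMul]

lemma IsTensorScheme.comul_tmul {A B : Type u} [AddCommGroup A] [Module R A] [AddCommGroup B]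
    [Module R B] {D₁ : AlgebraScheme R A} {D₂ : AlgebraScheme R B} {D : AlgebraScheme R (A ⊗[R] B)}
    (h : IsTensorScheme D₁ D₂ D) (a : A) (b : B) : D.comul (a ⊗ₜ b) =
      TensorProduct.tensorTensorTensorComm R A A B B (D₁.comul a ⊗ₜ D₂.comul b) := by
  refine tensor_ext _ _ fun S _ _ f f' g g' => ?_
  rw [D.extMul_comul, h.mul_extMul, extMul_tensorTensorTensorComm, D₁.extMul_comul,
    D₂.extMul_comul]
  rfl

/-- The bialgebra of a formal monoid. -/
@[reducible] def FormalMonoid.bialgebra (G : FormalMonoid R) : Bialgebra R G.carrier :=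
  letI := G.scheme.coalgebra
  Bialgebra.mk' R G.carrier (G.counit R).2
    (fun {a b} => by
      obtain ⟨D, hD, hm⟩ := G.coproduct
      have h := congrArg (fun q => q (a ⊗ₜ[R] b)) (hm R).2
      rw [hD.one_eq] at h
      exact h)
    (by
      refine eq_of_extMul_eq fun S _ _ f g => ?_
      refine (G.scheme.extMul_comul S f g 1).trans ?_
      rw [(G.counit S).1]
      rfl)
    (fun {a b} => by
      obtain ⟨D, hD, hm⟩ := G.coproduct
      refine eq_of_extMul_eq fun S _ _ f g => ?_
      have h := congrArg (fun q => q (a ⊗ₜ[R] b)) ((hm S).1 f g)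
      refine (G.scheme.extMul_comul S f g _).trans (h.trans ?_)
      rw [← D.extMul_comul, hD.comul_tmul, ← extMul_mul]
      rfl)

lemma FormalMonoid.mk_eq_mk {A : Type u} [Ring A] [Algebra R A] {D D' : AlgebraScheme R A}
    (h : D = D') (h₁ h₁' h₂ h₂') : FormalMonoid.mk A D h₁ h₂ = FormalMonoid.mk A D' h₁' h₂' := by
  subst h
  rfl

/-- The coproduct and the counit determine the algebra scheme. The result is an equality rather than
an isomorphism, so statements about `G` reduce to bialgebras by substitution. -/
lemma FormalMonoid.exists_eq_ofBialgebra (G : FormalMonoid R) :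
    ∃ (A : Type u) (_ : Ring A) (_ : Bialgebra R A) (_ : Coalgebra.IsCocomm R A),
      G = FormalMonoid.ofBialgebra (R := R) A := by
  let b := G.bialgebra
  have hc : Coalgebra.IsCocomm R G.carrier := ⟨G.scheme.comm_comul⟩
  refine ⟨G.carrier, G.ring, b, hc, ?_⟩
  have h : G.scheme = AlgebraScheme.ofCoalgebra (R := R) G.carrier :=
    AlgebraScheme.eq_of_mul_eq
      (fun S _ _ f g => G.scheme.mul_eq S f g) fun S _ _ => G.scheme.one_eq S
  exact FormalMonoid.mk_eq_mk h G.coproduct (FormalMonoid.ofBialgebra (R := R) G.carrier).coproduct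
    G.counit (FormalMonoid.ofBialgebra (R := R) G.carrier).counit

lemma isTangent_ofBialgebra_iff {A : Type u} [Ring A] [Bialgebra R A] [Coalgebra.IsCocomm R A]
    {a : A} : IsTangent (FormalMonoid.ofBialgebra (R := R) A) a ↔ IsPrimitive R a := by
  have h1 : ∀ (S : Type u) [CommRing S] [Algebra R S] (f g : A →ₗ[R] S),
      extMul f g (a ⊗ₜ 1 + 1 ⊗ₜ a) = f 1 * g a + f a * g 1 := fun S _ _ f g => by
    rw [map_add, extMul_tmul, extMul_tmul, add_comm]
  constructor
  · intro h
    refine eq_of_extMul_eq fun S _ _ f g => ?_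
    rw [h1]
    exact h S f g
  · intro h S _ _ (f : A →ₗ[R] S) (g : A →ₗ[R] S)
    refine Eq.trans ?_ (h1 S f g)
    show extMul f g (Coalgebra.comul a) = _
    rw [h]

end Bialgebra

/-! ### Points of formal monoids as elements of tensor products -/

section Points

variable {R : Type u} [CommRing R]

/-! ### Yoneda lemma for morphisms from a module scheme to a quasi-coherent module. -/

section Representing

variable {P N : Type u} [AddCommGroup P] [Module R P] [AddCommGroup N] [Module R N]

/-- The element of `P ⊗ N` which represents a morphism from `𝒫*` to `𝒩`. -/
def SchemeModHom.elem (w : SchemeModHom R P N) : P ⊗[R] N :=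
  (SqZero.snd R P).rTensor N (w.app (SqZero R P) (SqZero.inr R P))

/-- A form `f` need not have square-zero image, so it is not directly a specialization of the
universal form `SqZero.inr`. Its multiple by `e₁ e₂` is one, and `T`-linearity of the components
lets the coefficient of `e₁ e₂` be read off. -/
lemma SchemeModHom.app_eq (w : SchemeModHom R P N) (T : Type u) [CommRing T] [Algebra R T]
    (f : P →ₗ[R] T) : w.app T f = f.rTensor N w.elem := by
  obtain ⟨T', _, _, c, e₁, e₂, coef, h₁, h₂, c₁₂, c₁, c₂, c₀⟩ := exists_biDual (R := R) T
  have k : ∀ x y,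
      ((e₁ * e₂) • (c.toLinearMap ∘ₗ f)) x * ((e₁ * e₂) • (c.toLinearMap ∘ₗ f)) y = 0 := by
    intro x y
    simp only [LinearMap.smul_apply, smul_eq_mul]
    rw [mul_mul_mul_comm, mul_mul_mul_comm e₁, h₁, zero_mul, zero_mul]
  let φ : SqZero R P →ₐ[R] T' := SqZero.lift _ k
  have hφ : φ.toLinearMap ∘ₗ SqZero.inr R P = (e₁ * e₂) • (c.toLinearMap ∘ₗ f) := by
    ext x
    exact SqZero.lift_inr _ k x
  have hφ' : coef ∘ₗ φ.toLinearMap = f ∘ₗ SqZero.snd R P := by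
    ext x
    show coef (SqZero.lift _ k x) = _
    rw [SqZero.lift_apply, map_add, ← c.commutes, c₀, zero_add]
    exact c₁₂ _
  have h3 := w.natural _ T' φ (SqZero.inr R P)
  rw [hφ, map_smul, w.natural] at h3
  have h4 : ∀ z : T ⊗[R] N, coef.rTensor N
      ((e₁ * e₂) • TensorProduct.map c.toLinearMap LinearMap.id z) = z := by
    intro z
    induction z with
    | zero => simp
    | add a b ha hb => rw [map_add, smul_add, map_add, ha, hb]
    | tmul t n =>
      rw [TensorProduct.map_tmul, TensorProduct.smul_tmul', LinearMap.rTensor_tmul]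
      exact congrArg (· ⊗ₜ n) (c₁₂ t)
  have h5 := congrArg (coef.rTensor N) h3
  rw [h4] at h5
  have h6 : coef.rTensor N ∘ₗ φ.toLinearMap.rTensor N =
      f.rTensor N ∘ₗ (SqZero.snd R P).rTensor N := by
    rw [← LinearMap.rTensor_comp, ← LinearMap.rTensor_comp, hφ']
  exact h5.trans (congrArg (fun q => q (w.app (SqZero R P) (SqZero.inr R P))) h6)

/-- The morphism from `𝒫*` to `𝒩` represented by an element of `P ⊗ N`. -/
def SchemeModHom.ofElem (z : P ⊗[R] N) : SchemeModHom R P N where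
  app T _ _ :=
    { toFun := fun f => f.rTensor N z
      map_add' := fun f g => by rw [LinearMap.rTensor_add, LinearMap.add_apply]
      map_smul' := fun t f => by
        rw [RingHom.id_apply]
        induction z with
        | zero => simp
        | add a b ha hb => rw [map_add, map_add, smul_add, ha, hb]
        | tmul p n =>
          rw [LinearMap.rTensor_tmul, LinearMap.rTensor_tmul, LinearMap.smul_apply,
            TensorProduct.smul_tmul'] }
  natural T T' _ _ _ _ φ f := by
    show (φ.toLinearMap ∘ₗ f).rTensor N z = φ.toLinearMap.rTensor N (f.rTensor N z)
    rw [LinearMap.rTensor_comp]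
    rfl

end Representing

/-- The product `(a ⊗ s) (b ⊗ t) = (a ⊗ b) ⊗ s t`. -/
def externalMul {A B S : Type u} [AddCommGroup A] [Module R A] [AddCommGroup B] [Module R B]
    [CommRing S] [Algebra R S] (x : A ⊗[R] S) (y : B ⊗[R] S) : (A ⊗[R] B) ⊗[R] S :=
  (LinearMap.mul' R S).lTensor (A ⊗[R] B) (TensorProduct.tensorTensorTensorComm R A S B S (x ⊗ₜ y))

lemma rTensor_map_externalMul {A B A' B' S : Type u} [AddCommGroup A] [Module R A] [AddCommGroup B]
    [Module R B] [AddCommGroup A'] [Module R A'] [AddCommGroup B'] [Module R B'] [CommRing S]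
    [Algebra R S] (f : A →ₗ[R] A') (g : B →ₗ[R] B') (x : A ⊗[R] S) (y : B ⊗[R] S) :
    (TensorProduct.map f g).rTensor S (externalMul x y) =
      externalMul (f.rTensor S x) (g.rTensor S y) := by
  unfold externalMul
  induction x with
  | zero => simp
  | add a b ha hb => simp only [TensorProduct.add_tmul, map_add, ha, hb]
  | tmul a s =>
    induction y with
    | zero => simp
    | add a b ha hb => simp only [TensorProduct.tmul_add, map_add, ha, hb]
    | tmul b t => simp

lemma rTensor_mul'_externalMul {T S : Type u} [CommRing T] [Algebra R T] [CommRing S] [Algebra R S]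
    (x y : T ⊗[R] S) : (LinearMap.mul' R T).rTensor S (externalMul x y) = x * y := by
  unfold externalMul
  induction x with
  | zero => simp
  | add a b ha hb => simp only [TensorProduct.add_tmul, map_add, ha, hb, add_mul]
  | tmul a s =>
    induction y with
    | zero => simp
    | add a b ha hb => simp only [TensorProduct.tmul_add, map_add, ha, hb, mul_add]
    | tmul b t => simp

lemma rTensor_extMul_externalMul {A B T S : Type u} [AddCommGroup A] [Module R A] [AddCommGroup B]
    [Module R B] [CommRing T] [Algebra R T] [CommRing S] [Algebra R S] (f : A →ₗ[R] T)
    (g : B →ₗ[R] T) (x : A ⊗[R] S) (y : B ⊗[R] S) : (extMul f g).rTensor S (externalMul x y) =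
      f.rTensor S x * g.rTensor S y := by
  rw [extMul, LinearMap.rTensor_comp, LinearMap.comp_apply, rTensor_map_externalMul,
    rTensor_mul'_externalMul]

variable {A : Type u} [Ring A] [Bialgebra R A] [Coalgebra.IsCocomm R A] {S : Type u} [CommRing S]
  [Algebra R S]

/-- The element of `A ⊗ S` which represents a point of `Spec 𝒜*`. -/
def pointElem (x : SpecPoint (FormalMonoid.ofBialgebra (R := R) A) S) : A ⊗[R] S :=
  x.toSchemeModHom.elem

/-- The component at `T` of a point of `Spec 𝒜*`. -/
def pointApp (x : SpecPoint (FormalMonoid.ofBialgebra (R := R) A) S) (T : Type u) [CommRing T]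
    [Algebra R T] : (A →ₗ[R] T) →ₗ[T] T ⊗[R] S :=
  x.app T

lemma pointApp_eq (x : SpecPoint (FormalMonoid.ofBialgebra (R := R) A) S) (T : Type u)
    [CommRing T] [Algebra R T] (f : A →ₗ[R] T) : pointApp x T f = f.rTensor S (pointElem x) :=
  x.toSchemeModHom.app_eq T f

/-- Points are group-like: multiplicativity of `x`, tested on the universal pair of forms on `A`, is
the coproduct identity. -/
lemma comul_pointElem (x : SpecPoint (FormalMonoid.ofBialgebra (R := R) A) S) :
    (Coalgebra.comul (R := R) (A := A)).rTensor S (pointElem x) =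
      externalMul (pointElem x) (pointElem x) := by
  let T := SqZero R A ⊗[R] SqZero R A
  let f : A →ₗ[R] T := (Algebra.TensorProduct.includeLeft : SqZero R A →ₐ[R] _).toLinearMap ∘ₗ
    SqZero.inr R A
  let g : A →ₗ[R] T := (Algebra.TensorProduct.includeRight : SqZero R A →ₐ[R] _).toLinearMap ∘ₗ
    SqZero.inr R A
  have h1 : pointApp x T (extMul f g ∘ₗ Coalgebra.comul (R := R) (A := A)) =
      pointApp x T f * pointApp x T g :=
    x.map_mul T f g
  rw [pointApp_eq, pointApp_eq, pointApp_eq, ← rTensor_extMul_externalMul,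
    LinearMap.rTensor_comp, LinearMap.comp_apply, extMul_include_inr] at h1
  have h2 := congrArg ((TensorProduct.map (SqZero.snd R A) (SqZero.snd R A)).rTensor S) h1
  have h3 : ∀ z, (TensorProduct.map (SqZero.snd R A) (SqZero.snd R A)).rTensor S
      ((TensorProduct.map (SqZero.inr R A) (SqZero.inr R A)).rTensor S z) = z := fun z => by
    rw [← LinearMap.comp_apply, ← LinearMap.rTensor_comp, ← TensorProduct.map_comp,
      SqZero.snd_comp_inr, TensorProduct.map_id, LinearMap.rTensor_id]
    rfl
  rwa [h3, h3] at h2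

lemma counit_pointElem (x : SpecPoint (FormalMonoid.ofBialgebra (R := R) A) S) :
    (Coalgebra.counit (R := R) (A := A)).rTensor S (pointElem x) = 1 := by
  have h : pointApp x R (Algebra.linearMap R R ∘ₗ Coalgebra.counit (R := R) (A := A)) = 1 :=
    x.map_one R
  rw [pointApp_eq] at h
  exact h

/-- If `s₁` and `s₂` are inverse to each other for the convolution, then so are the points `x ∘ s₁`
and `x ∘ s₂`. -/
lemma isSpecMul_of_convMul_eq_one (x y₁ y₂ : SpecPoint (FormalMonoid.ofBialgebra (R := R) A) S)
    (s₁ s₂ : A →ₗ[R] A)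
    (h₁ : ∀ (T : Type u) [CommRing T] [Algebra R T] (f : A →ₗ[R] T),
      pointApp y₁ T f = pointApp x T (f ∘ₗ s₁))
    (h₂ : ∀ (T : Type u) [CommRing T] [Algebra R T] (f : A →ₗ[R] T),
      pointApp y₂ T f = pointApp x T (f ∘ₗ s₂))
    (h : toConv s₁ * toConv s₂ = 1) : IsSpecMul y₁ y₂ (specOne _ S) := by
  refine ⟨SchemeModHom.ofElem (externalMul (s₁.rTensor S (pointElem x))
    (s₂.rTensor S (pointElem x))), fun T _ _ =>
      ⟨fun (f : A →ₗ[R] T) (g : A →ₗ[R] T) => ?_, fun (f : A →ₗ[R] T) => ?_⟩⟩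
  · refine (rTensor_extMul_externalMul _ _ _ _).trans ?_
    show _ = pointApp y₁ T f * pointApp y₂ T g
    rw [h₁, h₂, pointApp_eq, pointApp_eq, LinearMap.rTensor_comp, LinearMap.rTensor_comp]
    rfl
  · show f 1 ⊗ₜ[R] (1 : S) = (f ∘ₗ LinearMap.mul' R A).rTensor S (externalMul
      (s₁.rTensor S (pointElem x)) (s₂.rTensor S (pointElem x)))
    -- As `pointElem x` is group-like, multiplying its images under `s₁` and `s₂` amounts to
    -- applying the convolution of `s₁` and `s₂`, here the unit.
    have h3 : LinearMap.mul' R A ∘ₗ TensorProduct.map s₁ s₂ ∘ₗ Coalgebra.comul =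
        Algebra.linearMap R A ∘ₗ Coalgebra.counit (R := R) (A := A) := congrArg ofConv h
    rw [← rTensor_map_externalMul, ← comul_pointElem, ← LinearMap.comp_apply, ← LinearMap.comp_apply,
      ← LinearMap.rTensor_comp, ← LinearMap.rTensor_comp, LinearMap.comp_assoc, LinearMap.comp_assoc,
      h3, LinearMap.rTensor_comp, LinearMap.rTensor_comp, LinearMap.comp_apply,
      LinearMap.comp_apply, counit_pointElem, Algebra.TensorProduct.one_def, LinearMap.rTensor_tmul,
      LinearMap.rTensor_tmul]
    show _ = f (algebraMap R A 1) ⊗ₜ[R] (1 : S)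
    rw [(algebraMap R A).map_one]

/-- The composition of a point with a linear map which is compatible with the coproduct. -/
def compPoint (x : SpecPoint (FormalMonoid.ofBialgebra (R := R) A) S) (s : A →ₗ[R] A)
    (h : TensorProduct.map s s ∘ₗ Coalgebra.comul = Coalgebra.comul (R := R) ∘ₗ s)
    (h' : Coalgebra.counit (R := R) ∘ₗ s = Coalgebra.counit) :
    SpecPoint (FormalMonoid.ofBialgebra (R := R) A) S where
  app T _ _ := pointApp x T ∘ₗ
    { toFun := fun f : A →ₗ[R] T => f ∘ₗ s
      map_add' := fun f g => rfl
      map_smul' := fun t f => rfl }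
  natural T T' _ _ _ _ φ (f : A →ₗ[R] T) := x.natural T T' φ (f ∘ₗ s)
  map_mul T _ _ (f : A →ₗ[R] T) (g : A →ₗ[R] T) := by
    refine Eq.trans ?_ (x.map_mul T (f ∘ₗ s) (g ∘ₗ s))
    show pointApp x T ((extMul f g ∘ₗ Coalgebra.comul) ∘ₗ s) =
      pointApp x T (extMul (f ∘ₗ s) (g ∘ₗ s) ∘ₗ Coalgebra.comul)
    rw [LinearMap.comp_assoc, ← h, extMul, extMul, TensorProduct.map_comp]
    rfl
  map_one T _ _ := by
    refine Eq.trans ?_ (x.map_one T)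
    show pointApp x T ((Algebra.linearMap R T ∘ₗ Coalgebra.counit) ∘ₗ s) =
      pointApp x T (Algebra.linearMap R T ∘ₗ Coalgebra.counit)
    rw [LinearMap.comp_assoc, h']

end Points

/-! ### Flat enveloping algebras -/

section Enveloping

variable {R : Type u} [CommRing R] [Algebra ℚ R]

/-! ### Consequences of polynomial type for flatness, base change and completeness. -/

section General

variable {A : Type u} [Ring A] [Bialgebra R A] (hA : IsPolynomialType R A)

lemma sum_lTensor_eulerian {N : Type u} [AddCommGroup N] [Module R N] (x : N ⊗[R] A) :
    ∃ n, ∀ m, n ≤ m → ∑ k ∈ Finset.range m, (eulerian hA k).ofConv.lTensor N x = x := by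
  induction x with
  | zero => exact ⟨0, fun m _ => by simp⟩
  | add x y hx hy =>
    obtain ⟨n, hn⟩ := hx
    obtain ⟨n', hn'⟩ := hy
    refine ⟨max n n', fun m hm => ?_⟩
    simp only [map_add, Finset.sum_add_distrib]
    rw [hn m (le_trans (le_max_left _ _) hm), hn' m (le_trans (le_max_right _ _) hm)]
  | tmul s a =>
    refine ⟨((adams hA).ofConv a).natDegree + 1, fun m hm => ?_⟩
    simp only [LinearMap.lTensor_tmul]
    rw [← TensorProduct.tmul_sum, sum_eulerian hA a m hm]

/-- `A` is flat if its linear part is. -/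
lemma flat_of_flat_eulerian_one {L : Type u} [AddCommGroup L] [Module R L] [Module.Flat R L]
    (p : A →ₗ[R] L) (j : L →ₗ[R] A) (h : j ∘ₗ p = (eulerian hA 1).ofConv) : Module.Flat R A := by
  -- By `(k + 1) e_(k+1) = e_1 * e_k`, the map `e_(k+1)` factors through `L ⊗ M` whenever `e_k`
  -- factors through `M`; so the flat module is in effect a tensor power of `L`.
  have h1 : ∀ k, ∃ (M : Type u) (_ : AddCommGroup M) (_ : Module R M) (_ : Module.Flat R M)
      (α : A →ₗ[R] M) (β : M →ₗ[R] A), β ∘ₗ α = (eulerian hA k).ofConv := by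
    intro k
    induction k with
    | zero =>
      rw [eulerian_zero]
      exact ⟨R, inferInstance, inferInstance, inferInstance, Coalgebra.counit,
        Algebra.linearMap R A, rfl⟩
    | succ k ih =>
      obtain ⟨M, _, _, _, α, β, hk⟩ := ih
      refine ⟨L ⊗[R] M, inferInstance, inferInstance, inferInstance,
        algebraMap ℚ R ((k + 1 : ℕ) : ℚ)⁻¹ • TensorProduct.map p α ∘ₗ Coalgebra.comul,
        LinearMap.mul' R A ∘ₗ TensorProduct.map j β, ?_⟩
      have h2 : (LinearMap.mul' R A ∘ₗ TensorProduct.map j β) ∘ₗ TensorProduct.map p α ∘ₗ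
          Coalgebra.comul = ((k + 1 : ℕ) : R) • (eulerian hA (k + 1)).ofConv := by
        rw [← ofConv_smul, eulerian_succ]
        show _ = LinearMap.mul' R A ∘ₗ TensorProduct.map _ _ ∘ₗ Coalgebra.comul
        rw [← h, ← hk, TensorProduct.map_comp]
        rfl
      rw [LinearMap.comp_smul, h2, smul_smul, ← map_natCast (algebraMap ℚ R) (k + 1), ← map_mul,
        inv_mul_cancel₀ (Nat.cast_ne_zero.2 k.succ_ne_zero), map_one, one_smul]
  rw [Module.Flat.iff_rTensor_preserves_injective_linearMap]
  intro N N' _ _ _ _ f hf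
  refine (injective_iff_map_eq_zero _).2 fun x hx => ?_
  obtain ⟨n, hn⟩ := sum_lTensor_eulerian hA x
  rw [← hn n le_rfl]
  refine Finset.sum_eq_zero fun k _ => ?_
  obtain ⟨M, _, _, _, α, β, hk⟩ := h1 k
  -- The factorization is natural in `N`, so injectivity after tensoring with the flat module `M`
  -- makes every `e_k` component of `x` vanish.
  have h3 : α.lTensor N x = 0 := by
    refine (injective_iff_map_eq_zero (f.rTensor M)).1
      (Module.Flat.rTensor_preserves_injective_linearMap f hf) _ ?_
    have h4 : f.rTensor M ∘ₗ α.lTensor N = α.lTensor N' ∘ₗ f.rTensor A := by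
      ext a b
      rfl
    have h5 := congrArg (fun q => q x) h4
    refine h5.trans ?_
    rw [LinearMap.comp_apply, hx, map_zero]
  rw [← hk, LinearMap.lTensor_comp, LinearMap.comp_apply, h3, map_zero]

/-- The linear part, as a projection onto a module which parametrizes its image. -/
lemma exists_projection {L : Type u} [AddCommGroup L] [Module R L] (j : L →ₗ[R] A)
    (hj : Function.Injective j) (h : ∀ a, ∃ x, (eulerian hA 1).ofConv a = j x) :
    ∃ p : A →ₗ[R] L, j ∘ₗ p = (eulerian hA 1).ofConv := by
  let i : L ≃ₗ[R] LinearMap.range j := LinearEquiv.ofInjective j hj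
  refine ⟨i.symm.toLinearMap ∘ₗ LinearMap.codRestrict _ (eulerian hA 1).ofConv (fun a => ?_), ?_⟩
  · obtain ⟨x, hx⟩ := h a
    exact ⟨x, hx.symm⟩
  · ext a : 1
    exact congrArg Subtype.val (i.apply_symm_apply _)

lemma eulerian_one_one : (eulerian hA 1).ofConv 1 = 0 := by
  have h0 : IsPrimitive R (0 : A) := by
    show Coalgebra.comul (0 : A) = _
    simp
  have h := h0.eulerian_pow hA 0 1
  rwa [pow_zero, if_neg zero_ne_one] at h

variable [Coalgebra.IsCocomm R A]

/-- Decompose an annihilated `x` in `S ⊗ A` into its components under the `e_k`. For `k > n` they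
vanish, since `k! e_k` is the `k`-th convolution power of `e_1` and `e_1 1 = 0`; for `k ≤ n` they
come from `A_n`, on which `f` is zero. -/
lemma idealPow_eq_idealPowBase (h : ∀ k a, (eulerian hA k).ofConv a ∈ annFiltration R A k) (n : ℕ)
    {S T : Type u} [CommRing S] [Algebra R S] [CommRing T] [Algebra R T] (φ : S →ₐ[R] T) :
    idealPow (FormalMonoid.ofBialgebra (R := R) A) n T =
      idealPowBase (FormalMonoid.ofBialgebra (R := R) A) n φ := by
  have h1 : ∀ (f : A →ₗ[R] T) s a, baseForm φ f (s ⊗ₜ a) = φ s * f a := fun _ _ _ => rfl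
  refine Set.Subset.antisymm ?_ ?_
  · intro (f : A →ₗ[R] T) hf (x : S ⊗[R] A) hx
    have hf' : ∀ a ∈ annFiltration R A n, f a = 0 := hf
    show baseForm φ f x = 0
    obtain ⟨m, hm⟩ := sum_lTensor_eulerian hA x
    rw [← hm m le_rfl, map_sum]
    refine Finset.sum_eq_zero fun k _ => ?_
    rcases lt_or_ge n k with hk | hk
    · have h2 := lTensor_convPow_apply_eq_zero (eulerian hA 1).ofConv (eulerian_one_one hA) hk S hx
      rw [toConv_ofConv, ← factorial_smul_eulerian, ofConv_smul, LinearMap.lTensor_smul] at h2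
      have h3 := mem_of_natCast_smul_mem (⊥ : Submodule R (S ⊗[R] A)) k.factorial_ne_zero
        (x := (eulerian hA k).ofConv.lTensor S x) (by rw [Submodule.mem_bot]; exact h2)
      rw [(Submodule.mem_bot R).1 h3, map_zero]
    · have h4 : baseForm φ f ∘ₗ (eulerian hA k).ofConv.lTensor S = 0 := by
        ext s a
        show baseForm φ f (s ⊗ₜ (eulerian hA k).ofConv a) = 0
        rw [h1, hf' _ (annPow_mono _ hk (h k a)), mul_zero]
      exact congrArg (fun q => q x) h4
  · intro (f : A →ₗ[R] T) hf (a : A) ha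
    -- The reverse inclusion only needs that `1 ⊗ a` is annihilated after base change when `a` is
    -- annihilated over `R`.
    have h2 : baseForm φ f ((1 : S) ⊗ₜ[R] a) = 0 := hf _ fun T' _ _ φ' l hl hI => by
      refine Eq.trans ?_ ((congrArg (φ' 1 * ·) (ha T' l hl hI)).trans (mul_zero _))
      rfl
    rw [h1, map_one, one_mul] at h2
    exact h2

omit [Algebra ℚ R] in
lemma complete_of_exists_mem_annFiltration (h : ∀ a : A, ∃ n, a ∈ annFiltration R A n)
    (S : Type u) [CommRing S] [Algebra R S] (g : ∀ n, annFiltration R A n →ₗ[R] S)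
    (hg : ∀ n m, n ≤ m → ∀ (a : A) (ha : a ∈ annFiltration R A n) (ha' : a ∈ annFiltration R A m),
      g m ⟨a, ha'⟩ = g n ⟨a, ha⟩) :
    ∃! f : A →ₗ[R] S, ∀ n (a : annFiltration R A n), f a = g n a := by
  choose d hd using h
  have hmono : Monotone (annFiltration R A) := annPow_mono _
  have key : ∀ n a (ha : a ∈ annFiltration R A n), g (d a) ⟨a, hd a⟩ = g n ⟨a, ha⟩ := by
    intro n a ha
    rw [← hg n (max n (d a)) (le_max_left _ _) a ha (hmono (le_max_left _ _) ha),
      ← hg (d a) (max n (d a)) (le_max_right _ _) a (hd a) (hmono (le_max_right _ _) (hd a))]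
  refine ⟨{ toFun := fun a => g (d a) ⟨a, hd a⟩, map_add' := ?_, map_smul' := ?_ }, ?_, ?_⟩
  · intro a b
    have ha := hmono (le_max_left (d a) (d b)) (hd a)
    have hb := hmono (le_max_right (d a) (d b)) (hd b)
    rw [key _ (a + b) (Submodule.add_mem _ ha hb), key _ a ha, key _ b hb, ← map_add]
    rfl
  · intro r a
    rw [key _ (r • a) (Submodule.smul_mem _ r (hd a)), RingHom.id_apply, ← map_smul]
    rfl
  · intro n a
    exact key n a a.2
  · intro f hf
    ext a
    exact hf (d a) ⟨a, hd a⟩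

end General

/-! ### The enveloping algebra of a flat Lie algebra: flatness, filtration and antipode. -/

variable {L : Type u} [LieRing L] [LieAlgebra R L]

local notation "U" => UniversalEnvelopingAlgebra
local notation "ι" => UniversalEnvelopingAlgebra.ι

lemma uea_flat [Module.Flat R L] : Module.Flat R (U R L) := by
  obtain ⟨p, hp⟩ := exists_projection (uea_isPolynomialType R (L := L))
    (ι R : L →ₗ⁅R⁆ U R L).toLinearMap (ι_injective R) (uea_eulerian_one_mem R)
  exact flat_of_flat_eulerian_one _ p _ hp

omit [Algebra ℚ R] in
lemma ι_pow_mem_annFiltration (x : L) {j n : ℕ} (h : j ≤ n) :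
    ι R x ^ j ∈ annFiltration R (U R L) n :=
  (isPrimitive_ι R x).pow_mem_annFiltration h

lemma uea_eulerian_mem_annFiltration (k : ℕ) (a : U R L) :
    (eulerian (uea_isPolynomialType R (L := L)) k).ofConv a ∈ annFiltration R (U R L) k := by
  have ha : a ∈ Submodule.span R {a : U R L | ∃ (x : L) (n : ℕ), ι R x ^ n = a} := by
    rw [span_ι_pow R]
    exact Submodule.mem_top
  induction ha using Submodule.span_induction with
  | mem a ha =>
    obtain ⟨x, n, rfl⟩ := ha
    rw [uea_eulerian_pow]
    split_ifs with h
    · exact ι_pow_mem_annFiltration x h.le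
    · exact Submodule.zero_mem _
  | zero => rw [map_zero]; exact Submodule.zero_mem _
  | add a b _ _ ha hb => rw [map_add]; exact Submodule.add_mem _ ha hb
  | smul r a _ ha => rw [map_smul]; exact Submodule.smul_mem _ r ha

lemma uea_exists_mem_annFiltration (a : U R L) : ∃ n, a ∈ annFiltration R (U R L) n := by
  have ha : a ∈ Submodule.span R {a : U R L | ∃ (x : L) (n : ℕ), ι R x ^ n = a} := by
    rw [span_ι_pow R]
    exact Submodule.mem_top
  have hmono : Monotone (annFiltration R (U R L)) := annPow_mono _
  induction ha using Submodule.span_induction with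
  | mem a ha =>
    obtain ⟨x, n, rfl⟩ := ha
    exact ⟨n, ι_pow_mem_annFiltration x le_rfl⟩
  | zero => exact ⟨0, Submodule.zero_mem _⟩
  | add a b _ _ ha hb =>
    obtain ⟨n, hn⟩ := ha
    obtain ⟨m, hm⟩ := hb
    exact ⟨max n m, Submodule.add_mem _ (hmono (le_max_left _ _) hn) (hmono (le_max_right _ _) hm)⟩
  | smul r a _ ha =>
    obtain ⟨n, hn⟩ := ha
    exact ⟨n, Submodule.smul_mem _ r hn⟩

variable (R L) in
/-- The antipode of `U(L)`. -/
def uAntipode : U R L →ₗ[R] U R L :=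
  (postConv (polyEval (-1 : R)) (adams (uea_isPolynomialType R (L := L)))).ofConv

/-- The antipode is `Ψ^(-1)` and `Ψ^t` multiplies `x^n` by `t^n`. The identities below are checked
on such powers, which span. -/
lemma uAntipode_pow (x : L) (n : ℕ) : uAntipode R L (ι R x ^ n) = (-1 : R) ^ n • ι R x ^ n := by
  rw [uAntipode, postConv_apply, (isPrimitive_ι R x).adams_pow, polyEval_monomial]

lemma map_uAntipode_comul : TensorProduct.map (uAntipode R L) (uAntipode R L) ∘ₗ Coalgebra.comul =
    Coalgebra.comul (R := R) ∘ₗ uAntipode R L := by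
  refine uea_linearMap_ext R fun x n => ?_
  rw [LinearMap.comp_apply, LinearMap.comp_apply, uAntipode_pow, map_smul,
    (isPrimitive_ι R x).comul_pow, map_sum, Finset.smul_sum]
  refine Finset.sum_congr rfl fun i hi => ?_
  rw [map_nsmul, TensorProduct.map_tmul, uAntipode_pow, uAntipode_pow, TensorProduct.smul_tmul_smul,
    ← pow_add, Nat.add_sub_cancel' (Nat.lt_succ_iff.1 (Finset.mem_range.1 hi)), smul_comm]

lemma counit_uAntipode : Coalgebra.counit (R := R) ∘ₗ uAntipode R L = Coalgebra.counit := by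
  refine uea_linearMap_ext R fun x n => ?_
  rw [LinearMap.comp_apply, uAntipode_pow, map_smul, Bialgebra.counit_pow,
    (isPrimitive_ι R x).counit_eq_zero]
  cases n with
  | zero => simp
  | succ n => simp

/-- On `x^n` this is the binomial expansion of `(x + (-x))^n`. -/
lemma id_mul_uAntipode : (toConv LinearMap.id * toConv (uAntipode R L) : WithConv _) = 1 := by
  refine WithConv.ext (uea_linearMap_ext R fun x n => ?_)
  rw [(isPrimitive_ι R x).convMul_pow_apply]
  show _ = algebraMap R _ (Coalgebra.counit (ι R x ^ n))
  rw [Bialgebra.counit_pow, (isPrimitive_ι R x).counit_eq_zero, map_pow, map_zero,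
    ← add_neg_cancel (ι R x), (Commute.neg_right (Commute.refl (ι R x))).add_pow]
  refine Finset.sum_congr rfl fun i _ => ?_
  show _ • (ι R x ^ i * uAntipode R L _) = _
  rw [uAntipode_pow, neg_pow (ι R x), nsmul_eq_mul', Algebra.smul_def, map_pow, map_neg, map_one]

lemma uAntipode_mul_id : (toConv (uAntipode R L) * toConv LinearMap.id : WithConv _) = 1 := by
  refine WithConv.ext (uea_linearMap_ext R fun x n => ?_)
  rw [(isPrimitive_ι R x).convMul_pow_apply]
  show _ = algebraMap R _ (Coalgebra.counit (ι R x ^ n))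
  rw [Bialgebra.counit_pow, (isPrimitive_ι R x).counit_eq_zero, map_pow, map_zero,
    ← neg_add_cancel (ι R x), (Commute.neg_left (Commute.refl (ι R x))).add_pow]
  refine Finset.sum_congr rfl fun i _ => ?_
  show _ • (uAntipode R L _ * ι R x ^ (n - i)) = _
  rw [uAntipode_pow, neg_pow (ι R x) i, nsmul_eq_mul', Algebra.smul_def, map_pow, map_neg, map_one]

/-- `Spec 𝒰(L)*` is a flat infinitesimal formal group if `L` is flat. -/
lemma isFlatInfinitesimalGroup_uea [Module.Flat R L] :
    IsFlatInfinitesimalGroup (FormalMonoid.ofBialgebra (R := R) (U R L)) where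
  flat := uea_flat (L := L)
  complete _ _ _ g hg := complete_of_exists_mem_annFiltration uea_exists_mem_annFiltration _ g hg
  baseChange n _ _ _ _ _ _ φ :=
    idealPow_eq_idealPowBase (uea_isPolynomialType R (L := L)) uea_eulerian_mem_annFiltration n φ
  group _ _ _ x :=
    ⟨compPoint x (uAntipode R L) map_uAntipode_comul counit_uAntipode,
      isSpecMul_of_convMul_eq_one x x _ LinearMap.id (uAntipode R L) (fun _ _ _ _ => rfl)
        (fun _ _ _ _ => rfl) id_mul_uAntipode,
      isSpecMul_of_convMul_eq_one x _ x (uAntipode R L) LinearMap.id (fun _ _ _ _ => rfl)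
        (fun _ _ _ _ => rfl) uAntipode_mul_id⟩

end Enveloping

/-! ### Bialgebras of polynomial type are enveloping algebras -/

section Reconstruction

variable {R : Type u} [CommRing R] {A : Type u} [Ring A] [Bialgebra R A] {L : Type u} [LieRing L]
  [LieAlgebra R L] (j : L →ₗ⁅R⁆ A)

local notation "U" => UniversalEnvelopingAlgebra
local notation "ι" => UniversalEnvelopingAlgebra.ι

/-- The morphism of bialgebras `U(L) → A` which extends a morphism of Lie algebras from `L` to the
primitive elements of `A`. -/
def uLift (hp : ∀ x, IsPrimitive R (j x)) : U R L →ₐc[R] A :=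
  BialgHom.ofAlgHom (UniversalEnvelopingAlgebra.lift R j)
    (uHom_ext fun x => by
      rw [AlgHom.comp_apply, UniversalEnvelopingAlgebra.lift_ι_apply]
      exact (hp x).counit_eq_zero.trans (uCounit_ι R x).symm)
    (uHom_ext fun x => by
      have h1 : Bialgebra.comulAlgHom R (U R L) (ι R x) = ι R x ⊗ₜ 1 + 1 ⊗ₜ ι R x := uComul_ι R x
      have h2 : Bialgebra.comulAlgHom R A (j x) = j x ⊗ₜ 1 + 1 ⊗ₜ j x := hp x
      rw [AlgHom.comp_apply, AlgHom.comp_apply, UniversalEnvelopingAlgebra.lift_ι_apply, h1, h2]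
      simp only [map_add, Algebra.TensorProduct.map_tmul, UniversalEnvelopingAlgebra.lift_ι_apply,
        map_one])

variable [Algebra ℚ R] [Coalgebra.IsCocomm R A] (hA : IsPolynomialType R A)
  (hp : ∀ x, IsPrimitive R (j x)) (hs : ∀ a : A, IsPrimitive R a → ∃ x, j x = a)

include hA hs in
-- `e_1` has primitive values, which are in the range; its convolution powers are sums of products
-- of such values, and `a` is the sum of the `e_k a`.
lemma lift_surjective : Function.Surjective (UniversalEnvelopingAlgebra.lift R j) := by
  let S := (UniversalEnvelopingAlgebra.lift R j).range
  have h1 : ∀ a, (eulerian hA 1).ofConv a ∈ S := fun a => by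
    obtain ⟨x, hx⟩ := hs _ (comul_eulerian_one hA a)
    exact ⟨ι R x, (UniversalEnvelopingAlgebra.lift_ι_apply R j x).trans hx⟩
  have h2 : ∀ k a, (eulerian hA 1 ^ k).ofConv a ∈ S := by
    intro k
    induction k with
    | zero => exact fun a => S.algebraMap_mem _
    | succ k ih =>
      intro a
      rw [pow_succ, LinearMap.convMul_apply]
      induction (Coalgebra.comul (R := R) a) with
      | zero => rw [map_zero, map_zero]; exact S.zero_mem
      | add s t hs ht => rw [map_add, map_add]; exact S.add_mem hs ht
      | tmul s t => exact S.mul_mem (ih s) (h1 t)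
  intro a
  have h3 : a ∈ Subalgebra.toSubmodule S := by
    rw [← sum_eulerian hA a _ (Nat.lt_succ_self _)]
    exact Submodule.sum_mem _ fun k _ => eulerian_mem_of_pow_mem hA _ k a (h2 k a)
  exact h3

include hA hp hs in
-- With `p` a projection of `A` onto `L` inducing `e_1`, the map `e_1` of `U(L)` is `ι ∘ p ∘ f`,
-- where `f : U(L) → A`. Since `f` is a coalgebra morphism, all convolution powers of `e_1` factor
-- through `f` as well; so `f u = 0` kills every `e_k u`, whose sum is `u`.
lemma lift_injective (hj : Function.Injective j) :
    Function.Injective (UniversalEnvelopingAlgebra.lift R j) := by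
  obtain ⟨p, hp'⟩ := exists_projection hA j.toLinearMap hj fun a => by
    obtain ⟨x, hx⟩ := hs _ (comul_eulerian_one hA a)
    exact ⟨x, hx.symm⟩
  let hU := uea_isPolynomialType R (L := L)
  let f := uLift j hp
  let e : WithConv (A →ₗ[R] U R L) := toConv ((ι R : L →ₗ⁅R⁆ U R L).toLinearMap ∘ₗ p)
  have h1 : preConv (f : U R L →ₗc[R] A) e = eulerian hU 1 := by
    ext u
    obtain ⟨x, hx⟩ := uea_eulerian_one_mem R u
    have h2 : j (p (f u)) = j x := by
      have h3 : j (p (f u)) = (eulerian hA 1).ofConv (f u) := congrArg (fun q => q (f u)) hp'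
      rw [h3, ← map_eulerian hU hA, hx]
      exact UniversalEnvelopingAlgebra.lift_ι_apply R j x
    rw [hx]
    exact congrArg (ι R) (hj h2)
  refine (injective_iff_map_eq_zero _).2 fun u hu => ?_
  rw [← sum_eulerian hU u _ (Nat.lt_succ_self _)]
  refine Finset.sum_eq_zero fun k _ => ?_
  have h4 := eulerian_mem_of_pow_mem hU ⊥ k u (by
    rw [← h1, ← map_pow, preConv_apply]
    have h5 : f u = 0 := hu
    show (e ^ k).ofConv (f u) ∈ _
    rw [h5, map_zero]
    exact Submodule.zero_mem _)
  exact h4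

include hA hp hs in
-- `L` is a retract of `A`, because `e_1` fixes the primitive elements.
lemma flat_of_flat_bialgebra (hj : Function.Injective j) [Module.Flat R A] : Module.Flat R L := by
  obtain ⟨p, hp'⟩ := exists_projection hA j.toLinearMap hj fun a => by
    obtain ⟨x, hx⟩ := hs _ (comul_eulerian_one hA a)
    exact ⟨x, hx.symm⟩
  refine Module.Flat.of_retract j.toLinearMap p ?_
  ext x
  refine hj ((congrArg (fun q => q (j x)) hp').trans ?_)
  exact (hp x).eulerian_one hA

end Reconstruction

/-! ### The tangent space of a flat infinitesimal formal group -/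

section TangentSpace

variable {R : Type u} [CommRing R]

lemma envelopingToCarrier_ι (G : FormalMonoid R) (x : tangentSpace G) :
    envelopingToCarrier G (UniversalEnvelopingAlgebra.ι R x) = x :=
  UniversalEnvelopingAlgebra.lift_ι_apply R _ x

/-- `U(T_e 𝔾) → A` is dual to a morphism of functors of algebras. -/
lemma mul_comp_envelopingToCarrier (G : FormalMonoid R) (S : Type u) [CommRing S] [Algebra R S] :
    (∀ f g : G.carrier →ₗ[R] S, G.scheme.mul S f g ∘ₗ (envelopingToCarrier G).toLinearMap =
      (AlgebraScheme.ofCoalgebra (R := R) (UniversalEnvelopingAlgebra R (tangentSpace G))).mul S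
        (f ∘ₗ (envelopingToCarrier G).toLinearMap) (g ∘ₗ (envelopingToCarrier G).toLinearMap)) ∧
    G.scheme.one S ∘ₗ (envelopingToCarrier G).toLinearMap =
      (AlgebraScheme.ofCoalgebra (R := R)
        (UniversalEnvelopingAlgebra R (tangentSpace G))).one S := by
  obtain ⟨A, _, _, _, rfl⟩ := G.exists_eq_ofBialgebra
  let j : tangentSpace (FormalMonoid.ofBialgebra (R := R) A) →ₗ⁅R⁆ A :=
    (tangentSpace (FormalMonoid.ofBialgebra (R := R) A)).incl
  let h := uLift j fun x => isTangent_ofBialgebra_iff.1 x.2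
  constructor
  · intro (f : A →ₗ[R] S) (g : A →ₗ[R] S)
    ext u
    have h1 := CoalgHomClass.map_comp_comul_apply h u
    show extMul f g (Coalgebra.comul (h u)) =
      extMul (f ∘ₗ (h : _ →ₗ[R] A)) (g ∘ₗ (h : _ →ₗ[R] A)) (Coalgebra.comul u)
    rw [← h1, extMul, extMul, TensorProduct.map_comp]
    rfl
  · ext u
    exact congrArg (algebraMap R S) (CoalgHomClass.counit_comp_apply h u)

variable [Algebra ℚ R] (G : FormalMonoid R) (hG : IsFlatInfinitesimalGroup G)

include hG

lemma envelopingToCarrier_bijective : Function.Bijective (envelopingToCarrier G) := by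
  obtain ⟨A, _, _, _, rfl⟩ := G.exists_eq_ofBialgebra
  have hA : IsPolynomialType R A := isPolynomialType_of_exists_mem_annFiltration
    (exists_mem_annPow_of_complete _ hG.complete)
  let j : tangentSpace (FormalMonoid.ofBialgebra (R := R) A) →ₗ⁅R⁆ A :=
    (tangentSpace (FormalMonoid.ofBialgebra (R := R) A)).incl
  have hs : ∀ a : A, IsPrimitive R a → ∃ x, j x = a :=
    fun a ha => ⟨⟨a, isTangent_ofBialgebra_iff.2 ha⟩, rfl⟩
  exact ⟨lift_injective j hA (fun x => isTangent_ofBialgebra_iff.1 x.2) hs Subtype.val_injective,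
    lift_surjective j hA hs⟩

lemma flat_tangentSpace : Module.Flat R (tangentSpace G) := by
  obtain ⟨A, _, _, _, rfl⟩ := G.exists_eq_ofBialgebra
  have hA : IsPolynomialType R A := isPolynomialType_of_exists_mem_annFiltration
    (exists_mem_annPow_of_complete _ hG.complete)
  let j : tangentSpace (FormalMonoid.ofBialgebra (R := R) A) →ₗ⁅R⁆ A :=
    (tangentSpace (FormalMonoid.ofBialgebra (R := R) A)).incl
  have hs : ∀ a : A, IsPrimitive R a → ∃ x, j x = a :=
    fun a ha => ⟨⟨a, isTangent_ofBialgebra_iff.2 ha⟩, rfl⟩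
  have hf : Module.Flat R A := hG.flat
  exact flat_of_flat_bialgebra j hA (fun x => isTangent_ofBialgebra_iff.1 x.2) hs
    Subtype.val_injective

end TangentSpace

/-! ### The equivalence of categories -/

section Equivalence

variable {R : Type u} [CommRing R]

/-- The morphism of formal monoids dual to an algebra morphism. -/
def FormalMonoid.homMk {G G' : FormalMonoid R} (h : G.carrier →ₐ[R] G'.carrier)
    (hm : ∀ (S : Type u) [CommRing S] [Algebra R S] (f g : G'.carrier →ₗ[R] S),
      G'.scheme.mul S f g ∘ₗ h.toLinearMap =
        G.scheme.mul S (f ∘ₗ h.toLinearMap) (g ∘ₗ h.toLinearMap))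
    (h1 : ∀ (S : Type u) [CommRing S] [Algebra R S],
      G'.scheme.one S ∘ₗ h.toLinearMap = G.scheme.one S) : G ⟶ G' :=
  show FormalMonoid.Hom G G' from
  { app := fun _ _ _ =>
      { toFun := fun f => f ∘ₗ h.toLinearMap
        map_add' := fun _ _ => rfl
        map_smul' := fun _ _ => rfl }
    natural := fun _ _ _ _ _ _ _ _ => rfl
    map_mul := fun S _ _ f g => hm S f g
    map_one := fun _ _ _ => h1 _
    exists_dual := ⟨h, fun _ _ _ _ => rfl⟩ }

lemma FormalMonoid.dual_homMk {G G' : FormalMonoid R} (h : G.carrier →ₐ[R] G'.carrier) (hm h1) :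
    FormalMonoid.Hom.dual (FormalMonoid.homMk (G := G) (G' := G') h hm h1) = h :=
  FormalMonoid.Hom.dual_unique _ _ fun _ _ _ _ => rfl

lemma FormalMonoid.hom_ext {G G' : FormalMonoid R} {p q : G ⟶ G'}
    (h : FormalMonoid.Hom.dual p = FormalMonoid.Hom.dual q) : p = q := by
  refine FormalMonoid.Hom.ext ?_
  funext S _ _
  refine LinearMap.ext fun f => ?_
  rw [FormalMonoid.Hom.app_eq, FormalMonoid.Hom.app_eq, h]

lemma FormalMonoid.isIso_of_bijective_dual {G G' : FormalMonoid R} (p : G ⟶ G')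
    (h : Function.Bijective (FormalMonoid.Hom.dual p)) : IsIso p := by
  let i := AlgEquiv.ofBijective (FormalMonoid.Hom.dual p) h
  have hi : ∀ {S : Type u} [CommRing S] [Algebra R S] (f : G.carrier →ₗ[R] S),
      (f ∘ₗ i.symm.toAlgHom.toLinearMap) ∘ₗ (FormalMonoid.Hom.dual p).toLinearMap = f := by
    intro S _ _ f
    ext a
    exact congrArg f (i.symm_apply_apply a)
  have hi' : ∀ {S : Type u} [CommRing S] [Algebra R S] (f : G'.carrier →ₗ[R] S),
      (f ∘ₗ (FormalMonoid.Hom.dual p).toLinearMap) ∘ₗ i.symm.toAlgHom.toLinearMap = f := by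
    intro S _ _ f
    ext a
    exact congrArg f (i.apply_symm_apply a)
  let q : G' ⟶ G := FormalMonoid.homMk i.symm.toAlgHom (fun S _ _ f g => by
      have h1 := FormalMonoid.Hom.map_mul p S (f ∘ₗ i.symm.toAlgHom.toLinearMap)
        (g ∘ₗ i.symm.toAlgHom.toLinearMap)
      rw [FormalMonoid.Hom.app_eq, FormalMonoid.Hom.app_eq, FormalMonoid.Hom.app_eq, hi, hi] at h1
      rw [← h1, hi']) (fun S _ _ => by
      have h1 := FormalMonoid.Hom.map_one p S
      rw [FormalMonoid.Hom.app_eq] at h1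
      rw [← h1, hi'])
  have hq : FormalMonoid.Hom.dual q = i.symm.toAlgHom := FormalMonoid.dual_homMk _ _ _
  refine ⟨q, FormalMonoid.hom_ext ?_, FormalMonoid.hom_ext ?_⟩
  · rw [FormalMonoid.Hom.dual_comp, FormalMonoid.Hom.dual_id, hq]
    exact AlgHom.ext fun a => i.symm_apply_apply a
  · rw [FormalMonoid.Hom.dual_comp, FormalMonoid.Hom.dual_id, hq]
    exact AlgHom.ext fun a => i.apply_symm_apply a

lemma LieAlgCat.isIso_of_bijective {L L' : LieAlgCat R} (p : L ⟶ L')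
    (h : Function.Bijective (LieAlgCat.toLieHom p)) : IsIso p := by
  let i := LieEquiv.ofBijective (LieAlgCat.toLieHom p) h
  exact ⟨(i.symm : L'.carrier →ₗ⁅R⁆ L.carrier), LieHom.ext fun x => i.symm_apply_apply x,
    LieHom.ext fun x => i.apply_symm_apply x⟩

lemma dual_envelopingFunctor_map {L L' : LieAlgCat R} (p : L ⟶ L') :
    FormalMonoid.Hom.dual ((envelopingFunctor R).map p) = uMap R (LieAlgCat.toLieHom p) :=
  FormalMonoid.Hom.dual_unique _ _ fun _ _ _ _ => rfl

/-- The canonical morphism `Spec 𝒰(T_e 𝔾)* → 𝔾`. -/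
def envelopingTangentApp (G : FormalMonoid R) :
    (envelopingFunctor R).obj ((tangentFunctor R).obj G) ⟶ G :=
  FormalMonoid.homMk
    (G := (envelopingFunctor R).obj ((tangentFunctor R).obj G)) (G' := G) (envelopingToCarrier G)
    (fun S _ _ f g => (mul_comp_envelopingToCarrier G S).1 f g)
    (fun S _ _ => (mul_comp_envelopingToCarrier G S).2)

lemma dual_envelopingTangentApp (G : FormalMonoid R) :
    FormalMonoid.Hom.dual (envelopingTangentApp G) = envelopingToCarrier G :=
  FormalMonoid.Hom.dual_unique _ _ fun _ _ _ _ => rfl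

lemma dual_envelopingTangentApp_ι (G : FormalMonoid R) (x : tangentSpace G) :
    FormalMonoid.Hom.dual (envelopingTangentApp G) (UniversalEnvelopingAlgebra.ι R x) = x.1 :=
  (congrArg (fun q => q (UniversalEnvelopingAlgebra.ι R x)) (dual_envelopingTangentApp G)).trans
    (envelopingToCarrier_ι G x)

variable (R) in
/-- The canonical morphisms `Spec 𝒰(T_e 𝔾)* → 𝔾`, as a natural transformation. -/
def envelopingTangent : tangentFunctor R ⋙ envelopingFunctor R ⟶ 𝟭 (FormalMonoid R) where
  app G := envelopingTangentApp G
  naturality G G' p := by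
    refine FormalMonoid.hom_ext ((FormalMonoid.Hom.dual_comp _ _).trans
      (Eq.trans ?_ (FormalMonoid.Hom.dual_comp _ _).symm))
    refine uHom_ext (L := tangentSpace G) fun x => ?_
    have h1 : FormalMonoid.Hom.dual ((envelopingFunctor R).map ((tangentFunctor R).map p))
        (UniversalEnvelopingAlgebra.ι R x) = UniversalEnvelopingAlgebra.ι R
          (LieAlgCat.toLieHom ((tangentFunctor R).map p) x) := by
      rw [dual_envelopingFunctor_map]
      exact uMap_ι _ x
    exact ((congrArg (FormalMonoid.Hom.dual (envelopingTangentApp G')) h1).trans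
      (dual_envelopingTangentApp_ι G' _)).trans
        (congrArg (FormalMonoid.Hom.dual p) (dual_envelopingTangentApp_ι G x)).symm

lemma dual_envelopingTangent_app (G : FormalMonoid R) :
    FormalMonoid.Hom.dual ((envelopingTangent R).app G) = envelopingToCarrier G :=
  dual_envelopingTangentApp G

variable (R) in
/-- The canonical morphism `L → T_e (Spec 𝒰(L)*)`. -/
def tangentEnveloping : 𝟭 (LieAlgCat R) ⟶ envelopingFunctor R ⋙ tangentFunctor R where
  app L := show L.carrier →ₗ⁅R⁆ tangentSpace (FormalMonoid.ofBialgebra (R := R)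
      (UniversalEnvelopingAlgebra R L.carrier)) from
    { toFun := fun x => ⟨UniversalEnvelopingAlgebra.ι R x,
        isTangent_ofBialgebra_iff.2 (isPrimitive_ι R x)⟩
      map_add' := fun x y => Subtype.ext (map_add (UniversalEnvelopingAlgebra.ι R) x y)
      map_smul' := fun r x => Subtype.ext (map_smul (UniversalEnvelopingAlgebra.ι R) r x)
      map_lie' := fun {x y} => Subtype.ext (LieHom.map_lie (UniversalEnvelopingAlgebra.ι R) x y) }
  naturality L L' p := by
    refine LieHom.ext fun x => Subtype.ext ?_
    show UniversalEnvelopingAlgebra.ι R (LieAlgCat.toLieHom p x) =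
      FormalMonoid.Hom.dual ((envelopingFunctor R).map p) (UniversalEnvelopingAlgebra.ι R x)
    rw [dual_envelopingFunctor_map]
    exact (uMap_ι _ x).symm

lemma tangentToU_tangentEnveloping (L : LieAlgCat R) (x : L.carrier) :
    tangentToU L (LieAlgCat.toLieHom ((tangentEnveloping R).app L) x) =
      UniversalEnvelopingAlgebra.ι R x := rfl

/-- One triangle identity; it suffices to identify the preimage in the fullness argument. -/
lemma tangentEnveloping_comp_map_envelopingTangent (G : FormalMonoid R) :
    (tangentEnveloping R).app ((tangentFunctor R).obj G) ≫
      (tangentFunctor R).map ((envelopingTangent R).app G) = 𝟙 _ := by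
  refine LieHom.ext fun x => Subtype.ext ?_
  show FormalMonoid.Hom.dual ((envelopingTangent R).app G)
    (UniversalEnvelopingAlgebra.ι R (show tangentSpace G from x)) = (show tangentSpace G from x).1
  rw [dual_envelopingTangent_app]
  exact envelopingToCarrier_ι G x

variable [Algebra ℚ R]

lemma isIso_envelopingTangent (G : FormalMonoid R) (hG : IsFlatInfinitesimalGroup G) :
    IsIso ((envelopingTangent R).app G) :=
  FormalMonoid.isIso_of_bijective_dual _ (by
    rw [dual_envelopingTangent_app]
    exact envelopingToCarrier_bijective G hG)

lemma isIso_tangentEnveloping (L : LieAlgCat R) : IsIso ((tangentEnveloping R).app L) := by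
  refine LieAlgCat.isIso_of_bijective _ ⟨fun x y h => ?_, fun a => ?_⟩
  · exact ι_injective R (congrArg (tangentToU L) h)
  · obtain ⟨x, hx⟩ := exists_ι_eq_of_isPrimitive R (isTangent_ofBialgebra_iff.1
      (show tangentSpace (FormalMonoid.ofBialgebra (R := R)
        (UniversalEnvelopingAlgebra R L.carrier)) from a).2)
    exact ⟨x, Subtype.ext hx⟩

/-- Naturality of `envelopingTangent`, which is invertible at `G` and `G'`, recovers `p` from its
tangent map. For fullness, `Spec 𝒰(φ)*` is transported along these isomorphisms, and the triangle
identity computes its tangent map. -/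
lemma tangentFunctor_map_bijective (G G' : FormalMonoid R) (hG : IsFlatInfinitesimalGroup G)
    (hG' : IsFlatInfinitesimalGroup G') :
    Function.Bijective (fun p : G ⟶ G' => (tangentFunctor R).map p) := by
  have := isIso_envelopingTangent G hG
  have := isIso_envelopingTangent G' hG'
  constructor
  · intro p q h
    have h1 : (envelopingFunctor R).map ((tangentFunctor R).map p) =
        (envelopingFunctor R).map ((tangentFunctor R).map q) := congrArg _ h
    have hp := (envelopingTangent R).naturality p
    have hq := (envelopingTangent R).naturality q
    rw [Functor.comp_map, h1] at hp
    rw [Functor.comp_map, hp] at hq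
    exact (cancel_epi ((envelopingTangent R).app G)).1 hq
  · intro φ
    refine ⟨inv ((envelopingTangent R).app G) ≫ (envelopingFunctor R).map φ ≫
      (envelopingTangent R).app G', ?_⟩
    have h1 := (tangentEnveloping R).naturality φ
    have h2 : (tangentFunctor R).map ((envelopingTangent R).app G) ≫
        (tangentFunctor R).map (inv ((envelopingTangent R).app G) ≫ (envelopingFunctor R).map φ ≫
          (envelopingTangent R).app G') = (tangentFunctor R).map ((envelopingFunctor R).map φ) ≫
            (tangentFunctor R).map ((envelopingTangent R).app G') := by
      rw [← Functor.map_comp, ← Functor.map_comp, IsIso.hom_inv_id_assoc]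
    have h3 : _ ≫ _ = _ ≫ _ :=
      congrArg (fun q => (tangentEnveloping R).app ((tangentFunctor R).obj G) ≫ q) h2
    rw [← Category.assoc, tangentEnveloping_comp_map_envelopingTangent, Category.id_comp] at h3
    refine h3.trans ?_
    have h4 : (tangentEnveloping R).app ((tangentFunctor R).obj G) ≫
        (tangentFunctor R).map ((envelopingFunctor R).map φ) =
          φ ≫ (tangentEnveloping R).app ((tangentFunctor R).obj G') := h1.symm
    rw [← Category.assoc, h4, Category.assoc, tangentEnveloping_comp_map_envelopingTangent]
    exact Category.comp_id φ

lemma flatLie_tangent (G : FlatInfFormalGroup R) :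
    flatLie R (((flatInfinitesimalGroup R).ι ⋙ tangentFunctor R).obj G) :=
  flat_tangentSpace G.obj G.property

lemma flatInfinitesimalGroup_enveloping (L : FlatLieAlg R) :
    flatInfinitesimalGroup R (((flatLie R).ι ⋙ envelopingFunctor R).obj L) :=
  have : Module.Flat R L.obj.carrier := L.property
  isFlatInfinitesimalGroup_uea (R := R) (L := L.obj.carrier)

variable (R) in
/-- `𝔾 ↦ T_e 𝔾`, on flat infinitesimal formal groups. -/
def flatTangentFunctor : FlatInfFormalGroup R ⥤ FlatLieAlg R :=
  (flatLie R).lift ((flatInfinitesimalGroup R).ι ⋙ tangentFunctor R) flatLie_tangent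

variable (R) in
/-- `L ↦ Spec 𝒰(L)*`, on flat Lie algebras. -/
def flatEnvelopingFunctor : FlatLieAlg R ⥤ FlatInfFormalGroup R :=
  (flatInfinitesimalGroup R).lift ((flatLie R).ι ⋙ envelopingFunctor R)
    flatInfinitesimalGroup_enveloping

/-- The isomorphism `Spec 𝒰(T_e 𝔾)* ≅ 𝔾`. -/
def flatEnvelopingTangentIso (G : FlatInfFormalGroup R) :
    (flatEnvelopingFunctor R).obj ((flatTangentFunctor R).obj G) ≅ G :=
  ObjectProperty.isoMk _
    (@asIso _ _ _ _ ((envelopingTangent R).app G.obj) (isIso_envelopingTangent G.obj G.property))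

/-- The isomorphism `L ≅ T_e (Spec 𝒰(L)*)`. -/
def flatTangentEnvelopingIso (L : FlatLieAlg R) :
    L ≅ (flatTangentFunctor R).obj ((flatEnvelopingFunctor R).obj L) :=
  ObjectProperty.isoMk _
    (@asIso _ _ _ _ ((tangentEnveloping R).app L.obj) (isIso_tangentEnveloping L.obj))

variable (R) in
/-- The equivalence between flat infinitesimal formal groups and flat Lie algebras. -/
def flatEquivalence : FlatInfFormalGroup R ≌ FlatLieAlg R :=
  CategoryTheory.Equivalence.mk (flatTangentFunctor R) (flatEnvelopingFunctor R)
    (NatIso.ofComponents (F := flatTangentFunctor R ⋙ flatEnvelopingFunctor R) (G := 𝟭 _)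
      flatEnvelopingTangentIso (fun {G G' : FlatInfFormalGroup R} (p : G ⟶ G') =>
        ObjectProperty.hom_ext _ ((envelopingTangent R).naturality p.hom))).symm
    (NatIso.ofComponents (F := 𝟭 _) (G := flatEnvelopingFunctor R ⋙ flatTangentFunctor R)
      flatTangentEnvelopingIso (fun {L L' : FlatLieAlg R} (p : L ⟶ L') =>
        ObjectProperty.hom_ext _ ((tangentEnveloping R).naturality p.hom))).symm

end Equivalence

end FormalGrp

end

/-! ### The main theorem. -/

theorem mainTheorem11 (R : Type u) [CommRing R] [Algebra ℚ R] :
    -- `𝔾 ↦ T_e 𝔾` and `L ↦ Spec 𝒰(L)*` restrict to functors between the two categories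
    ∃ (hT : ∀ G : FormalGrp.FlatInfFormalGroup R, FormalGrp.flatLie R
        (((FormalGrp.flatInfinitesimalGroup R).ι ⋙ FormalGrp.tangentFunctor R).obj G))
      (hU : ∀ L : FormalGrp.FlatLieAlg R, FormalGrp.flatInfinitesimalGroup R
        (((FormalGrp.flatLie R).ι ⋙ FormalGrp.envelopingFunctor R).obj L)),
      -- which are mutually inverse equivalences;
      (∃ e : FormalGrp.FlatInfFormalGroup R ≌ FormalGrp.FlatLieAlg R,
        e.functor = (FormalGrp.flatLie R).lift
          ((FormalGrp.flatInfinitesimalGroup R).ι ⋙ FormalGrp.tangentFunctor R) hT ∧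
        e.inverse = (FormalGrp.flatInfinitesimalGroup R).lift
          ((FormalGrp.flatLie R).ι ⋙ FormalGrp.envelopingFunctor R) hU) ∧
      -- `Hom_grp(𝔾, 𝔾') = Hom_Lie(T_e 𝔾, T_e 𝔾')`;
      (∀ G G' : FormalGrp.FlatInfFormalGroup R, Function.Bijective
        (fun p : G.obj ⟶ G'.obj => (FormalGrp.tangentFunctor R).map p)) ∧
      -- the canonical morphism `U(T_e 𝔾) → A` is dual to an isomorphism `Spec 𝒰(T_e 𝔾)* ≅ 𝔾`;
      (∀ G : FormalGrp.FlatInfFormalGroup R,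
        ∃ i : (FormalGrp.envelopingFunctor R).obj ((FormalGrp.tangentFunctor R).obj G.obj) ≅ G.obj,
          FormalGrp.FormalMonoid.Hom.dual i.hom = FormalGrp.envelopingToCarrier G.obj) ∧
      -- the canonical map `L → U(L)` is an isomorphism of `L` onto `T_e (Spec 𝒰(L)*)`.
      (∀ L : FormalGrp.FlatLieAlg R,
        ∃ j : L.obj ≅ (FormalGrp.tangentFunctor R).obj ((FormalGrp.envelopingFunctor R).obj L.obj),
          ∀ x : L.obj.carrier,
            FormalGrp.tangentToU L.obj (FormalGrp.LieAlgCat.toLieHom j.hom x) =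
              UniversalEnvelopingAlgebra.ι R x) := by
  refine ⟨FormalGrp.flatLie_tangent, FormalGrp.flatInfinitesimalGroup_enveloping,
    ⟨FormalGrp.flatEquivalence R, rfl, rfl⟩,
    fun G G' => FormalGrp.tangentFunctor_map_bijective G.obj G'.obj G.property G'.property,
    fun G => ?_, fun L => ?_⟩
  · have := FormalGrp.isIso_envelopingTangent G.obj G.property
    exact ⟨asIso ((FormalGrp.envelopingTangent R).app G.obj),
      FormalGrp.dual_envelopingTangent_app G.obj⟩
  · have := FormalGrp.isIso_tangentEnveloping L.obj
    exact ⟨asIso ((FormalGrp.tangentEnveloping R).app L.obj),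
      FormalGrp.tangentToU_tangentEnveloping L.obj⟩
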